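/- Let $n>1$, $m\in\mathbb R$, $c>n$. For $s$ in a neighbourhood of $c$ let $\phi_s$ be the solitary wave profile of speed $s$ of the magma equation $\partial_t\phi+\partial_x(\phi^n)-\partial_x[\phi^n\partial_x(\phi^{-m}\partial_t\phi)]=0$, i.e. the even $C^2$ function $\phi_s>1$ with $\phi_s(y)\to1$ as $y\to\pm\infty$ and $$-s(\phi_s-1)+\phi_s^n-1+s\,\phi_s^n\,\partial_y(\phi_s^{-m}\partial_y\phi_s)=0 .$$ Put $\gamma=\sqrt{(c-n)/c}$ and let $0<a\le a_\star(c)$, where $$a_\star(c)=\min\Big\{\tfrac13\gamma,\ \tfrac12\inf_x\phi_c(x)^{(m-n)/2},\ \tfrac12\sqrt{\tfrac{2c}{n+2c+\sqrt{n(n+8c)}}}\sqrt{\tfrac{c-n}{c}}\Big\}.$$ Let $$\mathcal N[\phi]=\int_{\mathbb R}\Big(\tfrac12\phi^{-2m}\phi_x^2+V(\phi)\Big)dx,$$ where $V(\phi)=\phi\log\phi-\phi+1$ if $n+m=1$, $V(\phi)=\phi-1-\log\phi$ if $n+m=2$, and $V(\phi)=\frac{\phi^{2-n-m}-1+(n+m-2)(\phi-1)}{(n+m-1)(n+m-2)}$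 otherwise. Assume $\partial_c\mathcal N[\phi_c]\ne0$ and put $\Theta=(\partial_c\mathcal N[\phi_c])^{-1}$. Let $$M=I-\partial_x(\phi_c^n\partial_x(\phi_c^{-m}\,\cdot\,)),\qquad M^\star=I-\phi_c^{-m}\partial_x(\phi_c^n\partial_x\,\cdot\,),$$ $$L_c=-c\phi_c^n\partial_x^2(\phi_c^{-m}\,\cdot\,)+[c-n\phi_c^{-1}+cn(\phi_c^{-1}-1)],\qquad L_c^\star=-c\phi_c^{-m}\partial_x^2(\phi_c^n\,\cdot\,)+[c-n\phi_c^{-1}+cn(\phi_c^{-1}-1)],$$ and let $A_a=e^{ax}M^{-1}\partial_xL_ce^{-ax}$ be the unbounded operator on $L^2(\mathbb R;\mathbb C)$ with maximal domain: $w\in D(A_a)$ and $A_aw=f$ if and only if $w,f\in L^2$ and $M(e^{-ax}f)=\partial_xL_c(e^{-ax}w)$ in the sense of distributions. For an operator $T$ write $\ker_g(T)=\bigcup_k\ker(T^k)$. Then $A_a$ is well defined (single-valued) and densely defined, so that its $L^2$ adjoint $A_a^\star$ exists, $s\mapsto\phi_s(x)$ is differentiable at $s=c$ for every $x$, and the following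 holds. Put $$\tilde\xi_1=\partial_x\phi_c,\quad\tilde\xi_2=\partial_c\phi_c,\quad W(x)=\int_{-\infty}^x\frac{\partial_x\phi_c}{\phi_c^{n+m}}\,dx,\quad\tilde\eta_2=\Theta M^\star W,\quad\tilde\eta_1=\Theta M^\star\int_{-\infty}^x g\,dx,$$ where $g$ is a real-valued $C^2$ function in $L^2(\mathbb R)$ with $L_c^\star g=M^\star W$, that is, a value of $(L_c^\star)^{-1}M^\star W$. Put $\xi_j=e^{ax}\tilde\xi_j$, $\eta_j=e^{-ax}\tilde\eta_j$. 1. $\xi_1,\xi_2\in L^2$, $\{\xi_1,\xi_2\}$ is a basis of $\ker_g(A_a)$, and $A_a\xi_1=0$, $A_a\xi_2=-\xi_1$. 2. For every such $g$: $\eta_1,\eta_2\in L^2$, $\{\eta_1,\eta_2\}$ is a basis of $\ker_g(A_a^\star)$, and $A_a^\star\eta_2=0$, $A_a^\star\eta_1=-\eta_2$. 3. There is exactly one such $g$ for which the two bases are biorthogonal, $\langle\xi_i,\eta_j\rangle=\delta_{ij}$ for $i,j=1,2$. -/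

import Mathlib

open MeasureTheory Filter Topology
open scoped ContDiff

noncomputable section

/-- `φ` is the profile of a solitary wave of speed `c` of the magma equation with exponents `n`, `m`:
an even classical solution, in excess of the reference state `1`, of the once integrated travelling
wave equation `-c (φ - 1) + φ ^ n - 1 + c φ ^ n (φ ^ (-m) φ')' = 0`, with `φ → 1` at `±∞`. -/
structure IsSolitaryWave (n m c : ℝ) (φ : ℝ → ℝ) : Prop where
  contDiff : ContDiff ℝ 2 φ
  even : ∀ y, φ (-y) = φ y
  one_lt : ∀ y, 1 < φ y
  ode : ∀ y, -c * (φ y - 1) + φ y ^ n - 1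
    + c * φ y ^ n * deriv (fun z => φ z ^ (-m) * deriv φ z) y = 0
  tendsto_atTop : Tendsto φ atTop (𝓝 1)
  tendsto_atBot : Tendsto φ atBot (𝓝 1)

/-- The potential part of the density of the invariant `𝒩`. -/
def energyPotential (n m s : ℝ) : ℝ :=
  if n + m = 1 then s * Real.log s - s + 1
  else if n + m = 2 then s - 1 - Real.log s
  else (s ^ (2 - n - m) - 1 + (n + m - 2) * (s - 1)) / ((n + m - 1) * (n + m - 2))

/-- The invariant `𝒩[φ] = ∫ (1/2) φ ^ (-2 m) (φ') ^ 2 + (potential)`. -/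
def energy (n m : ℝ) (φ : ℝ → ℝ) : ℝ :=
  ∫ x, (1 / 2 * φ x ^ (-2 * m) * deriv φ x ^ 2 + energyPotential n m (φ x))

/-- `γ = √((c - n) / c)`. -/
def gammaOf (n c : ℝ) : ℝ := Real.sqrt ((c - n) / c)

/-- The largest admissible exponential weight `a⋆(c) = min {a₁, a₂, a₃ / 2}` with `a₁ = γ / 3`,
`a₂ = (1 / 2) inf φ ^ ((m - n) / 2)`,
`a₃ = √(2 c / (n + 2 c + √(n (n + 8 c)))) √((c - n) / c)`. -/
def aStar (n m c : ℝ) (φ : ℝ → ℝ) : ℝ :=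
  min (1 / 3 * gammaOf n c)
    (min (1 / 2 * ⨅ x, φ x ^ ((m - n) / 2))
      (1 / 2 * (Real.sqrt (2 * c / (n + 2 * c + Real.sqrt (n * (n + 8 * c))))
        * Real.sqrt ((c - n) / c))))

/-- `I - φ ^ (-m) ∂ (φ ^ n ∂ ·)`, the formal adjoint of `M = I - ∂ (φ ^ n ∂ (φ ^ (-m) ·))`. -/
def adjM (n m : ℝ) (φ f : ℝ → ℝ) : ℝ → ℝ := fun x =>
  f x - φ x ^ (-m) * deriv (fun y => φ y ^ n * deriv f y) x

/-- The formal adjoint `L⋆ = -c φ ^ (-m) ∂² (φ ^ n ·) + [c - n φ⁻¹ + c n (φ⁻¹ - 1)]` of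
`L = -c φ ^ n ∂² (φ ^ (-m) ·) + [c - n φ⁻¹ + c n (φ⁻¹ - 1)]`. -/
def adjL (n m c : ℝ) (φ f : ℝ → ℝ) : ℝ → ℝ := fun x =>
  -c * φ x ^ (-m) * deriv (deriv (fun y => φ y ^ n * f y)) x
    + (c - n * (φ x)⁻¹ + c * n * ((φ x)⁻¹ - 1)) * f x

/-- The complex Hilbert space `L²(ℝ)`. -/
abbrev L2C : Type := Lp ℂ 2 (volume : Measure ℝ)

/-- The graph of `A_a = e^{ax} A e^{-ax}`, `A = M⁻¹ ∂ L`, in `L²(ℝ)`: all pairs `(w, f)` such that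
`M (e^{-ax} f) = ∂ L (e^{-ax} w)` in the sense of distributions, that is,
`∫ (M⋆ χ) e^{-ax} f = - ∫ (L⋆ χ') e^{-ax} w` for all test functions `χ`.
(For `φ` of class `C²` with `φ > 0` the two integrands are automatically integrable, being products
of an `L²` function and a continuous function with compact support.) -/
def linGraph (n m c a : ℝ) (φ : ℝ → ℝ) : Submodule ℂ (L2C × L2C) where
  carrier := {p | ∀ χ : ℝ → ℝ, ContDiff ℝ ∞ χ → HasCompactSupport χ →
    Integrable (fun x => (adjM n m φ χ x * Real.exp (-(a * x))) • p.2 x) ∧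
    Integrable (fun x => (adjL n m c φ (deriv χ) x * Real.exp (-(a * x))) • p.1 x) ∧
    ∫ x, (adjM n m φ χ x * Real.exp (-(a * x))) • p.2 x
      = - ∫ x, (adjL n m c φ (deriv χ) x * Real.exp (-(a * x))) • p.1 x}
  zero_mem' := by
    intro χ _ _
    have h0 : ∀ r : ℝ → ℝ, (fun x => r x • ((0 : L2C) : ℝ → ℂ) x) =ᵐ[volume] fun _ => (0 : ℂ) := by
      intro r
      filter_upwards [Lp.coeFn_zero ℂ 2 (volume : Measure ℝ)] with x hx
      rw [hx]
      simp
    refine ⟨(integrable_congr (h0 _)).2 (integrable_zero _ _ _),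
      (integrable_congr (h0 _)).2 (integrable_zero _ _ _), ?_⟩
    have h1 := integral_congr_ae (h0 fun x => adjM n m φ χ x * Real.exp (-(a * x)))
    have h2 := integral_congr_ae (h0 fun x => adjL n m c φ (deriv χ) x * Real.exp (-(a * x)))
    simp only [Prod.fst_zero, Prod.snd_zero]
    rw [h1, h2]
    simp
  add_mem' := by
    intro p q hp hq χ h1 h2
    obtain ⟨p1, p2, p3⟩ := hp χ h1 h2
    obtain ⟨q1, q2, q3⟩ := hq χ h1 h2
    have key : ∀ (r : ℝ → ℝ) (u v : L2C), (fun x => r x • (u + v : L2C) x) =ᵐ[volume]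
        fun x => r x • u x + r x • v x := by
      intro r u v
      filter_upwards [Lp.coeFn_add u v] with x hx
      rw [hx, Pi.add_apply, smul_add]
    refine ⟨(integrable_congr (key _ _ _)).2 (p1.add q1),
      (integrable_congr (key _ _ _)).2 (p2.add q2), ?_⟩
    have e1 := integral_congr_ae (key (fun x => adjM n m φ χ x * Real.exp (-(a * x))) p.2 q.2)
    have e2 := integral_congr_ae
      (key (fun x => adjL n m c φ (deriv χ) x * Real.exp (-(a * x))) p.1 q.1)
    simp only [Prod.fst_add, Prod.snd_add]
    rw [e1, e2, integral_add p1 q1, integral_add p2 q2, p3, q3]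
    ring
  smul_mem' := by
    intro z p hp χ h1 h2
    obtain ⟨p1, p2, p3⟩ := hp χ h1 h2
    have key : ∀ (r : ℝ → ℝ) (u : L2C), (fun x => r x • (z • u : L2C) x) =ᵐ[volume]
        fun x => z • (r x • u x) := by
      intro r u
      filter_upwards [Lp.coeFn_smul z u] with x hx
      rw [hx, Pi.smul_apply, smul_comm]
    refine ⟨(integrable_congr (key _ _)).2 (p1.smul z),
      (integrable_congr (key _ _)).2 (p2.smul z), ?_⟩
    have e1 := integral_congr_ae (key (fun x => adjM n m φ χ x * Real.exp (-(a * x))) p.2)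
    have e2 := integral_congr_ae
      (key (fun x => adjL n m c φ (deriv χ) x * Real.exp (-(a * x))) p.1)
    simp only [Prod.smul_fst, Prod.smul_snd]
    rw [e1, e2, integral_smul, integral_smul, p3, smul_neg]

/-- The unbounded operator `A_a` on `L²(ℝ)`, with its maximal domain. -/
def linOp (n m c a : ℝ) (φ : ℝ → ℝ) : L2C →ₗ.[ℂ] L2C :=
  (linGraph n m c a φ).toLinearPMap

/-- `ker (T ^ k)` for an unbounded operator `T`. -/
def kerPow {E : Type*} [AddCommGroup E] [Module ℂ E] (T : E →ₗ.[ℂ] E) : ℕ → Submodule ℂ E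
  | 0 => ⊥
  | k + 1 => ((kerPow T k).comap T.toFun).map T.domain.subtype

/-- The generalized kernel `⋃ₖ ker (T ^ k)` of an unbounded operator `T`. -/
def genKer {E : Type*} [AddCommGroup E] [Module ℂ E] (T : E →ₗ.[ℂ] E) : Submodule ℂ E :=
  ⨆ k, kerPow T k

/-- The family `v` is a basis of the subspace `K`. -/
def IsBasisOf {E : Type*} [AddCommGroup E] [Module ℂ E] (v : Fin 2 → E) (K : Submodule ℂ E) : Prop :=
  LinearIndependent ℂ v ∧ Submodule.span ℂ (Set.range v) = K

/-- `∂_c 𝒩[φ_c]`. -/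
def dEnergy (n m : ℝ) (φ : ℝ → ℝ → ℝ) (c : ℝ) : ℝ := deriv (fun s => energy n m (φ s)) c

/-- `M⋆ ∫_{-∞}^x φ^{-(n+m)} φ'`. -/
def baseFun (n m : ℝ) (φ : ℝ → ℝ) : ℝ → ℝ :=
  adjM n m φ (fun x => ∫ t in Set.Iic x, deriv φ t / φ t ^ (n + m))

/-- `g` is a value of `(L⋆)⁻¹ M⋆ ∫_{-∞}^x φ^{-(n+m)} φ'`: a square integrable classical solution of
`L⋆ g = M⋆ ∫_{-∞}^x φ^{-(n+m)} φ'`. -/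
structure IsPreimage (n m c : ℝ) (φ g : ℝ → ℝ) : Prop where
  contDiff : ContDiff ℝ 2 g
  memLp : MemLp g 2 volume
  eq : ∀ x, adjL n m c φ g x = baseFun n m φ x

/-- `η̃₁ = Θ M⋆ ∫_{-∞}^x g` with `Θ = (∂_c 𝒩[φ_c])⁻¹`. -/
def etaTilde₁ (n m : ℝ) (φ : ℝ → ℝ → ℝ) (c : ℝ) (g : ℝ → ℝ) : ℝ → ℝ := fun x =>
  (dEnergy n m φ c)⁻¹ * adjM n m (φ c) (fun y => ∫ t in Set.Iic y, g t) x

/-- `η̃₂ = Θ M⋆ ∫_{-∞}^x φ_c^{-(n+m)} ∂_x φ_c` with `Θ = (∂_c 𝒩[φ_c])⁻¹`. -/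
def etaTilde₂ (n m : ℝ) (φ : ℝ → ℝ → ℝ) (c : ℝ) : ℝ → ℝ := fun x =>
  (dEnergy n m φ c)⁻¹ * baseFun n m (φ c) x

/-- The element `u` of `L²(ℝ)` is the class of the function `x ↦ e^{bx} f(x)`. -/
def Represents (u : L2C) (b : ℝ) (f : ℝ → ℝ) : Prop :=
  ∀ᵐ x, u x = ((Real.exp (b * x) * f x : ℝ) : ℂ)

end

/-! Write ψ = φ^(-m) φ'. In the variable u = ∫₁^φ τ^(-m) dτ the profile equation is Newton's
equation u' = ψ, ψ' = force(φ), with conserved energy ψ²/2 = A(φ) - B(φ)/s (`psi_sq`). The quotient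
B/A is strictly increasing, so the only turning value is the maximum φ(0), determined by (B/A)(φ(0))
= s. Hence ψ is odd, is negative on (0, ∞), and has no zero in common with ψ'. Since force'(1) = 1 -
n/c = γ², barrier arguments give exponential decay at the rate b = γ/2.

The substitution w = φ^m v turns L w into c φ^n (-v'' + q v) with q = φ^m force'(φ), and ψ'' = q ψ.
The spectral statements thereby reduce to a scalar Schrödinger equation with an exponentially
decaying zero mode, whose Fredholm alternative is elementary (`exists_dec_solution`,
`eq_mul_zero_mode`). The second order equation behind M is solved by a contraction (`exists_green`).

The distributional relation defining A_a extends to test functions χ that decay like e^(bx) at -∞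
and are merely bounded at +∞ (`Rel.extend`): for 0 < a < b the weight e^(-ax) repairs the right end
without spoiling the left one. Primitives from -∞ are therefore admissible. Solving M⋆χ = ρ shows
that A_a is single-valued. Solving L⋆χ' = c φ^(-m) ρ for ρ ⊥ ψ shows that ker A_a is spanned by ξ₁.
The range contains e^(ax) K' for every test function K with ∫ K' M⋆W = 0; a vector orthogonal to it
is a combination of e^(-ax) M⋆W and e^(-ax), and the latter is not square integrable.

Differentiability in the speed starts from the amplitude, where the inverse function theorem applies
to B/A. Gronwall's inequality carries it to bounded intervals, and the maximum principle makes the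
Lipschitz bounds uniform on the line. With ∂_cφ = φ^m v one gets v'' = q v + (1 - φ^(-n))/c², which
is A_a ξ₂ = -ξ₁ (`exists_variation`, `rel_variation`). The adjoint chain comes from A_a⋆(e^(-ax)
M⋆χ) = -e^(-ax) L⋆χ' with χ = W and χ = ∫_{-∞}^x g.

Differentiation of the invariant gives ∂_c𝒩 = ∫ (M⋆W) ∂_cφ (`dEnergy_eq`), so ⟨ξ₂, η₂⟩ = 1. Thus η₂
annihilates the range of A_a but not ξ₂, and the Jordan chain stops at length two
(`genKer_eq_span`); ξ₁ plays the same role for the adjoint. The chain relations force ⟨ξ₁, η₂⟩ = 0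
and ⟨ξ₁, η₁⟩ = 1. The preimages g form a line g₀ + k W', along which ⟨ξ₂, η₁⟩ changes by exactly k,
so one and only one g makes the bases biorthogonal. -/

noncomputable section

/-! ### Smooth functions whose derivatives are all dominated by a weight -/

/-- The function `f` is smooth and its derivatives of order at most `k` are `O(w)`. -/
def DecN (w : ℝ → ℝ) : ℕ → (ℝ → ℝ) → Prop
  | 0, f => ContDiff ℝ ∞ f ∧ ∃ C, ∀ x, |f x| ≤ C * w x
  | k + 1, f => (ContDiff ℝ ∞ f ∧ ∃ C, ∀ x, |f x| ≤ C * w x) ∧ DecN w k (deriv f)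

/-- The function `f` is smooth and all its derivatives are `O(w)`. -/
def Dec (w f : ℝ → ℝ) : Prop := ∀ k, DecN w k f

/-- The constant weight. -/
def wOne : ℝ → ℝ := fun _ => 1

theorem DecN.zero {w f : ℝ → ℝ} {k : ℕ} (h : DecN w k f) : DecN w 0 f := by
  cases k with
  | zero => exact h
  | succ k => exact h.1

theorem DecN.contDiff {w f : ℝ → ℝ} {k : ℕ} (h : DecN w k f) : ContDiff ℝ ∞ f := h.zero.1

theorem DecN.bound {w f : ℝ → ℝ} {k : ℕ} (h : DecN w k f) : ∃ C, ∀ x, |f x| ≤ C * w x := h.zero.2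

theorem DecN.pred {w f : ℝ → ℝ} {k : ℕ} (h : DecN w (k + 1) f) : DecN w k f := by
  induction k generalizing f with
  | zero => exact h.1
  | succ k ih => exact ⟨h.1, ih h.2⟩

theorem contDiff_infty_deriv {f : ℝ → ℝ} (h : ContDiff ℝ ∞ f) : ContDiff ℝ ∞ (deriv f) :=
  (contDiff_infty_iff_deriv.1 h).2

theorem hasDerivAt_of_smooth {f : ℝ → ℝ} (h : ContDiff ℝ ∞ f) (x : ℝ) :
    HasDerivAt f (deriv f x) x :=
  ((contDiff_infty_iff_deriv.1 h).1 x).hasDerivAt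

theorem DecN.add {w f g : ℝ → ℝ} {k : ℕ} (hf : DecN w k f) (hg : DecN w k g) :
    DecN w k (fun x => f x + g x) := by
  have h0 : ∀ {f g : ℝ → ℝ}, DecN w 0 f → DecN w 0 g → DecN w 0 (fun x => f x + g x) := by
    rintro f g ⟨hf, C, hC⟩ ⟨hg, D, hD⟩
    refine ⟨hf.add hg, C + D, fun x => ?_⟩
    calc |f x + g x| ≤ |f x| + |g x| := abs_add_le _ _
      _ ≤ _ := by linarith [hC x, hD x]
  induction k generalizing f g with
  | zero => exact h0 hf hg
  | succ k ih =>
    refine ⟨h0 hf.1 hg.1, ?_⟩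
    have : deriv (fun x => f x + g x) = fun x => deriv f x + deriv g x := by
      ext x
      exact ((hasDerivAt_of_smooth hf.contDiff x).add (hasDerivAt_of_smooth hg.contDiff x)).deriv
    rw [this]
    exact ih hf.2 hg.2

theorem DecN.mul {w₁ w₂ f g : ℝ → ℝ} {k : ℕ} (hf : DecN w₁ k f) (hg : DecN w₂ k g) :
    DecN (fun x => w₁ x * w₂ x) k (fun x => f x * g x) := by
  have h0 : ∀ {f g : ℝ → ℝ}, DecN w₁ 0 f → DecN w₂ 0 g →
      DecN (fun x => w₁ x * w₂ x) 0 (fun x => f x * g x) := by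
    rintro f g ⟨hf, C, hC⟩ ⟨hg, D, hD⟩
    refine ⟨hf.mul hg, C * D, fun x => ?_⟩
    rw [abs_mul]
    calc |f x| * |g x| ≤ (C * w₁ x) * (D * w₂ x) :=
          mul_le_mul (hC x) (hD x) (abs_nonneg _) ((abs_nonneg _).trans (hC x))
      _ = _ := by ring
  induction k generalizing f g with
  | zero => exact h0 hf hg
  | succ k ih =>
    refine ⟨h0 hf.1 hg.1, ?_⟩
    have : deriv (fun x => f x * g x) = fun x => deriv f x * g x + f x * deriv g x := by
      ext x
      exact ((hasDerivAt_of_smooth hf.contDiff x).mul (hasDerivAt_of_smooth hg.contDiff x)).deriv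
    rw [this]
    exact (ih hf.2 hg.pred).add (ih hf.pred hg.2)

theorem DecN.mono {w₁ w₂ f : ℝ → ℝ} {k : ℕ} (hf : DecN w₁ k f) {K : ℝ} (h1 : ∀ x, 0 ≤ w₁ x)
    (h : ∀ x, w₁ x ≤ K * w₂ x) : DecN w₂ k f := by
  have h0 : ∀ {f : ℝ → ℝ}, DecN w₁ 0 f → DecN w₂ 0 f := by
    rintro f ⟨hf, C, hC⟩
    refine ⟨hf, |C| * K, fun x => (hC x).trans ?_⟩
    calc C * w₁ x ≤ |C| * w₁ x := mul_le_mul_of_nonneg_right (le_abs_self C) (h1 x)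
      _ ≤ |C| * (K * w₂ x) := mul_le_mul_of_nonneg_left (h x) (abs_nonneg C)
      _ = _ := by ring
  induction k generalizing f with
  | zero => exact h0 hf
  | succ k ih => exact ⟨h0 hf.1, ih hf.2⟩

namespace Dec

variable {w f g : ℝ → ℝ}

theorem contDiff (h : Dec w f) : ContDiff ℝ ∞ f := (h 0).contDiff

theorem bound (h : Dec w f) : ∃ C, ∀ x, |f x| ≤ C * w x := (h 0).bound

theorem deriv (h : Dec w f) : Dec w (_root_.deriv f) := fun k => (h (k + 1)).2

theorem add (hf : Dec w f) (hg : Dec w g) : Dec w (fun x => f x + g x) :=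
  fun k => (hf k).add (hg k)

theorem mul_one (hf : Dec w f) (hg : Dec wOne g) : Dec w (fun x => f x * g x) := fun k => by
  have := (hf k).mul (hg k)
  simpa [wOne] using this

theorem one_mul (hf : Dec wOne f) (hg : Dec w g) : Dec w (fun x => f x * g x) := fun k => by
  have := (hf k).mul (hg k)
  simpa [wOne] using this

theorem mono {w₁ w₂ : ℝ → ℝ} (hf : Dec w₁ f) {K : ℝ} (h1 : ∀ x, 0 ≤ w₁ x)
    (h : ∀ x, w₁ x ≤ K * w₂ x) : Dec w₂ f := fun k => (hf k).mono h1 h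

end Dec

theorem decN_const (c : ℝ) (k : ℕ) : DecN wOne k (fun _ => c) := by
  have h0 : ∀ c : ℝ, DecN wOne 0 (fun _ => c) := fun c =>
    ⟨contDiff_const, |c|, fun x => by simp [wOne]⟩
  induction k generalizing c with
  | zero => exact h0 c
  | succ k ih =>
    refine ⟨h0 c, ?_⟩
    have : deriv (fun _ : ℝ => c) = fun _ => 0 := by ext x; simp
    rw [this]
    exact ih 0

theorem dec_const (c : ℝ) : Dec wOne (fun _ => c) := decN_const c

namespace Dec

variable {w f g : ℝ → ℝ}

theorem const_mul (c : ℝ) (hf : Dec w f) : Dec w (fun x => c * f x) := (dec_const c).one_mul hf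

theorem neg (hf : Dec w f) : Dec w (fun x => -f x) := by
  have := hf.const_mul (-1)
  simpa using this

theorem sub (hf : Dec w f) (hg : Dec w g) : Dec w (fun x => f x - g x) := by
  have := hf.add hg.neg
  simpa [sub_eq_add_neg] using this

theorem of_deriv (hf : ContDiff ℝ ∞ f) (hb : ∃ C, ∀ x, |f x| ≤ C * w x)
    (h : Dec w (_root_.deriv f)) : Dec w f := by
  intro k
  cases k with
  | zero => exact ⟨hf, hb⟩
  | succ k => exact ⟨⟨hf, hb⟩, h k⟩

end Dec

/-- Solutions of linear second order equations inherit decay from the two lowest orders. -/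
theorem dec_of_ode {w y p q F : ℝ → ℝ} (hy : ContDiff ℝ ∞ y) (h0 : ∃ C, ∀ x, |y x| ≤ C * w x)
    (h1 : ∃ C, ∀ x, |deriv y x| ≤ C * w x) (hp : Dec wOne p) (hq : Dec wOne q) (hF : Dec w F)
    (h : ∀ x, deriv (deriv y) x = p x * deriv y x + q x * y x + F x) : Dec w y := by
  -- Carrying `y` and `deriv y` together lets the equation supply one further derivative at each
  -- step.
  have key : ∀ k, DecN w k y ∧ DecN w k (deriv y) := by
    intro k
    induction k with
    | zero => exact ⟨⟨hy, h0⟩, ⟨contDiff_infty_deriv hy, h1⟩⟩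
    | succ k ih =>
      refine ⟨⟨⟨hy, h0⟩, ih.2⟩, ⟨⟨contDiff_infty_deriv hy, h1⟩, ?_⟩⟩
      rw [show deriv (deriv y) = fun x => p x * deriv y x + q x * y x + F x from funext h]
      have e1 := (hp k).mul ih.2
      have e2 := (hq k).mul ih.1
      simp only [wOne, _root_.one_mul] at e1 e2
      exact (e1.add e2).add (hF k)
  exact fun k => (key k).1

/-- Smoothness of solutions of linear second order equations with smooth coefficients. -/
theorem contDiff_of_second_order {y y₁ p q F : ℝ → ℝ} (h1 : ∀ x, HasDerivAt y (y₁ x) x)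
    (h2 : ∀ x, HasDerivAt y₁ (p x * y₁ x + q x * y x + F x) x) (hp : ContDiff ℝ ∞ p)
    (hq : ContDiff ℝ ∞ q) (hF : ContDiff ℝ ∞ F) : ContDiff ℝ ∞ y := by
  have key : ∀ k : ℕ, ContDiff ℝ k y ∧ ContDiff ℝ k y₁ := by
    intro k
    induction k with
    | zero =>
      refine ⟨?_, ?_⟩ <;> simp only [Nat.cast_zero, contDiff_zero]
      · exact continuous_iff_continuousAt.2 fun x => (h1 x).continuousAt
      · exact continuous_iff_continuousAt.2 fun x => (h2 x).continuousAt
    | succ k ih =>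
      have a1 : deriv y = y₁ := funext fun x => (h1 x).deriv
      have a2 : deriv y₁ = fun x => p x * y₁ x + q x * y x + F x := funext fun x => (h2 x).deriv
      have l : ((k : ℕ) : WithTop ℕ∞) ≤ ∞ := by exact_mod_cast le_top
      refine ⟨?_, ?_⟩
      · rw [Nat.cast_succ, contDiff_succ_iff_deriv]
        refine ⟨fun x => (h1 x).differentiableAt, by simp, ?_⟩
        rw [a1]; exact ih.2
      · rw [Nat.cast_succ, contDiff_succ_iff_deriv]
        refine ⟨fun x => (h2 x).differentiableAt, by simp, ?_⟩
        rw [a2]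
        exact (((hp.of_le l).mul ih.2).add ((hq.of_le l).mul ih.1)).add (hF.of_le l)
  exact contDiff_infty.2 fun k => (key k).1

/-! ### Maximum principle, barriers and Gronwall estimates on half-lines -/

/-- A positive value would force a positive interior maximum, where z' = 0 and hence z'' > 0. The
point is then also a local minimum, so z is locally constant and z'' = 0 there. -/
theorem nonpos_of_max_principle {z z₁ z₂ : ℝ → ℝ} {X : ℝ} (h1 : ∀ x, HasDerivAt z (z₁ x) x)
    (h2 : ∀ x, HasDerivAt z₁ (z₂ x) x) (hX : z X ≤ 0) (hinf : ∀ᶠ x in atTop, z x ≤ 0)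
    (hpos : ∀ x, X < x → 0 < z x → z₁ x = 0 → 0 < z₂ x) : ∀ x, X ≤ x → z x ≤ 0 := by
  intro x0 hx0
  by_contra! hz
  obtain ⟨R, hR, hzR⟩ := ((eventually_ge_atTop x0).and hinf).exists
  have hcont : Continuous z := continuous_iff_continuousAt.2 fun x => (h1 x).continuousAt
  obtain ⟨x1, hx1, hmax⟩ := isCompact_Icc.exists_isMaxOn (Set.nonempty_Icc.2 (hx0.trans hR))
    hcont.continuousOn
  have hz1 : 0 < z x1 := hz.trans_le (hmax ⟨hx0, hR⟩)
  have hX1 : X < x1 := lt_of_le_of_ne hx1.1 (by rintro rfl; linarith)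
  have hR1 : x1 < R := lt_of_le_of_ne hx1.2 (by rintro rfl; linarith)
  have hloc : IsLocalMax z x1 := hmax.isLocalMax (Icc_mem_nhds hX1 hR1)
  have hd0 : z₁ x1 = 0 := hloc.hasDerivAt_eq_zero (h1 x1)
  have hd2 := hpos x1 hX1 hz1 hd0
  have e1 : deriv z = z₁ := funext fun x => (h1 x).deriv
  have hmin : IsLocalMin z x1 := isLocalMin_of_deriv_deriv_pos
    (by rw [e1, (h2 x1).deriv]; exact hd2) (by rw [e1]; exact hd0) hcont.continuousAt
  have hconst : ∀ᶠ x in 𝓝 x1, z x = z x1 := by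
    filter_upwards [hloc, hmin] with x ha hb using le_antisymm ha hb
  have hz1' : ∀ᶠ x in 𝓝 x1, z₁ x = 0 := by
    filter_upwards [hconst.eventually_nhds] with x hx
    have := (hasDerivAt_const x (z x1)).congr_of_eventuallyEq hx
    exact (h1 x).unique this
  have := (hasDerivAt_const x1 (0 : ℝ)).congr_of_eventuallyEq hz1'
  rw [(h2 x1).unique this] at hd2
  exact lt_irrefl _ hd2

theorem hasDerivAt_exp_mul (b x : ℝ) :
    HasDerivAt (fun x => Real.exp (b * x)) (b * Real.exp (b * x)) x := by
  have e1 : HasDerivAt (fun x => b * x) b x := by simpa using (hasDerivAt_id x).const_mul b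
  exact e1.exp.congr_deriv (by ring)

theorem hasDerivAt_exp_neg_mul (b x : ℝ) :
    HasDerivAt (fun x => Real.exp (-(b * x))) (-(b * Real.exp (-(b * x)))) x := by
  have e1 := hasDerivAt_exp_mul (-b) x
  simp only [neg_mul] at e1
  exact e1

/-- The function C e^(-bx) + ε e^(bx) is a strict supersolution because b² + δb < κ, and the growing
term dominates any bounded y far out. Compare and let ε → 0. Only a differential inequality is
required, which admits nonlinear equations. -/
theorem le_exp_of_barrier {y y₁ y₂ κ₁ κ₂ : ℝ → ℝ} {X b δ κ B Y C : ℝ}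
    (h1 : ∀ x, HasDerivAt y (y₁ x) x) (h2 : ∀ x, HasDerivAt y₁ (y₂ x) x) (hb : 0 < b)
    (hode : ∀ x, X ≤ x → κ₁ x * y₁ x + κ₂ x * y x - B * Real.exp (-(b * x)) ≤ y₂ x)
    (hκ₁ : ∀ x, X ≤ x → |κ₁ x| ≤ δ) (hκ₂ : ∀ x, X ≤ x → 0 < y x → κ ≤ κ₂ x)
    (hbδ : b ^ 2 + δ * b < κ) (hY : ∀ x, X ≤ x → y x ≤ Y) (hC0 : 0 ≤ C)
    (hCX : Y * Real.exp (b * X) ≤ C) (hCB : B ≤ (κ - δ * b - b ^ 2) * C) :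
    ∀ x, X ≤ x → y x ≤ C * Real.exp (-(b * x)) := by
  have key : ∀ ε : ℝ, 0 < ε → ∀ x, X ≤ x →
      y x - (C * Real.exp (-(b * x)) + ε * Real.exp (b * x)) ≤ 0 := by
    intro ε hε
    have d1 : ∀ x, HasDerivAt (fun x => C * Real.exp (-(b * x)) + ε * Real.exp (b * x))
        (-(b * (C * Real.exp (-(b * x)))) + b * (ε * Real.exp (b * x))) x := by
      intro x
      refine (((hasDerivAt_exp_neg_mul b x).const_mul C).add
        ((hasDerivAt_exp_mul b x).const_mul ε)).congr_deriv ?_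
      ring
    have d2 : ∀ x, HasDerivAt
        (fun x => -(b * (C * Real.exp (-(b * x)))) + b * (ε * Real.exp (b * x)))
        (b ^ 2 * (C * Real.exp (-(b * x)) + ε * Real.exp (b * x))) x := by
      intro x
      refine (((((hasDerivAt_exp_neg_mul b x).const_mul C).const_mul b).neg).add
        (((hasDerivAt_exp_mul b x).const_mul ε).const_mul b)).congr_deriv ?_
      ring
    refine nonpos_of_max_principle (fun x => (h1 x).sub (d1 x)) (fun x => (h2 x).sub (d2 x)) ?_ ?_ ?_
    · have : Y ≤ C * Real.exp (-(b * X)) := by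
        rw [Real.exp_neg, ← div_eq_mul_inv, le_div_iff₀ (Real.exp_pos _)]; exact hCX
      have h3 := hY X le_rfl
      have := mul_pos hε (Real.exp_pos (b * X))
      linarith
    · have ht : Tendsto (fun x => ε * Real.exp (b * x)) atTop atTop :=
        (Real.tendsto_exp_atTop.comp (tendsto_id.const_mul_atTop hb)).const_mul_atTop hε
      filter_upwards [ht.eventually_ge_atTop Y, eventually_ge_atTop X] with x hx hXx
      have h3 := hY x hXx
      have := mul_nonneg hC0 (Real.exp_pos (-(b * x))).le
      linarith
    · intro x hx hz hz1
      set E₁ := Real.exp (-(b * x)) with hE₁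
      set E₂ := Real.exp (b * x) with hE₂
      have p1 : 0 < E₁ := Real.exp_pos _
      have p2 : 0 < E₂ := Real.exp_pos _
      have pC : 0 ≤ C * E₁ := mul_nonneg hC0 p1.le
      have pε : 0 < ε * E₂ := mul_pos hε p2
      have hypos : 0 < y x := by linarith
      have a0 := hode x hx.le
      have a1 := hκ₁ x hx.le
      have a2 := hκ₂ x hx.le hypos
      have hδ : 0 ≤ δ := (abs_nonneg _).trans a1
      have hκ : 0 < κ := lt_of_le_of_lt (by positivity) hbδ
      have b1 : -(δ * (b * (C * E₁ + ε * E₂))) ≤ κ₁ x * y₁ x := by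
        have hy1 : |y₁ x| ≤ b * (C * E₁ + ε * E₂) := by
          rw [abs_le]
          constructor <;> nlinarith
        have := mul_le_mul a1 hy1 (abs_nonneg _) hδ
        rw [← abs_mul] at this
        linarith [neg_abs_le (κ₁ x * y₁ x)]
      have b2 : κ * (C * E₁ + ε * E₂) ≤ κ₂ x * y x :=
        mul_le_mul a2 (by linarith) (by linarith) (by linarith)
      have b3 : B * E₁ ≤ (κ - δ * b - b ^ 2) * C * E₁ := mul_le_mul_of_nonneg_right hCB p1.le
      have b4 : 0 < (κ - δ * b - b ^ 2) * (ε * E₂) := mul_pos (by linarith) pε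
      nlinarith
  intro x hx
  refine le_of_forall_pos_le_add fun ε hε => ?_
  -- With x fixed, this choice makes the growing term equal to ε at x.
  have := key (ε / Real.exp (b * x)) (div_pos hε (Real.exp_pos _)) x hx
  rw [div_mul_cancel₀ _ (Real.exp_pos _).ne'] at this
  linarith

theorem abs_le_exp_of_barrier {y y₁ y₂ κ₁ κ₂ : ℝ → ℝ} {X b δ κ B Y C : ℝ}
    (h1 : ∀ x, HasDerivAt y (y₁ x) x) (h2 : ∀ x, HasDerivAt y₁ (y₂ x) x) (hb : 0 < b)
    (hode : ∀ x, X ≤ x → |y₂ x - κ₁ x * y₁ x - κ₂ x * y x| ≤ B * Real.exp (-(b * x)))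
    (hκ₁ : ∀ x, X ≤ x → |κ₁ x| ≤ δ) (hκ₂ : ∀ x, X ≤ x → κ ≤ κ₂ x)
    (hbδ : b ^ 2 + δ * b < κ) (hY : ∀ x, X ≤ x → |y x| ≤ Y) (hC0 : 0 ≤ C)
    (hCX : Y * Real.exp (b * X) ≤ C) (hCB : B ≤ (κ - δ * b - b ^ 2) * C) :
    ∀ x, X ≤ x → |y x| ≤ C * Real.exp (-(b * x)) := by
  intro x hx
  rw [abs_le']
  constructor
  · refine le_exp_of_barrier h1 h2 hb (fun t ht => ?_) hκ₁ (fun t ht _ => hκ₂ t ht) hbδ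
      (fun t ht => (le_abs_self _).trans (hY t ht)) hC0 hCX hCB x hx
    linarith [(abs_le.1 (hode t ht)).1]
  · refine le_exp_of_barrier (y := fun x => -y x) (fun t => (h1 t).neg) (fun t => (h2 t).neg) hb
      (fun t ht => ?_) hκ₁ (fun t ht _ => hκ₂ t ht) hbδ
      (fun t ht => (neg_le_abs _).trans (hY t ht)) hC0 hCX hCB x hx
    linarith [(abs_le.1 (hode t ht)).2]

/-- Interpolation on an interval of length one: by the mean value theorem y' = ρ j is at most 2A in
size at some point, and the bound on j' carries the resulting bound on j back to x. -/
theorem abs_flux_le_of_abs_le {y j j' ρ : ℝ → ℝ} {A B P x : ℝ}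
    (h1 : ∀ x, HasDerivAt y (ρ x * j x) x) (h2 : ∀ x, HasDerivAt j (j' x) x)
    (hρ : ∀ x, 1 ≤ P * |ρ x|) (hP : 0 ≤ P) (hA : ∀ t ∈ Set.Icc x (x + 1), |y t| ≤ A)
    (hB : ∀ t ∈ Set.Icc x (x + 1), |j' t| ≤ B) : |j x| ≤ P * (2 * A) + B := by
  obtain ⟨ξ, hξ, e⟩ := exists_hasDerivAt_eq_slope y _ (by linarith : x < x + 1)
    (continuous_iff_continuousAt.2 fun x => (h1 x).continuousAt).continuousOn (fun t _ => h1 t)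
  have e1 : |ρ ξ * j ξ| ≤ 2 * A := by
    rw [e, add_sub_cancel_left, div_one]
    have a1 := hA x ⟨le_rfl, by linarith⟩
    have a2 := hA (x + 1) ⟨by linarith, le_rfl⟩
    exact (abs_sub _ _).trans (by linarith)
  have e1' : |j ξ| ≤ P * (2 * A) := by
    calc |j ξ| ≤ P * |ρ ξ| * |j ξ| := le_mul_of_one_le_left (abs_nonneg _) (hρ ξ)
      _ = P * |ρ ξ * j ξ| := by rw [abs_mul]; ring
      _ ≤ _ := mul_le_mul_of_nonneg_left e1 hP
  have hB0 : 0 ≤ B := (abs_nonneg _).trans (hB x ⟨le_rfl, by linarith⟩)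
  have e2 : |j x - j ξ| ≤ B := by
    have := (convex_Icc x (x + 1)).norm_image_sub_le_of_norm_hasDerivWithin_le
      (f := j) (f' := j') (C := B) (fun t _ => (h2 t).hasDerivWithinAt)
      (fun t ht => by simpa using hB t ht) (x := ξ) (y := x) ⟨hξ.1.le, hξ.2.le⟩
      ⟨le_rfl, by linarith⟩
    simp only [Real.norm_eq_abs] at this
    refine this.trans ?_
    have : |x - ξ| ≤ 1 := by rw [abs_le]; constructor <;> linarith [hξ.1, hξ.2]
    nlinarith
  have := abs_sub_abs_le_abs_sub (j x) (j ξ)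
  linarith

theorem abs_deriv_le_of_abs_le {y y₁ y₂ : ℝ → ℝ} {A B x : ℝ} (h1 : ∀ x, HasDerivAt y (y₁ x) x)
    (h2 : ∀ x, HasDerivAt y₁ (y₂ x) x) (hA : ∀ t ∈ Set.Icc x (x + 1), |y t| ≤ A)
    (hB : ∀ t ∈ Set.Icc x (x + 1), |y₂ t| ≤ B) : |y₁ x| ≤ 2 * A + B := by
  have := abs_flux_le_of_abs_le (ρ := fun _ => 1) (P := 1) (fun x => by simpa using h1 x) h2
    (fun x => by simp) zero_le_one hA hB
  linarith

theorem abs_flux_le_weight {y j j' ρ w : ℝ → ℝ} {A B K P : ℝ}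
    (h1 : ∀ x, HasDerivAt y (ρ x * j x) x) (h2 : ∀ x, HasDerivAt j (j' x) x)
    (hρ : ∀ x, 1 ≤ P * |ρ x|) (hP : 0 ≤ P) (hA0 : 0 ≤ A) (hB0 : 0 ≤ B)
    (hA : ∀ x, |y x| ≤ A * w x) (hB : ∀ x, |j' x| ≤ B * w x)
    (hw : ∀ x t, x ≤ t → t ≤ x + 1 → w t ≤ K * w x) (x : ℝ) :
    |j x| ≤ (P * (2 * A) + B) * K * w x := by
  have := abs_flux_le_of_abs_le (A := A * (K * w x)) (B := B * (K * w x)) (x := x) h1 h2 hρ hP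
    (fun t ht => (hA t).trans (mul_le_mul_of_nonneg_left (hw x t ht.1 ht.2) hA0))
    (fun t ht => (hB t).trans (mul_le_mul_of_nonneg_left (hw x t ht.1 ht.2) hB0))
  linarith

theorem hasDerivAt_comp_neg_arg {f : ℝ → ℝ} {f' x : ℝ} (h : HasDerivAt f f' (-x)) :
    HasDerivAt (fun x => f (-x)) (-f') x :=
  (h.comp x (hasDerivAt_neg x)).congr_deriv (by ring)

/-- The two-sided exponential weight `e^{-b|x|}`. -/
def expW (b x : ℝ) : ℝ := Real.exp (-(b * |x|))

theorem expW_pos (b x : ℝ) : 0 < expW b x := Real.exp_pos _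

theorem expW_shift {b : ℝ} (hb : 0 ≤ b) (x t : ℝ) (h1 : x ≤ t) (h2 : t ≤ x + 1) :
    expW b t ≤ Real.exp b * expW b x := by
  rw [expW, expW, ← Real.exp_add, Real.exp_le_exp]
  have : |x| ≤ |t| + 1 := by
    have := abs_sub_abs_le_abs_sub x t
    have : |x - t| ≤ 1 := by rw [abs_le]; constructor <;> linarith
    linarith
  nlinarith

theorem exists_nonneg_bound {w f : ℝ → ℝ} (hw : ∀ x, 0 ≤ w x) (h : ∃ C, ∀ x, |f x| ≤ C * w x) :
    ∃ C, 0 ≤ C ∧ ∀ x, |f x| ≤ C * w x := by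
  obtain ⟨C, hC⟩ := h
  exact ⟨|C|, abs_nonneg C, fun x => (hC x).trans (mul_le_mul_of_nonneg_right (le_abs_self C) (hw x))⟩

/-- Bounded solutions of `y'' = κ₁ y' + κ₂ y + F` decay exponentially if `F` does and `κ₂` is
positive enough near infinity. -/
theorem exists_expW_bound {y y₁ y₂ κ₁ κ₂ F : ℝ → ℝ} {X b δ κ : ℝ}
    (h1 : ∀ x, HasDerivAt y (y₁ x) x) (h2 : ∀ x, HasDerivAt y₁ (y₂ x) x) (hb : 0 < b)
    (hode : ∀ x, y₂ x = κ₁ x * y₁ x + κ₂ x * y x + F x)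
    (hF : ∃ C, ∀ x, |F x| ≤ C * expW b x) (hX : 0 ≤ X)
    (hκ₁ : ∀ x, X ≤ |x| → |κ₁ x| ≤ δ) (hκ₂ : ∀ x, X ≤ |x| → κ ≤ κ₂ x)
    (hbδ : b ^ 2 + δ * b < κ) (hY : ∃ Y, ∀ x, |y x| ≤ Y) :
    ∃ C, ∀ x, |y x| ≤ C * expW b x := by
  obtain ⟨Y, hY⟩ := hY
  obtain ⟨B, hB0, hB⟩ := exists_nonneg_bound (fun x => (expW_pos b x).le) hF
  have hY0 : 0 ≤ Y := (abs_nonneg _).trans (hY 0)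
  have hpos : 0 < κ - δ * b - b ^ 2 := by linarith
  -- The first summand covers |x| ≤ X, where only the bound Y is available; the second absorbs the
  -- inhomogeneity in the barrier argument.
  set C := Y * Real.exp (b * X) + B / (κ - δ * b - b ^ 2) with hC
  have hC0 : 0 ≤ C := by positivity
  have hCX : Y * Real.exp (b * X) ≤ C := by
    have : 0 ≤ B / (κ - δ * b - b ^ 2) := by positivity
    linarith
  have hCB : B ≤ (κ - δ * b - b ^ 2) * C := by
    have : 0 ≤ (κ - δ * b - b ^ 2) * (Y * Real.exp (b * X)) := by positivity
    rw [hC, mul_add, mul_div_cancel₀ _ hpos.ne']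
    linarith
  refine ⟨C, fun x => ?_⟩
  rcases lt_or_ge |x| X with hx | hx
  · refine (hY x).trans ?_
    have : 1 ≤ Real.exp (b * X) * expW b x := by
      rw [expW, ← Real.exp_add]
      exact Real.one_le_exp (by nlinarith)
    calc Y ≤ Y * (Real.exp (b * X) * expW b x) := le_mul_of_one_le_right hY0 this
      _ = (Y * Real.exp (b * X)) * expW b x := by ring
      _ ≤ _ := mul_le_mul_of_nonneg_right hCX (expW_pos b x).le
  · rcases le_total 0 x with h0 | h0
    · rw [abs_of_nonneg h0] at hx
      rw [expW, abs_of_nonneg h0]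
      refine abs_le_exp_of_barrier h1 h2 hb (fun t ht => ?_) (fun t ht => hκ₁ t ?_)
        (fun t ht => hκ₂ t ?_) hbδ (fun t _ => hY t) hC0 hCX hCB x hx
      · rw [hode t, show κ₁ t * y₁ t + κ₂ t * y t + F t - κ₁ t * y₁ t - κ₂ t * y t = F t by ring]
        have := hB t
        rwa [expW, abs_of_nonneg (hX.trans ht)] at this
      · exact ht.trans (le_abs_self t)
      · exact ht.trans (le_abs_self t)
    · rw [abs_of_nonpos h0] at hx
      rw [expW, abs_of_nonpos h0]
      have g1 : ∀ t, HasDerivAt (fun t => y (-t)) (-y₁ (-t)) t := fun t =>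
        hasDerivAt_comp_neg_arg (h1 (-t))
      have g2 : ∀ t, HasDerivAt (fun t => -y₁ (-t)) (y₂ (-t)) t := fun t =>
        ((hasDerivAt_comp_neg_arg (h2 (-t))).fun_neg).congr_deriv (neg_neg _)
      have := abs_le_exp_of_barrier (κ₁ := fun t => -κ₁ (-t)) (κ₂ := fun t => κ₂ (-t))
        g1 g2 hb (fun t ht => ?_) (fun t ht => ?_)
        (fun t ht => hκ₂ (-t) ?_) hbδ (fun t _ => hY (-t)) hC0 hCX hCB (-x) hx
      · simpa using this
      · rw [hode (-t), show κ₁ (-t) * y₁ (-t) + κ₂ (-t) * y (-t) + F (-t) -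
          -κ₁ (-t) * -y₁ (-t) - κ₂ (-t) * y (-t) = F (-t) by ring]
        have := hB (-t)
        rwa [expW, abs_neg, abs_of_nonneg (hX.trans ht)] at this
      · rw [abs_neg]
        exact hκ₁ (-t) (by rw [abs_neg]; exact ht.trans (le_abs_self t))
      · rw [abs_neg]; exact ht.trans (le_abs_self t)

/-- Gronwall's inequality for (y, y') in the maximum norm. The system has Lipschitz constant at most
K + 1; keeping it at least 1 bounds ε/(K + 1) by ε. -/
theorem gronwall_second_order {y y₁ y₂ : ℝ → ℝ} {X K ε ε₀ : ℝ} (h1 : ∀ x, HasDerivAt y (y₁ x) x)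
    (h2 : ∀ x, HasDerivAt y₁ (y₂ x) x) (hK : 0 ≤ K) (hε : 0 ≤ ε)
    (hode : ∀ x ∈ Set.Icc 0 X, |y₂ x| ≤ K * |y x| + ε) (h0 : |y 0| ≤ ε₀) (h10 : y₁ 0 = 0) :
    ∀ x ∈ Set.Icc 0 X, |y x| ≤ (ε₀ + ε) * Real.exp ((K + 1) * X) ∧
      |y₁ x| ≤ (ε₀ + ε) * Real.exp ((K + 1) * X) := by
  have hε₀ : 0 ≤ ε₀ := (abs_nonneg _).trans h0
  have hd : ∀ x, HasDerivAt (fun x => (y x, y₁ x)) (y₁ x, y₂ x) x := fun x => (h1 x).prodMk (h2 x)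
  have g := norm_le_gronwallBound_of_norm_deriv_right_le (f := fun x => (y x, y₁ x))
    (f' := fun x => (y₁ x, y₂ x)) (δ := ε₀) (K := K + 1) (ε := ε) (a := 0) (b := X)
    (continuous_iff_continuousAt.2 fun x => (hd x).continuousAt).continuousOn
    (fun x _ => (hd x).hasDerivWithinAt)
    (by simp only [Prod.norm_def, Real.norm_eq_abs, h10, abs_zero]; exact max_le h0 hε₀)
    (by
      intro x hx
      have := hode x ⟨hx.1, hx.2.le⟩
      simp only [Prod.norm_def, Real.norm_eq_abs]
      have m1 : |y x| ≤ max |y x| |y₁ x| := le_max_left _ _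
      have m2 : |y₁ x| ≤ max |y x| |y₁ x| := le_max_right _ _
      have m0 : 0 ≤ max |y x| |y₁ x| := (abs_nonneg _).trans m1
      refine max_le ?_ ?_
      · nlinarith
      · nlinarith)
  intro x hx
  have hgx := g x hx
  rw [gronwallBound_of_K_ne_0 (by linarith : K + 1 ≠ 0), sub_zero] at hgx
  have hexp : Real.exp ((K + 1) * x) ≤ Real.exp ((K + 1) * X) :=
    Real.exp_le_exp.2 (mul_le_mul_of_nonneg_left hx.2 (by linarith))
  have e1 : ε / (K + 1) * (Real.exp ((K + 1) * x) - 1) ≤ ε * Real.exp ((K + 1) * X) := by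
    have : ε / (K + 1) ≤ ε := div_le_self hε (by linarith)
    have h3 : 0 ≤ Real.exp ((K + 1) * x) - 1 := by
      have := Real.one_le_exp (x := (K + 1) * x) (mul_nonneg (by linarith) hx.1)
      linarith
    exact mul_le_mul this (by linarith) h3 hε
  have e2 : ε₀ * Real.exp ((K + 1) * x) ≤ ε₀ * Real.exp ((K + 1) * X) :=
    mul_le_mul_of_nonneg_left hexp hε₀
  have hb : ‖((y x, y₁ x) : ℝ × ℝ)‖ ≤ (ε₀ + ε) * Real.exp ((K + 1) * X) := by linarith
  simp only [Prod.norm_def, Real.norm_eq_abs] at hb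
  exact ⟨(le_max_left _ _).trans hb, (le_max_right _ _).trans hb⟩

/-! ### Bounded solutions of Sturm-Liouville equations with positive potential -/

theorem hasDerivAt_integral_Ioi {F : ℝ → ℝ} (hF : Continuous F)
    (hi : ∀ a, IntegrableOn F (Set.Ioi a)) (x : ℝ) :
    HasDerivAt (fun x => ∫ t in Set.Ioi x, F t) (-F x) x := by
  have e : (fun x => ∫ t in Set.Ioi x, F t) =
      fun x => (∫ t in Set.Ioi 0, F t) - ∫ t in (0 : ℝ)..x, F t := by
    ext x
    rw [← intervalIntegral.integral_Ioi_sub_Ioi' (hi 0) (hi x)]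
    ring
  rw [e]
  exact (intervalIntegral.integral_hasDerivAt_right (hF.intervalIntegrable _ _)
    (hF.stronglyMeasurableAtFilter _ _) hF.continuousAt).const_sub _

theorem hasDerivAt_integral_Iic {F : ℝ → ℝ} (hF : Continuous F)
    (hi : ∀ a, IntegrableOn F (Set.Iic a)) (x : ℝ) :
    HasDerivAt (fun x => ∫ t in Set.Iic x, F t) (F x) x := by
  have e : (fun x => ∫ t in Set.Iic x, F t) =
      fun x => (∫ t in Set.Iic 0, F t) + ∫ t in (0 : ℝ)..x, F t := by
    ext x
    rw [← intervalIntegral.integral_Iic_sub_Iic (hi 0) (hi x)]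
    ring
  rw [e]
  exact (intervalIntegral.integral_hasDerivAt_right (hF.intervalIntegrable _ _)
    (hF.stronglyMeasurableAtFilter _ _) hF.continuousAt).const_add _

/-- The travel time `∫₀ˣ 1/r`. -/
def travelTime (r : ℝ → ℝ) (x : ℝ) : ℝ := ∫ t in (0 : ℝ)..x, (r t)⁻¹

/-- The bounded solution `g` of `l g - r g' = f`. -/
def halfResolvent (r : ℝ → ℝ) (l : ℝ) (f : ℝ → ℝ) (x : ℝ) : ℝ :=
  Real.exp (l * travelTime r x) *
    ∫ t in Set.Ioi x, Real.exp (-(l * travelTime r t)) * (r t)⁻¹ * f t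

section HalfResolvent

variable {r : ℝ → ℝ} {l : ℝ}

theorem hasDerivAt_travelTime (hr : Continuous r) (hr0 : ∀ x, 0 < r x) (x : ℝ) :
    HasDerivAt (travelTime r) (r x)⁻¹ x := by
  have hc : Continuous fun t => (r t)⁻¹ := hr.inv₀ fun t => (hr0 t).ne'
  exact intervalIntegral.integral_hasDerivAt_right (hc.intervalIntegrable _ _)
    (hc.stronglyMeasurableAtFilter _ _) hc.continuousAt

theorem tendsto_travelTime {r₁ : ℝ} (hr : Continuous r) (hr0 : ∀ x, 0 < r x) (hr1 : ∀ x, r x ≤ r₁) :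
    Tendsto (travelTime r) atTop atTop := by
  have hr₁ : 0 < r₁ := (hr0 0).trans_le (hr1 0)
  have h : ∀ᶠ x in atTop, r₁⁻¹ * x ≤ travelTime r x := by
    filter_upwards [eventually_ge_atTop 0] with x hx
    have hc : Continuous fun t => (r t)⁻¹ := hr.inv₀ fun t => (hr0 t).ne'
    have := intervalIntegral.integral_mono_on (a := 0) (b := x) (f := fun _ => r₁⁻¹)
      (g := fun t => (r t)⁻¹) (μ := volume) hx (by simp) (hc.intervalIntegrable _ _)
      (fun t _ => inv_anti₀ (hr0 t) (hr1 t))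
    rw [intervalIntegral.integral_const] at this
    simpa [travelTime, mul_comm] using this
  exact tendsto_atTop_mono' _ h (tendsto_id.const_mul_atTop (inv_pos.2 hr₁))

variable {r₁ : ℝ} (hr : Continuous r) (hr0 : ∀ x, 0 < r x) (hr1 : ∀ x, r x ≤ r₁) (hl : 0 < l)
include hr hr0 hr1 hl

/-- The integrand is the derivative of -e^(-lT)/l with T the travel time, and T → ∞ because r is
bounded. This is the kernel mass that gives the half resolvent the norm bound 1/l. -/
theorem integral_exp_travelTime (x : ℝ) :
    IntegrableOn (fun t => Real.exp (-(l * travelTime r t)) * (r t)⁻¹) (Set.Ioi x) ∧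
    ∫ t in Set.Ioi x, Real.exp (-(l * travelTime r t)) * (r t)⁻¹ =
      Real.exp (-(l * travelTime r x)) / l := by
  have hd : ∀ t, HasDerivAt (fun t => -(Real.exp (-(l * travelTime r t)) / l))
      (Real.exp (-(l * travelTime r t)) * (r t)⁻¹) t := by
    intro t
    refine (((((hasDerivAt_travelTime hr hr0 t).const_mul l).fun_neg).exp.div_const l).fun_neg).congr_deriv ?_
    field_simp
  have ht : Tendsto (fun t => -(Real.exp (-(l * travelTime r t)) / l)) atTop (𝓝 0) := by
    have := (Real.tendsto_exp_neg_atTop_nhds_zero.comp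
      ((tendsto_travelTime hr hr0 hr1).const_mul_atTop hl)).div_const l
    simpa using this.neg
  have hi := integrableOn_Ioi_deriv_of_nonneg' (a := x) (fun t _ => hd t)
    (fun t _ => mul_nonneg (Real.exp_pos _).le (inv_pos.2 (hr0 t)).le) ht
  refine ⟨hi, ?_⟩
  rw [integral_Ioi_of_hasDerivAt_of_tendsto' (fun t _ => hd t) hi ht]
  ring

theorem integrableOn_halfResolvent {f : ℝ → ℝ} (hf : Continuous f) {M : ℝ} (hM : ∀ x, |f x| ≤ M)
    (x : ℝ) : IntegrableOn (fun t => Real.exp (-(l * travelTime r t)) * (r t)⁻¹ * f t)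
      (Set.Ioi x) :=
  (integral_exp_travelTime hr hr0 hr1 hl x).1.mul_bdd hf.aestronglyMeasurable
    (Eventually.of_forall hM)

theorem abs_halfResolvent_le {f : ℝ → ℝ} {M : ℝ} (hM : ∀ x, |f x| ≤ M) (x : ℝ) :
    |halfResolvent r l f x| ≤ M / l := by
  have h := integral_exp_travelTime hr hr0 hr1 hl x
  have hb : ‖∫ t in Set.Ioi x, Real.exp (-(l * travelTime r t)) * (r t)⁻¹ * f t‖ ≤
      ∫ t in Set.Ioi x, Real.exp (-(l * travelTime r t)) * (r t)⁻¹ * M := by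
    refine norm_integral_le_of_norm_le (h.1.mul_const M) (Eventually.of_forall fun t => ?_)
    have : 0 ≤ Real.exp (-(l * travelTime r t)) * (r t)⁻¹ :=
      mul_nonneg (Real.exp_pos _).le (inv_pos.2 (hr0 t)).le
    rw [norm_mul, Real.norm_of_nonneg this]
    exact mul_le_mul_of_nonneg_left (hM t) this
  rw [integral_mul_const, h.2, Real.norm_eq_abs] at hb
  rw [halfResolvent, abs_mul, abs_of_pos (Real.exp_pos _)]
  refine (mul_le_mul_of_nonneg_left hb (Real.exp_pos _).le).trans (le_of_eq ?_)
  rw [Real.exp_neg]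
  field_simp

theorem halfResolvent_sub {f g : ℝ → ℝ} (hf : Continuous f) (hg : Continuous g) {M N : ℝ}
    (hM : ∀ x, |f x| ≤ M) (hN : ∀ x, |g x| ≤ N) (x : ℝ) :
    halfResolvent r l f x - halfResolvent r l g x = halfResolvent r l (fun t => f t - g t) x := by
  simp only [halfResolvent, mul_sub]
  rw [integral_sub (integrableOn_halfResolvent hr hr0 hr1 hl hf hM x)
    (integrableOn_halfResolvent hr hr0 hr1 hl hg hN x), mul_sub]

theorem hasDerivAt_halfResolvent {f : ℝ → ℝ} (hf : Continuous f) {M : ℝ} (hM : ∀ x, |f x| ≤ M)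
    (x : ℝ) : HasDerivAt (halfResolvent r l f) ((r x)⁻¹ * (l * halfResolvent r l f x - f x)) x := by
  have hY : Continuous (travelTime r) :=
    continuous_iff_continuousAt.2 fun x => (hasDerivAt_travelTime hr hr0 x).continuousAt
  have hc : Continuous fun t => Real.exp (-(l * travelTime r t)) * (r t)⁻¹ * f t :=
    ((hY.const_mul l).neg.rexp.mul (hr.inv₀ fun t => (hr0 t).ne')).mul hf
  have h1 := hasDerivAt_integral_Ioi hc (integrableOn_halfResolvent hr hr0 hr1 hl hf hM) x
  refine (((hasDerivAt_travelTime hr hr0 x).const_mul l).exp.mul h1).congr_deriv ?_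
  have : Real.exp (l * travelTime r x) * Real.exp (-(l * travelTime r x)) = 1 := by
    rw [← Real.exp_add]; simp
  rw [halfResolvent]
  linear_combination (-(r x)⁻¹ * f x) * this

end HalfResolvent

open BoundedContinuousFunction in
/-- Existence of bounded solutions of `s k - (r k')' = R`, in the form of a first order system for
`k` and the flux `j = r k'`. -/
theorem exists_bounded_solution {r s R : ℝ → ℝ} {r₀ r₁ s₀ s₁ M : ℝ} (hr : Continuous r)
    (hs : Continuous s) (hR : Continuous R) (hr₀ : 0 < r₀) (hr0 : ∀ x, r₀ ≤ r x)
    (hr1 : ∀ x, r x ≤ r₁) (hs₀ : 0 < s₀) (hs0 : ∀ x, s₀ ≤ s x) (hs1 : ∀ x, s x ≤ s₁)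
    (hM : ∀ x, |R x| ≤ M) :
    ∃ k j : ℝ → ℝ, (∀ x, HasDerivAt k ((r x)⁻¹ * j x) x) ∧
      (∀ x, HasDerivAt j (s x * k x - R x) x) ∧ ∃ C, ∀ x, |k x| ≤ C := by
  have hrp : ∀ x, 0 < r x := fun x => hr₀.trans_le (hr0 x)
  have hsp : ∀ x, 0 < s x := fun x => hs₀.trans_le (hs0 x)
  have hr₁ : 0 < r₁ := (hrp 0).trans_le (hr1 0)
  have hs₁ : 0 < s₁ := (hsp 0).trans_le (hs1 0)
  -- Multiplied by r, the equation reads (l² - (r∂)²) k = r R + (l² - r s) k. The left side factors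
  -- as (l - r∂)(l + r∂), so two half resolvents invert it with norm at most 1/l². The choice l² =
  -- r₁ s₁ makes the coefficient on the right nonnegative.
  set l : ℝ := Real.sqrt (r₁ * s₁) with hl_def
  have hl2 : l ^ 2 = r₁ * s₁ := Real.sq_sqrt (by positivity)
  have hl : 0 < l := Real.sqrt_pos.2 (by positivity)
  have hr' : Continuous fun x => r (-x) := hr.comp continuous_neg
  -- the resolvent of `-(r ∂)²` at `l ^ 2`
  set U : (ℝ → ℝ) → ℝ → ℝ := fun f x =>
    halfResolvent (fun x => r (-x)) l (fun y => halfResolvent r l f (-y)) (-x) with hU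
  have hV : ∀ (f : ℝ → ℝ) (N : ℝ), Continuous f → (∀ x, |f x| ≤ N) →
      Continuous (halfResolvent r l f) ∧ ∀ x, |halfResolvent r l f x| ≤ N / l := fun f N hf hN =>
    ⟨continuous_iff_continuousAt.2 fun x =>
      (hasDerivAt_halfResolvent hr hrp hr1 hl hf hN x).continuousAt,
      abs_halfResolvent_le hr hrp hr1 hl hN⟩
  have hUd : ∀ (f : ℝ → ℝ) (N : ℝ), Continuous f → (∀ x, |f x| ≤ N) → ∀ x,
      HasDerivAt (U f) ((r x)⁻¹ * (halfResolvent r l f x - l * U f x)) x := by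
    intro f N hf hN x
    obtain ⟨c1, c2⟩ := hV f N hf hN
    have := hasDerivAt_halfResolvent hr' (fun x => hrp (-x)) (fun x => hr1 (-x)) hl
      (f := fun y => halfResolvent r l f (-y)) (c1.comp continuous_neg) (fun x => c2 (-x)) (-x)
    refine (hasDerivAt_comp_neg_arg this).congr_deriv ?_
    simp only [neg_neg, hU]
    ring
  have hUb : ∀ (f : ℝ → ℝ) (N : ℝ), Continuous f → (∀ x, |f x| ≤ N) → ∀ x,
      |U f x| ≤ N / l ^ 2 := by
    intro f N hf hN x
    obtain ⟨c1, c2⟩ := hV f N hf hN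
    have := abs_halfResolvent_le hr' (fun x => hrp (-x)) (fun x => hr1 (-x)) hl
      (f := fun y => halfResolvent r l f (-y)) (fun x => c2 (-x)) (-x)
    rwa [div_div, ← sq] at this
  have hUs : ∀ (f g : ℝ → ℝ) (N N' : ℝ), Continuous f → Continuous g → (∀ x, |f x| ≤ N) →
      (∀ x, |g x| ≤ N') → ∀ x, U f x - U g x = U (fun t => f t - g t) x := by
    intro f g N N' hf hg hN hN' x
    obtain ⟨c1, c2⟩ := hV f N hf hN
    obtain ⟨c1', c2'⟩ := hV g N' hg hN'
    simp only [hU]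
    rw [halfResolvent_sub hr' (fun x => hrp (-x)) (fun x => hr1 (-x)) hl
      (f := fun y => halfResolvent r l f (-y)) (g := fun y => halfResolvent r l g (-y)) (c1.comp continuous_neg) (c1'.comp continuous_neg) (fun x => c2 (-x)) (fun x => c2' (-x))]
    congr 1
    ext y
    exact halfResolvent_sub hr hrp hr1 hl hf hg hN hN' (-y)
  -- the fixed point map
  set p : ℝ → ℝ := fun x => l ^ 2 - r x * s x with hp
  have hpc : Continuous p := continuous_const.sub (hr.mul hs)
  have hp0 : ∀ x, 0 ≤ p x := fun x => by
    have : r x * s x ≤ r₁ * s₁ := mul_le_mul (hr1 x) (hs1 x) (hsp x).le hr₁.le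
    simp only [hp]; linarith
  have hp1 : ∀ x, p x ≤ l ^ 2 - r₀ * s₀ := fun x => by
    have : r₀ * s₀ ≤ r x * s x := mul_le_mul (hr0 x) (hs0 x) hs₀.le (hrp x).le
    simp only [hp]; linarith
  have hP0 : 0 ≤ l ^ 2 - r₀ * s₀ := (hp0 0).trans (hp1 0)
  set Fn : (ℝ →ᵇ ℝ) → ℝ → ℝ := fun k x => r x * R x + p x * k x with hFn
  have hFc : ∀ k, Continuous (Fn k) := fun k => (hr.mul hR).add (hpc.mul k.continuous)
  have hFb : ∀ k x, |Fn k x| ≤ r₁ * M + (l ^ 2 - r₀ * s₀) * ‖k‖ := by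
    intro k x
    refine (abs_add_le _ _).trans (add_le_add ?_ ?_)
    · rw [abs_mul, abs_of_pos (hrp x)]
      exact mul_le_mul (hr1 x) (hM x) (abs_nonneg _) hr₁.le
    · rw [abs_mul, abs_of_nonneg (hp0 x)]
      exact mul_le_mul (hp1 x) (k.norm_coe_le_norm x) (abs_nonneg _) hP0
  set T : (ℝ →ᵇ ℝ) → (ℝ →ᵇ ℝ) := fun k => BoundedContinuousFunction.ofNormedAddCommGroup
    (U (Fn k)) (continuous_iff_continuousAt.2 fun x => (hUd _ _ (hFc k) (hFb k) x).continuousAt)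
    ((r₁ * M + (l ^ 2 - r₀ * s₀) * ‖k‖) / l ^ 2) (fun x => hUb _ _ (hFc k) (hFb k) x) with hT
  have hTapp : ∀ k x, T k x = U (Fn k) x := fun k x => rfl
  -- The contraction factor: the positive lower bounds on r and s keep it below 1.
  set θ : ℝ := (l ^ 2 - r₀ * s₀) / l ^ 2 with hθ
  have hθ0 : 0 ≤ θ := by positivity
  have hθ1 : θ < 1 := by
    rw [hθ, div_lt_one (by positivity)]
    have : 0 < r₀ * s₀ := by positivity
    linarith
  have hcontr : ContractingWith ⟨θ, hθ0⟩ T := by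
    refine ⟨by exact_mod_cast hθ1, LipschitzWith.of_dist_le_mul fun k k' => ?_⟩
    rw [BoundedContinuousFunction.dist_le (by positivity)]
    intro x
    rw [hTapp, hTapp, Real.dist_eq, hUs _ _ _ _ (hFc k) (hFc k') (hFb k) (hFb k')]
    have hb : ∀ t, |Fn k t - Fn k' t| ≤ (l ^ 2 - r₀ * s₀) * dist k k' := by
      intro t
      rw [show Fn k t - Fn k' t = p t * (k t - k' t) by simp only [hFn]; ring, abs_mul,
        abs_of_nonneg (hp0 t)]
      refine mul_le_mul (hp1 t) ?_ (abs_nonneg _) hP0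
      rw [← Real.dist_eq]
      exact BoundedContinuousFunction.dist_coe_le_dist t
    refine (hUb _ _ ((hFc k).sub (hFc k')) hb x).trans (le_of_eq ?_)
    change (l ^ 2 - r₀ * s₀) * dist k k' / l ^ 2 = θ * dist k k'
    rw [hθ]
    ring
  set k := ContractingWith.fixedPoint T hcontr with hk
  have hfix : T k = k := hcontr.fixedPoint_isFixedPt
  have hkU : ∀ x, k x = U (Fn k) x := fun x => by rw [← hTapp, hfix]
  -- The flux r k' is read off from the outer factor (l + r∂) k = `halfResolvent r l (Fn k)`; no
  -- differentiability of r is needed.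
  refine ⟨k, fun x => halfResolvent r l (Fn k) x - l * k x, fun x => ?_, fun x => ?_,
    ‖k‖, fun x => k.norm_coe_le_norm x⟩
  · have := hUd _ _ (hFc k) (hFb k) x
    rw [← hkU x] at this
    rwa [show U (Fn k) = k from funext fun x => (hkU x).symm] at this
  · have h1 := hasDerivAt_halfResolvent hr hrp hr1 hl (hFc k) (hFb k) x
    have h2 := hUd _ _ (hFc k) (hFb k) x
    rw [← hkU x] at h2
    rw [show U (Fn k) = k from funext fun x => (hkU x).symm] at h2
    refine (h1.sub (h2.const_mul l)).congr_deriv ?_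
    simp only [hFn, hp]
    have := (hrp x).ne'
    field_simp
    ring

/-- Decaying solutions of `s k - (r k')' = R` for test functions `R`. -/
theorem exists_decaying_solution {r s R ri : ℝ → ℝ} {b δ κ X s₀ r₀ : ℝ} (hr : Dec wOne r)
    (hs : Dec wOne s) (hri : Dec wOne ri) (hr₀ : 0 < r₀) (hr0 : ∀ x, r₀ ≤ r x)
    (hinv : ∀ x, ri x = (r x)⁻¹) (hs₀ : 0 < s₀)
    (hs0 : ∀ x, s₀ ≤ s x) (hR : Dec (expW b) R) (hb : 0 < b) (hX : 0 ≤ X)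
    (hδ : ∀ x, X ≤ |x| → |ri x * deriv r x| ≤ δ) (hκ : ∀ x, X ≤ |x| → κ ≤ ri x * s x)
    (hbδ : b ^ 2 + δ * b < κ) :
    ∃ k : ℝ → ℝ, Dec (expW b) k ∧ ∀ x, s x * k x - deriv (fun y => r y * deriv k y) x = R x := by
  obtain ⟨r₁, hr1⟩ := hr.bound
  obtain ⟨s₁, hs1⟩ := hs.bound
  obtain ⟨M, hM0, hM⟩ := exists_nonneg_bound (fun x => (expW_pos b x).le) hR.bound
  obtain ⟨ri₁, hri1⟩ := hri.bound
  simp only [wOne, mul_one] at hr1 hs1 hri1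
  have hrp : ∀ x, r x ≠ 0 := fun x => (hr₀.trans_le (hr0 x)).ne'
  have hw1 : ∀ x, expW b x ≤ 1 := fun x => by
    rw [expW, Real.exp_le_one_iff]; have := mul_nonneg hb.le (abs_nonneg x); linarith
  obtain ⟨k, j, h1, h2, C, hC⟩ := exists_bounded_solution hr.contDiff.continuous
    hs.contDiff.continuous hR.contDiff.continuous hr₀ hr0 (fun x => (le_abs_self _).trans (hr1 x))
    hs₀ hs0 (fun x => (le_abs_self _).trans (hs1 x)) (M := M)
    (fun x => (hM x).trans (mul_le_of_le_one_right hM0 (hw1 x)))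
  simp only [← hinv] at h1
  have hrr : ∀ x, ri x * r x = 1 := fun x => by rw [hinv, inv_mul_cancel₀ (hrp x)]
  have hrid : ∀ x, deriv ri x = -(ri x * ri x * deriv r x) := by
    intro x
    have e := ((hasDerivAt_of_smooth hri.contDiff x).mul (hasDerivAt_of_smooth hr.contDiff x))
    have e2 : ri * r = fun _ => (1 : ℝ) := funext hrr
    rw [e2] at e
    have e3 := e.unique (hasDerivAt_const x 1)
    have e4 := hrr x
    linear_combination ri x * e3 - deriv ri x * e4
  have h1' : ∀ x, HasDerivAt (fun x => ri x * j x) (-(ri x * deriv r x) * (ri x * j x) +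
      ri x * s x * k x + -(ri x * R x)) x := by
    intro x
    refine ((hasDerivAt_of_smooth hri.contDiff x).mul (h2 x)).congr_deriv ?_
    rw [hrid x]; ring
  have hks : ContDiff ℝ ∞ k := contDiff_of_second_order h1 h1'
    (hri.contDiff.mul hr.deriv.contDiff).neg (hri.contDiff.mul hs.contDiff)
    (hri.contDiff.mul hR.contDiff).neg
  have hRi : Dec (expW b) fun x => -(ri x * R x) := (hri.one_mul hR).neg
  have hkb : ∃ C, ∀ x, |k x| ≤ C * expW b x :=
    exists_expW_bound h1 h1' hb (fun x => rfl) hRi.bound hX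
      (fun x hx => by rw [abs_neg]; exact hδ x hx) hκ hbδ ⟨C, hC⟩
  have hkd : deriv k = fun x => ri x * j x := funext fun x => (h1 x).deriv
  obtain ⟨A, hA0, hA⟩ := exists_nonneg_bound (fun x => (expW_pos b x).le) hkb
  have hs1' : 0 ≤ s₁ := (abs_nonneg _).trans (hs1 0)
  have hri1' : 0 ≤ ri₁ := (abs_nonneg _).trans (hri1 0)
  have hr1' : 0 ≤ r₁ := (abs_nonneg _).trans (hr1 0)
  have hjb := abs_flux_le_weight (w := expW b) (A := A) (B := s₁ * A + M) (P := r₁)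
    (K := Real.exp b) h1 h2 (fun x => by
      have e := congrArg abs (hrr x)
      rw [abs_mul, abs_one] at e
      rw [← e, mul_comm |ri x|]
      exact mul_le_mul_of_nonneg_right (hr1 x) (abs_nonneg _)) hr1' hA0 (by positivity) hA
    (fun x => by
      refine (abs_sub _ _).trans ?_
      rw [abs_mul, add_mul]
      refine add_le_add ?_ (hM x)
      rw [mul_assoc]
      exact mul_le_mul (hs1 x) (hA x) (abs_nonneg _) hs1')
    (expW_shift hb.le)
  refine ⟨k, dec_of_ode hks hkb ?_ (hri.mul_one hr.deriv).neg (hri.mul_one hs) hRi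
    (fun x => ?_), fun x => ?_⟩
  · refine ⟨ri₁ * ((r₁ * (2 * A) + (s₁ * A + M)) * Real.exp b), fun x => ?_⟩
    rw [hkd, abs_mul, mul_assoc]
    exact mul_le_mul (hri1 x) (hjb x) (abs_nonneg _) hri1'
  · rw [hkd]
    exact (h1' x).deriv
  · have : (fun y => r y * deriv k y) = j := by
      ext y
      rw [hkd]
      linear_combination j y * hrr y
    rw [this, (h2 x).deriv]
    ring

/-! ### The Schrödinger equation `y'' = q y - F` with an exponentially decaying zero mode -/

section Schrodinger

variable {q ψ ψ₁ : ℝ → ℝ}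

/-- A second solution `v` of `v'' = q v`, given by a formula without singularities at the zeros of
the first solution `ψ`, with Wronskian `1`. -/
theorem exists_second_solution (hq : Continuous q) (h1 : ∀ x, HasDerivAt ψ (ψ₁ x) x)
    (h2 : ∀ x, HasDerivAt ψ₁ (q x * ψ x) x) (hne : ∀ x, 0 < ψ x ^ 2 + ψ₁ x ^ 2) :
    ∃ v v₁ : ℝ → ℝ, (∀ x, HasDerivAt v (v₁ x) x) ∧ (∀ x, HasDerivAt v₁ (q x * v x) x) ∧
      (∀ x, ψ x * v₁ x - ψ₁ x * v x = 1) ∧ (ψ 0 = 0 → v₁ 0 = 0) := by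
  have c1 : Continuous ψ := continuous_iff_continuousAt.2 fun x => (h1 x).continuousAt
  have c2 : Continuous ψ₁ := continuous_iff_continuousAt.2 fun x => (h2 x).continuousAt
  -- The rotated vector (-ψ', ψ)/ρ has Wronskian 1 with (ψ, ψ'). Adding a multiple I of (ψ, ψ') does
  -- not change this, and the equation determines I' = J. Unlike ψ ∫ ψ⁻², the formula is regular at
  -- zeros of ψ.
  set ρ : ℝ → ℝ := fun x => ψ x ^ 2 + ψ₁ x ^ 2 with hρ
  have hρ0 : ∀ x, ρ x ≠ 0 := fun x => (hne x).ne'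
  have cρ : Continuous ρ := (c1.pow 2).add (c2.pow 2)
  have dρ : ∀ x, HasDerivAt ρ (2 * ψ x * ψ₁ x * (1 + q x)) x := fun x => by
    refine (((h1 x).pow 2).add ((h2 x).pow 2)).congr_deriv ?_
    norm_num; ring
  set J : ℝ → ℝ := fun x => (1 + q x) * (ψ x ^ 2 - ψ₁ x ^ 2) / ρ x ^ 2 with hJ
  have cJ : Continuous J := ((continuous_const.add hq).mul ((c1.pow 2).sub (c2.pow 2))).div
    (cρ.pow 2) fun x => pow_ne_zero 2 (hρ0 x)
  set I : ℝ → ℝ := fun x => ∫ t in (0 : ℝ)..x, J t with hI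
  have dI : ∀ x, HasDerivAt I (J x) x := fun x =>
    intervalIntegral.integral_hasDerivAt_right (cJ.intervalIntegrable _ _)
      (cJ.stronglyMeasurableAtFilter _ _) cJ.continuousAt
  refine ⟨fun x => ψ x * I x - ψ₁ x / ρ x, fun x => ψ₁ x * I x + ψ x / ρ x, fun x => ?_,
    fun x => ?_, fun x => ?_, fun h => ?_⟩
  · refine (((h1 x).mul (dI x)).sub ((h2 x).div (dρ x) (hρ0 x))).congr_deriv ?_
    have := hρ0 x
    simp only [hJ]
    field_simp
    simp only [hρ]
    ring
  · refine (((h2 x).mul (dI x)).add ((h1 x).div (dρ x) (hρ0 x))).congr_deriv ?_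
    have := hρ0 x
    simp only [hJ]
    field_simp
    simp only [hρ]
    ring
  · have := hρ0 x
    field_simp
    simp only [hρ]
    ring
  · simp [h, hI]

/-- The initial value problem `y'' = q y + F`, `y 0 = y₀`, `y' 0 = 0`. -/
theorem exists_initial_value_solution (hq : Continuous q) (h1 : ∀ x, HasDerivAt ψ (ψ₁ x) x)
    (h2 : ∀ x, HasDerivAt ψ₁ (q x * ψ x) x) (hne : ∀ x, 0 < ψ x ^ 2 + ψ₁ x ^ 2) (h0 : ψ 0 = 0)
    {F : ℝ → ℝ} (hF : Continuous F) (y₀ : ℝ) :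
    ∃ y y₁ : ℝ → ℝ, (∀ x, HasDerivAt y (y₁ x) x) ∧ (∀ x, HasDerivAt y₁ (q x * y x + F x) x) ∧
      y 0 = y₀ ∧ y₁ 0 = 0 := by
  obtain ⟨v, v₁, a1, a2, hW, hv⟩ := exists_second_solution hq h1 h2 hne
  have c1 : Continuous ψ := continuous_iff_continuousAt.2 fun x => (h1 x).continuousAt
  have c2 : Continuous v := continuous_iff_continuousAt.2 fun x => (a1 x).continuousAt
  have dI : ∀ {g : ℝ → ℝ}, Continuous g → ∀ x,
      HasDerivAt (fun x => ∫ t in (0 : ℝ)..x, g t) (g x) x := fun hg x =>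
    intervalIntegral.integral_hasDerivAt_right (hg.intervalIntegrable _ _)
      (hg.stronglyMeasurableAtFilter _ _) hg.continuousAt
  have dA := dI (c1.fun_mul hF)
  have dB := dI (c2.fun_mul hF)
  have hW0 := hW 0
  rw [h0, hv h0] at hW0
  have hv0 : v 0 ≠ 0 := by rintro h; rw [h] at hW0; norm_num at hW0
  -- Variation of constants based at 0 contributes zero initial data. As ψ(0) = 0 gives v'(0) = 0
  -- and v(0) ≠ 0, a multiple of v alone meets both initial conditions.
  refine ⟨fun x => y₀ / v 0 * v x + (v x * (∫ t in (0 : ℝ)..x, ψ t * F t) -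
      ψ x * ∫ t in (0 : ℝ)..x, v t * F t), fun x => y₀ / v 0 * v₁ x +
      (v₁ x * (∫ t in (0 : ℝ)..x, ψ t * F t) - ψ₁ x * ∫ t in (0 : ℝ)..x, v t * F t),
      fun x => ?_, fun x => ?_, ?_, ?_⟩
  · refine (((a1 x).const_mul _).add (((a1 x).mul (dA x)).sub ((h1 x).mul (dB x)))).congr_deriv ?_
    ring
  · refine (((a2 x).const_mul _).add (((a2 x).mul (dA x)).sub ((h2 x).mul (dB x)))).congr_deriv ?_
    linear_combination (F x) * hW x
  · simp [hv0]
  · simp [hv h0]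

variable {X κ : ℝ}

/-- Solutions of `ψ'' = q ψ` that vanish at infinity are nonzero there and decay at least at rate
`√κ`. -/
theorem decay_rate_of_tendsto_zero (h1 : ∀ x, HasDerivAt ψ (ψ₁ x) x)
    (h2 : ∀ x, HasDerivAt ψ₁ (q x * ψ x) x) (hne : ∀ x, 0 < ψ x ^ 2 + ψ₁ x ^ 2) (hκ : 0 < κ)
    (hq : ∀ x, X ≤ x → κ ≤ q x) (t1 : Tendsto ψ atTop (𝓝 0)) (t2 : Tendsto ψ₁ atTop (𝓝 0)) :
    ∀ x, X ≤ x → ψ x ≠ 0 ∧ ψ x * ψ₁ x ≤ -(Real.sqrt κ * ψ x ^ 2) := by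
  have hmono : ∀ {f f' : ℝ → ℝ}, (∀ x, HasDerivAt f (f' x) x) → (∀ x, X ≤ x → 0 ≤ f' x) →
      MonotoneOn f (Set.Ici X) := by
    intro f f' hd hf
    refine monotoneOn_of_hasDerivWithinAt_nonneg (convex_Ici X)
      (continuous_iff_continuousAt.2 fun x => (hd x).continuousAt).continuousOn
      (fun x _ => (hd x).hasDerivWithinAt) fun x hx => hf x ?_
    rw [interior_Ici] at hx; exact (Set.mem_Ioi.1 hx).le
  have hle : ∀ {f : ℝ → ℝ}, MonotoneOn f (Set.Ici X) → Tendsto f atTop (𝓝 0) →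
      ∀ x, X ≤ x → f x ≤ 0 := by
    intro f hm ht x hx
    refine ge_of_tendsto ht ?_
    filter_upwards [eventually_ge_atTop x] with y hy
    exact hm hx (hx.trans hy) hy
  -- ψψ' is nondecreasing where q > 0 and tends to 0, hence is nonpositive.
  have s1 : ∀ x, X ≤ x → ψ x * ψ₁ x ≤ 0 := by
    refine hle (hmono (f' := fun x => ψ₁ x ^ 2 + q x * ψ x ^ 2) (fun x => ?_) fun x hx => ?_) ?_
    · refine ((h1 x).mul (h2 x)).congr_deriv ?_
      ring
    · have := hκ.trans_le (hq x hx); positivity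
    · simpa using t1.mul t2
  -- The derivative 2(κ - q)ψψ' is nonnegative by the previous sign, and the limit is again 0. The
  -- resulting |ψ'| ≥ √κ |ψ| is the decay rate.
  have s2 : ∀ x, X ≤ x → κ * ψ x ^ 2 - ψ₁ x ^ 2 ≤ 0 := by
    refine hle (hmono (f' := fun x => 2 * (κ - q x) * (ψ x * ψ₁ x)) (fun x => ?_)
      fun x hx => ?_) ?_
    · refine ((((h1 x).pow 2).const_mul κ).sub ((h2 x).pow 2)).congr_deriv ?_
      norm_num; ring
    · have := s1 x hx
      have := hq x hx
      nlinarith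
    · simpa using ((t1.pow 2).const_mul κ).sub (t2.pow 2)
  intro x hx
  have hs := Real.sq_sqrt hκ.le
  have hs0 := Real.sqrt_pos.2 hκ
  constructor
  · intro h0
    have hm : ∀ y, x ≤ y → ψ y = 0 := by
      intro y hy
      have : AntitoneOn (fun x => ψ x ^ 2) (Set.Ici X) := by
        have := hmono (f := fun x => -(ψ x ^ 2)) (f' := fun x => -(2 * (ψ x * ψ₁ x))) (fun x => ?_)
          (fun x hx => by linarith [s1 x hx])
        · intro a ha b hb hab
          have := this ha hb hab
          simp only at this ⊢
          linarith
        · refine ((h1 x).pow 2).neg.congr_deriv ?_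
          norm_num; ring
      have h3 := this hx (hx.trans hy) hy
      simp only [h0] at h3
      nlinarith [sq_nonneg (ψ y)]
    have h4 : ψ₁ (x + 1) = 0 := by
      refine (h1 (x + 1)).unique ((hasDerivAt_const _ (0 : ℝ)).congr_of_eventuallyEq ?_)
      filter_upwards [eventually_gt_nhds (by linarith : x < x + 1)] with y hy using hm y hy.le
    have := hne (x + 1)
    rw [h4, hm (x + 1) (by linarith)] at this
    norm_num at this
  · have a1 := s1 x hx
    have a2 := s2 x hx
    have a3 : |Real.sqrt κ * ψ x| ≤ |ψ₁ x| := by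
      rw [← sq_le_sq, mul_pow, hs]; linarith
    have a4 : |ψ x * ψ₁ x| = -(ψ x * ψ₁ x) := abs_of_nonpos a1
    have a5 : Real.sqrt κ * ψ x ^ 2 ≤ |ψ x * ψ₁ x| := by
      rw [abs_mul, ← sq_abs, sq, ← mul_assoc]
      rw [abs_mul, abs_of_pos hs0] at a3
      have := mul_le_mul_of_nonneg_left a3 (abs_nonneg (ψ x))
      linarith
    linarith

/-- A solution of `y'' = q y - F` whose Wronskian with the decaying solution `ψ` tends to `0` is
bounded, if `F = O(ψ)`. -/
theorem bounded_of_wronskian_tendsto_zero {y y₁ F : ℝ → ℝ} {b C K : ℝ}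
    (h1 : ∀ x, HasDerivAt ψ (ψ₁ x) x)
    (h2 : ∀ x, HasDerivAt ψ₁ (q x * ψ x) x) (hne : ∀ x, 0 < ψ x ^ 2 + ψ₁ x ^ 2) (hκ : 0 < κ)
    (hq : ∀ x, X ≤ x → κ ≤ q x) (t1 : Tendsto ψ atTop (𝓝 0)) (t2 : Tendsto ψ₁ atTop (𝓝 0))
    (hb : 0 < b) (hψ : ∀ x, X ≤ x → |ψ x| ≤ K * Real.exp (-(b * x)))
    (g1 : ∀ x, HasDerivAt y (y₁ x) x) (g2 : ∀ x, HasDerivAt y₁ (q x * y x - F x) x)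
    (hF : ∀ x, X ≤ x → |F x| ≤ C * |ψ x|)
    (hw : Tendsto (fun x => ψ x * y₁ x - ψ₁ x * y x) atTop (𝓝 0)) :
    ∃ Y, ∀ x, X ≤ x → |y x| ≤ Y := by
  have hrate := decay_rate_of_tendsto_zero h1 h2 hne hκ hq t1 t2
  have hs0 := Real.sqrt_pos.2 hκ
  set l := Real.sqrt κ with hl
  set w : ℝ → ℝ := fun x => ψ x * y₁ x - ψ₁ x * y x with hwdef
  have dw : ∀ x, HasDerivAt w (-(ψ x * F x)) x := fun x => by
    refine (((h1 x).mul (g2 x)).sub ((h2 x).mul (g1 x))).congr_deriv ?_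
    ring
  have dψ : ∀ x, HasDerivAt (fun x => ψ x ^ 2) (2 * (ψ x * ψ₁ x)) x := fun x => by
    refine ((h1 x).pow 2).congr_deriv ?_
    norm_num; ring
  -- The decay (ψ²)' ≤ -2lψ² pays for |w'| = |ψF| ≤ Cψ², so both functions (s = ±1) are
  -- nonincreasing; their limit is 0.
  have hside : ∀ s : ℝ, |s| = 1 → ∀ x, X ≤ x → 0 ≤ C / (2 * l) * ψ x ^ 2 + s * w x := by
    intro s hs x hx
    have hd : ∀ x, HasDerivAt (fun x => C / (2 * l) * ψ x ^ 2 + s * w x)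
        (C / (2 * l) * (2 * (ψ x * ψ₁ x)) + s * -(ψ x * F x)) x := fun x =>
      ((dψ x).const_mul _).add ((dw x).const_mul s)
    have hanti : AntitoneOn (fun x => C / (2 * l) * ψ x ^ 2 + s * w x) (Set.Ici X) := by
      refine antitoneOn_of_hasDerivWithinAt_nonpos (convex_Ici X)
        (continuous_iff_continuousAt.2 fun x => (hd x).continuousAt).continuousOn
        (fun x _ => (hd x).hasDerivWithinAt) fun t ht => ?_
      rw [interior_Ici] at ht
      have htX : X ≤ t := (Set.mem_Ioi.1 ht).le
      obtain ⟨n0, rt⟩ := hrate t htX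
      have f1 := hF t htX
      have hC0 : 0 ≤ C := by
        by_contra! hC
        have : 0 < |ψ t| := abs_pos.2 n0
        nlinarith [abs_nonneg (F t)]
      have f2 : s * -(ψ t * F t) ≤ C * ψ t ^ 2 := by
        calc s * -(ψ t * F t) ≤ |s * -(ψ t * F t)| := le_abs_self _
          _ = |ψ t| * |F t| := by rw [abs_mul, hs, abs_neg, abs_mul, one_mul]
          _ ≤ |ψ t| * (C * |ψ t|) := mul_le_mul_of_nonneg_left f1 (abs_nonneg _)
          _ = C * ψ t ^ 2 := by rw [← sq_abs]; ring
      have f3 : C / (2 * l) * (2 * (ψ t * ψ₁ t)) ≤ C / (2 * l) * (2 * -(l * ψ t ^ 2)) :=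
        mul_le_mul_of_nonneg_left (by linarith) (by positivity)
      have f4 : C / (2 * l) * (2 * -(l * ψ t ^ 2)) = -(C * ψ t ^ 2) := by field_simp
      linarith
    have ht : Tendsto (fun x => C / (2 * l) * ψ x ^ 2 + s * w x) atTop (𝓝 0) := by
      simpa using ((t1.pow 2).const_mul (C / (2 * l))).add (hw.const_mul s)
    refine le_of_tendsto ht ?_
    filter_upwards [eventually_ge_atTop x] with t htx
    exact hanti hx (hx.trans htx) htx
  have hwb : ∀ x, X ≤ x → |w x| ≤ C / (2 * l) * ψ x ^ 2 := fun x hx => by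
    rw [abs_le]
    have a1 := hside 1 (by simp) x hx
    have a2 := hside (-1) (by simp) x hx
    constructor <;> linarith
  -- (y/ψ)' = w/ψ² is bounded, so y/ψ grows at most linearly and the exponential decay of ψ keeps y
  -- bounded.
  have hquot : ∀ x, X ≤ x → |y x / ψ x - y X / ψ X| ≤ C / (2 * l) * (x - X) := by
    intro x hx
    have := (convex_Icc X x).norm_image_sub_le_of_norm_hasDerivWithin_le
      (f := fun x => y x / ψ x) (f' := fun x => (y₁ x * ψ x - y x * ψ₁ x) / ψ x ^ 2)
      (C := C / (2 * l))
      (fun t ht => ((g1 t).div (h1 t) (hrate t ht.1).1).hasDerivWithinAt)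
      (fun t ht => by
        have n0 := (hrate t ht.1).1
        have n1 : 0 < ψ t ^ 2 := by positivity
        rw [norm_div, Real.norm_of_nonneg n1.le, div_le_iff₀ n1, Real.norm_eq_abs,
          show y₁ t * ψ t - y t * ψ₁ t = w t by simp only [hwdef]; ring]
        exact hwb t ht.1) (x := X) (y := x) ⟨le_rfl, hx⟩ ⟨hx, le_rfl⟩
    rwa [Real.norm_eq_abs, Real.norm_of_nonneg (by linarith)] at this
  have hC0 : 0 ≤ C / (2 * l) := by
    have := hquot (X + 1) (by linarith)
    have h0 := abs_nonneg (y (X + 1) / ψ (X + 1) - y X / ψ X)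
    linarith
  have hK0 : 0 ≤ K := by
    have := (abs_nonneg _).trans (hψ X le_rfl)
    exact nonneg_of_mul_nonneg_left this (Real.exp_pos _)
  refine ⟨K * Real.exp (-(b * X)) * |y X / ψ X| + C / (2 * l) * (K * Real.exp (-(b * X)) / b),
    fun x hx => ?_⟩
  have n0 := (hrate x hx).1
  have e1 : |y x| = |y x / ψ x| * |ψ x| := by rw [← abs_mul, div_mul_cancel₀ _ n0]
  have e2 : |y x / ψ x| ≤ |y X / ψ X| + C / (2 * l) * (x - X) := by
    have := abs_sub_abs_le_abs_sub (y x / ψ x) (y X / ψ X)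
    linarith [hquot x hx]
  have e3 : Real.exp (-(b * x)) ≤ Real.exp (-(b * X)) := Real.exp_le_exp.2 (by nlinarith)
  have e4 : (x - X) * Real.exp (-(b * x)) ≤ Real.exp (-(b * X)) / b := by
    rw [le_div_iff₀ hb]
    have : b * (x - X) ≤ Real.exp (b * (x - X)) := by linarith [Real.add_one_le_exp (b * (x - X))]
    calc (x - X) * Real.exp (-(b * x)) * b = b * (x - X) * Real.exp (-(b * x)) := by ring
      _ ≤ Real.exp (b * (x - X)) * Real.exp (-(b * x)) :=
          mul_le_mul_of_nonneg_right this (Real.exp_pos _).le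
      _ = Real.exp (-(b * X)) := by rw [← Real.exp_add]; congr 1; ring
  calc |y x| = |y x / ψ x| * |ψ x| := e1
    _ ≤ (|y X / ψ X| + C / (2 * l) * (x - X)) * (K * Real.exp (-(b * x))) :=
        mul_le_mul e2 (hψ x hx) (abs_nonneg _) (by
          have : 0 ≤ x - X := by linarith
          positivity)
    _ = K * Real.exp (-(b * x)) * |y X / ψ X| +
          C / (2 * l) * (K * ((x - X) * Real.exp (-(b * x)))) := by ring
    _ ≤ _ := by
        gcongr
        rw [mul_div_assoc]
        gcongr

/-- A square integrable solution of `y'' = q y` is bounded on `[X, ∞)`. -/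
theorem bounded_of_integrable_sq {y y₁ : ℝ → ℝ} (hκ : 0 ≤ κ) (hq : ∀ x, X ≤ x → κ ≤ q x)
    (g1 : ∀ x, HasDerivAt y (y₁ x) x) (g2 : ∀ x, HasDerivAt y₁ (q x * y x) x)
    (hi : Integrable fun x => y x ^ 2) : ∀ x, X ≤ x → |y x| ≤ |y X| := by
  have d1 : ∀ x, HasDerivAt (fun x => y x ^ 2) (2 * (y x * y₁ x)) x := fun x => by
    refine ((g1 x).pow 2).congr_deriv ?_
    norm_num; ring
  have d2 : ∀ x, HasDerivAt (fun x => 2 * (y x * y₁ x)) (2 * (y₁ x ^ 2 + q x * y x ^ 2)) x :=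
    fun x => by
      refine (((g1 x).mul (g2 x)).const_mul 2).congr_deriv ?_
      ring
  have hmono : MonotoneOn (fun x => 2 * (y x * y₁ x)) (Set.Ici X) := by
    refine monotoneOn_of_hasDerivWithinAt_nonneg (convex_Ici X)
      (continuous_iff_continuousAt.2 fun x => (d2 x).continuousAt).continuousOn
      (fun x _ => (d2 x).hasDerivWithinAt) fun x hx => ?_
    rw [interior_Ici] at hx
    have := hκ.trans (hq x (Set.mem_Ioi.1 hx).le)
    positivity
  -- y² is convex on [X, ∞). A positive slope somewhere would keep y² above a positive constant from
  -- then on, contrary to integrability.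
  have hneg : ∀ x, X ≤ x → 2 * (y x * y₁ x) ≤ 0 := by
    intro x hx
    by_contra! hpos
    set ε := 2 * (y x * y₁ x) with hε
    have hge : ∀ t, x + 1 ≤ t → ε ≤ y t ^ 2 := by
      intro t ht
      have hxt : x ≤ t := by linarith
      have := (convex_Ici x).mul_sub_le_image_sub_of_le_deriv (f := fun x => y x ^ 2) (C := ε)
        (continuous_iff_continuousAt.2 fun x => (d1 x).continuousAt).continuousOn
        (fun s _ => (d1 s).differentiableAt.differentiableWithinAt)
        (fun s hs => by
          rw [interior_Ici] at hs
          rw [(d1 s).deriv]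
          exact hmono hx (hx.trans (Set.mem_Ioi.1 hs).le) (Set.mem_Ioi.1 hs).le)
        x (Set.mem_Ici.2 le_rfl) t hxt hxt
      have : ε * 1 ≤ ε * (t - x) := mul_le_mul_of_nonneg_left (by linarith) hpos.le
      nlinarith [sq_nonneg (y x)]
    have hconst : IntegrableOn (fun _ : ℝ => ε) (Set.Ioi (x + 1)) := by
      refine Integrable.mono' hi.integrableOn aestronglyMeasurable_const ?_
      filter_upwards [ae_restrict_mem measurableSet_Ioi] with t ht
      rw [Real.norm_of_nonneg hpos.le]
      exact hge t (Set.mem_Ioi.1 ht).le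
    rw [integrableOn_const_iff] at hconst
    rcases hconst with h | h
    · exact hpos.ne' (enorm_eq_zero.1 h)
    · simp at h
  have hanti : AntitoneOn (fun x => y x ^ 2) (Set.Ici X) := by
    refine antitoneOn_of_hasDerivWithinAt_nonpos (convex_Ici X)
      (continuous_iff_continuousAt.2 fun x => (d1 x).continuousAt).continuousOn
      (fun x _ => (d1 x).hasDerivWithinAt) fun x hx => ?_
    rw [interior_Ici] at hx
    exact hneg x (Set.mem_Ioi.1 hx).le
  intro x hx
  exact sq_le_sq.1 (hanti (Set.mem_Ici.2 le_rfl) hx hx)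

end Schrodinger

/-! ### Exponential weights -/

theorem integrable_expW {b : ℝ} (hb : 0 < b) : Integrable (expW b) := by
  have hIoi : IntegrableOn (expW b) (Set.Ioi 0) := by
    refine (integrableOn_exp_mul_Ioi (a := -b) (by linarith) 0).congr_fun (fun x hx => ?_)
      measurableSet_Ioi
    simp only [expW]; rw [abs_of_pos (Set.mem_Ioi.1 hx), neg_mul]
  have hIic : IntegrableOn (expW b) (Set.Iic 0) := by
    refine (integrableOn_exp_mul_Iic hb 0).congr_fun (fun x hx => ?_) measurableSet_Iic
    simp only [expW]; rw [abs_of_nonpos (Set.mem_Iic.1 hx)]; ring_nf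
  rw [← integrableOn_univ, ← Set.Iic_union_Ioi (a := (0 : ℝ))]
  exact hIic.union hIoi

theorem integrable_of_le_expW {f : ℝ → ℝ} {b C : ℝ} (hf : Continuous f) (hb : 0 < b)
    (h : ∀ x, |f x| ≤ C * expW b x) : Integrable f :=
  ((integrable_expW hb).const_mul C).mono' hf.aestronglyMeasurable (Eventually.of_forall h)

theorem expW_mul (b d x : ℝ) : expW b x * expW d x = expW (b + d) x := by
  rw [expW, expW, expW, ← Real.exp_add]; congr 1; ring

theorem memLp_of_le_expW {f : ℝ → ℝ} {b C : ℝ} (hf : Continuous f) (hb : 0 < b)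
    (h : ∀ x, |f x| ≤ C * expW b x) : MemLp f 2 := by
  rw [memLp_two_iff_integrable_sq hf.aestronglyMeasurable]
  refine integrable_of_le_expW (b := b + b) (C := C ^ 2) (hf.pow 2) (by linarith) fun x => ?_
  rw [abs_pow, ← expW_mul]
  calc |f x| ^ 2 ≤ (C * expW b x) ^ 2 := pow_le_pow_left₀ (abs_nonneg _) (h x) 2
    _ = _ := by ring

/-- The one-sided weight `min 1 (e^{bx})`. -/
def leftW (b x : ℝ) : ℝ := min 1 (Real.exp (b * x))

theorem leftW_nonneg (b x : ℝ) : 0 ≤ leftW b x := le_min zero_le_one (Real.exp_pos _).le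

theorem expW_le_leftW {b : ℝ} (hb : 0 ≤ b) (x : ℝ) : expW b x ≤ leftW b x := by
  refine le_min ?_ ?_
  · rw [expW, Real.exp_le_one_iff]; have := mul_nonneg hb (abs_nonneg x); linarith
  · rw [expW, Real.exp_le_exp]
    nlinarith [neg_abs_le x]

/-- For 0 < a < b the rate min a (b - a) is positive: the exponential factor decays on the right,
and `leftW` outweighs its growth on the left. -/
theorem exp_mul_leftW_le {a b : ℝ} (x : ℝ) :
    Real.exp (-(a * x)) * leftW b x ≤ expW (min a (b - a)) x := by
  rcases le_total 0 x with h | h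
  · calc Real.exp (-(a * x)) * leftW b x ≤ Real.exp (-(a * x)) * 1 :=
          mul_le_mul_of_nonneg_left (min_le_left _ _) (Real.exp_pos _).le
      _ ≤ _ := by
          rw [mul_one, expW, abs_of_nonneg h, Real.exp_le_exp]
          nlinarith [min_le_left a (b - a)]
  · calc Real.exp (-(a * x)) * leftW b x ≤ Real.exp (-(a * x)) * Real.exp (b * x) :=
          mul_le_mul_of_nonneg_left (min_le_right _ _) (Real.exp_pos _).le
      _ ≤ _ := by
          rw [← Real.exp_add, expW, abs_of_nonpos h, Real.exp_le_exp]
          nlinarith [min_le_right a (b - a)]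

theorem exp_mul_expW_le {a b : ℝ} (x : ℝ) :
    Real.exp (a * x) * expW b x ≤ expW (b - |a|) x := by
  rw [expW, ← Real.exp_add, expW, Real.exp_le_exp]
  have := le_abs_self (a * x)
  rw [abs_mul] at this
  linarith

theorem continuous_expW (b : ℝ) : Continuous (expW b) := by
  unfold expW; fun_prop

/-! ### Test functions -/

theorem dec_of_hasCompactSupport {w f : ℝ → ℝ} (hw : Continuous w) (hw0 : ∀ x, 0 < w x)
    (hf : ContDiff ℝ ∞ f) (hc : HasCompactSupport f) : Dec w f := by
  have h0 : ∀ {f : ℝ → ℝ}, ContDiff ℝ ∞ f → HasCompactSupport f → ∃ C, ∀ x, |f x| ≤ C * w x := by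
    intro f hf hc
    obtain ⟨C, hC⟩ := (hc.mul_right (f' := fun x => (w x)⁻¹)).exists_bound_of_continuous
      (hf.continuous.mul (hw.inv₀ fun x => (hw0 x).ne'))
    refine ⟨C, fun x => ?_⟩
    have := hC x
    rw [Pi.mul_apply, norm_mul, norm_inv, Real.norm_of_nonneg (hw0 x).le, ← div_eq_mul_inv,
      div_le_iff₀ (hw0 x)] at this
    exact this
  intro k
  induction k generalizing f with
  | zero => exact ⟨hf, h0 hf hc⟩
  | succ k ih => exact ⟨⟨hf, h0 hf hc⟩, ih (contDiff_infty_deriv hf) hc.deriv⟩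

theorem exists_bound_support {f : ℝ → ℝ} (hc : HasCompactSupport f) :
    ∃ R, 0 ≤ R ∧ ∀ x, R < |x| → f x = 0 := by
  obtain ⟨R, hR⟩ := (hc.isCompact.isBounded).subset_closedBall 0
  refine ⟨max R 0, le_max_right _ _, fun x hx => ?_⟩
  by_contra h
  have := hR (subset_tsupport f h)
  rw [Metric.mem_closedBall, dist_zero_right, Real.norm_eq_abs] at this
  exact absurd (lt_of_le_of_lt (le_max_left R 0) hx) (not_lt.2 this)

theorem hasCompactSupport_of_bound {f : ℝ → ℝ} {R : ℝ} (h : ∀ x, R < |x| → f x = 0) :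
    HasCompactSupport f := by
  refine HasCompactSupport.intro (isCompact_Icc (a := -R) (b := R)) fun x hx => h x ?_
  by_contra! h'
  exact hx (abs_le.1 h')

theorem integral_deriv_eq_zero {f : ℝ → ℝ} (hf : ContDiff ℝ ∞ f) (hc : HasCompactSupport f) :
    ∫ x, deriv f x = 0 :=
  integral_eq_zero_of_hasDerivAt_of_integrable (hasDerivAt_of_smooth hf)
    ((contDiff_infty_deriv hf).continuous.integrable_of_hasCompactSupport hc.deriv)
    (hf.continuous.integrable_of_hasCompactSupport hc)

/-- Left primitives of exponentially decaying functions. -/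
theorem dec_primitive {f : ℝ → ℝ} {b : ℝ} (hb : 0 < b) (hf : Dec (expW b) f) :
    Dec (leftW b) (fun x => ∫ t in Set.Iic x, f t) ∧
      ∀ x, HasDerivAt (fun x => ∫ t in Set.Iic x, f t) (f x) x := by
  obtain ⟨C, hC0, hC⟩ := exists_nonneg_bound (fun x => (expW_pos b x).le) hf.bound
  have hi : Integrable f := integrable_of_le_expW hf.contDiff.continuous hb hC
  have hd := hasDerivAt_integral_Iic hf.contDiff.continuous fun a => hi.integrableOn (s := Set.Iic a)
  refine ⟨?_, hd⟩
  have hderiv : deriv (fun x => ∫ t in Set.Iic x, f t) = f := funext fun x => (hd x).deriv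
  have hbound : ∀ x, |∫ t in Set.Iic x, f t| ≤ (∫ t, |f t|) + C / b * 1 := fun x => by
    have h1 : |∫ t in Set.Iic x, f t| ≤ ∫ t in Set.Iic x, |f t| := by
      simpa using norm_integral_le_integral_norm (μ := volume.restrict (Set.Iic x)) f
    have h2 : ∫ t in Set.Iic x, |f t| ≤ ∫ t, |f t| :=
      setIntegral_le_integral hi.abs (Eventually.of_forall fun t => abs_nonneg _)
    have : 0 ≤ C / b := by positivity
    linarith
  have hI0 : 0 ≤ ∫ t, |f t| := integral_nonneg fun t => abs_nonneg _
  refine Dec.of_deriv (contDiff_infty_iff_deriv.2 ⟨fun x => (hd x).differentiableAt,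
    by rw [hderiv]; exact hf.contDiff⟩) ⟨(∫ t, |f t|) + C / b, fun x => ?_⟩ ?_
  · rcases le_total 0 x with h | h
    · rw [leftW, min_eq_left (Real.one_le_exp (by positivity))]
      have := hbound x
      linarith
    · rw [leftW, min_eq_right (by rw [Real.exp_le_one_iff]; nlinarith)]
      have h1 : ‖∫ t in Set.Iic x, f t‖ ≤ ∫ t in Set.Iic x, C * Real.exp (b * t) := by
        refine norm_integral_le_of_norm_le ((integrableOn_exp_mul_Iic hb x).const_mul C) ?_
        filter_upwards [ae_restrict_mem measurableSet_Iic] with t ht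
        have := hC t
        rw [expW, abs_of_nonpos ((Set.mem_Iic.1 ht).trans h)] at this
        rw [Real.norm_eq_abs]
        convert this using 3
        ring
      rw [integral_const_mul, integral_exp_mul_Iic hb] at h1
      rw [Real.norm_eq_abs] at h1
      refine h1.trans ?_
      have : 0 ≤ (∫ t, |f t|) * Real.exp (b * x) := by positivity
      have e : C * (Real.exp (b * x) / b) = C / b * Real.exp (b * x) := by ring
      rw [e, add_mul]; linarith
  · rw [hderiv]
    exact hf.mono (K := 1) (fun x => (expW_pos b x).le)
      fun x => by rw [one_mul]; exact expW_le_leftW hb.le x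

/-- Test functions with vanishing integral are derivatives of test functions. -/
theorem exists_test_primitive {f : ℝ → ℝ} (hf : ContDiff ℝ ∞ f) (hc : HasCompactSupport f)
    (h0 : ∫ x, f x = 0) : ∃ K : ℝ → ℝ, ContDiff ℝ ∞ K ∧ HasCompactSupport K ∧ deriv K = f := by
  have hi : Integrable f := hf.continuous.integrable_of_hasCompactSupport hc
  have hd := hasDerivAt_integral_Iic hf.continuous fun a => hi.integrableOn (s := Set.Iic a)
  have hderiv : deriv (fun x => ∫ t in Set.Iic x, f t) = f := funext fun x => (hd x).deriv
  refine ⟨fun x => ∫ t in Set.Iic x, f t, contDiff_infty_iff_deriv.2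
    ⟨fun x => (hd x).differentiableAt, by rw [hderiv]; exact hf⟩, ?_, hderiv⟩
  obtain ⟨R, hR0, hR⟩ := exists_bound_support hc
  refine hasCompactSupport_of_bound (R := R) fun x hx => ?_
  rcases le_total 0 x with h | h
  · rw [abs_of_nonneg h] at hx
    have e := intervalIntegral.integral_Iic_add_Ioi (hi.integrableOn (s := Set.Iic x))
      (hi.integrableOn (s := Set.Ioi x))
    rw [h0, setIntegral_eq_zero_of_forall_eq_zero (t := Set.Ioi x) (fun t ht => hR t ?_),
      add_zero] at e
    · exact e
    · exact (hx.trans (Set.mem_Ioi.1 ht)).trans_le (le_abs_self t)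
  · rw [abs_of_nonpos h] at hx
    refine setIntegral_eq_zero_of_forall_eq_zero fun t ht => hR t ?_
    have := Set.mem_Iic.1 ht
    have := neg_abs_le t
    linarith

/-- A distribution that vanishes on the test functions orthogonal to `g` is a multiple of `g`. -/
theorem ae_eq_smul_of_integral_eq_zero {y : ℝ → ℂ} {g : ℝ → ℝ} (hy : LocallyIntegrable y)
    (hg : Continuous g) (h : ∀ ρ : ℝ → ℝ, ContDiff ℝ ∞ ρ → HasCompactSupport ρ →
      ∫ x, ρ x * g x = 0 → ∫ x, ρ x • y x = 0) : ∃ α : ℂ, ∀ᵐ x, y x = α * g x := by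
  by_cases hex : ∃ ρ : ℝ → ℝ, ContDiff ℝ ∞ ρ ∧ HasCompactSupport ρ ∧ ∫ x, ρ x * g x ≠ 0
  · obtain ⟨ρ₀, hs₀, hc₀, hne⟩ := hex
    set α : ℂ := (∫ x, ρ₀ x • y x) / ((∫ x, ρ₀ x * g x : ℝ) : ℂ) with hα
    refine ⟨α, ?_⟩
    have hcont : Continuous fun x => α * (g x : ℂ) := by fun_prop
    refine ae_eq_of_integral_contDiff_smul_eq hy hcont.locallyIntegrable fun ρ hs hc => ?_
    have hint : ∀ {ρ : ℝ → ℝ}, ContDiff ℝ ∞ ρ → HasCompactSupport ρ →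
        Integrable fun x => ρ x * g x := fun hs hc =>
      (hs.continuous.mul hg).integrable_of_hasCompactSupport hc.mul_right
    have hinty : ∀ {ρ : ℝ → ℝ}, ContDiff ℝ ∞ ρ → HasCompactSupport ρ →
        Integrable fun x => ρ x • y x := fun hs hc =>
      hy.integrable_smul_left_of_hasCompactSupport hs.continuous hc
    -- Subtracting t ρ₀ projects ρ onto the test functions orthogonal to g.
    set t : ℝ := (∫ x, ρ x * g x) / ∫ x, ρ₀ x * g x with ht
    have h1 := h (fun x => ρ x - t * ρ₀ x) (hs.sub (contDiff_const.mul hs₀))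
      (hc.sub hc₀.mul_left) (by
        have : ∀ x, (ρ x - t * ρ₀ x) * g x = ρ x * g x - t * (ρ₀ x * g x) := fun x => by ring
        simp only [this]
        rw [integral_sub (hint hs hc) ((hint hs₀ hc₀).const_mul t), integral_const_mul, ht,
          div_mul_cancel₀ _ hne, sub_self])
    have e1 : ∀ x, (ρ x - t * ρ₀ x) • y x = ρ x • y x - t • (ρ₀ x • y x) := fun x => by
      rw [sub_smul, mul_smul]
    simp only [e1] at h1
    rw [integral_sub (hinty hs hc) ((hinty hs₀ hc₀).fun_smul t), integral_smul, sub_eq_zero] at h1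
    rw [h1]
    have e2 : ∀ x, ρ x • (α * (g x : ℂ)) = α * ((ρ x * g x : ℝ) : ℂ) := fun x => by
      rw [Complex.real_smul]; push_cast; ring
    simp only [e2]
    rw [integral_const_mul, integral_complex_ofReal, hα, ht, Complex.real_smul]
    have : ((∫ x, ρ₀ x * g x : ℝ) : ℂ) ≠ 0 := by exact_mod_cast hne
    push_cast
    field_simp
  · push Not at hex
    refine ⟨0, ?_⟩
    have := ae_eq_zero_of_integral_contDiff_smul_eq_zero hy fun ρ hs hc => h ρ hs hc (hex ρ hs hc)
    filter_upwards [this] with x hx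
    rw [hx, zero_mul]

/-! ### The linearized operator in terms of abstract coefficients -/

/-- Coefficients `r = φ ^ n`, `σ = φ ^ (-m)` and their inverses, potential `q` and zero mode
`ψ = φ ^ (-m) φ'`, such that `L (σ⁻¹ v) = c r (-v'' + q v)`. -/
structure Coeffs where
  (c b X δ κ : ℝ)
  (r ri σ σi q ψ : ℝ → ℝ)
  c_pos : 0 < c
  b_pos : 0 < b
  X_nonneg : 0 ≤ X
  δ_nonneg : 0 ≤ δ
  dec_r : Dec wOne r
  dec_ri : Dec wOne ri
  dec_σ : Dec wOne σ
  dec_σi : Dec wOne σi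
  dec_q : Dec wOne q
  dec_ψ : Dec (expW b) ψ
  r_pos : ∀ x, 0 < r x
  σ_pos : ∀ x, 0 < σ x
  ri_mul : ∀ x, ri x * r x = 1
  σi_mul : ∀ x, σi x * σ x = 1
  ψ_ode : ∀ x, deriv (deriv ψ) x = q x * ψ x
  ψ_ne : ∀ x, 0 < ψ x ^ 2 + deriv ψ x ^ 2
  q_far : ∀ x, X ≤ |x| → κ ≤ q x
  drift_far : ∀ x, X ≤ |x| → |ri x * deriv r x| ≤ δ
  pot_far : ∀ x, X ≤ |x| → κ ≤ ri x * σi x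
  rate : b ^ 2 + δ * b < κ

namespace Coeffs

variable (P : Coeffs)

/-- The formal adjoint of `M`. -/
def M (χ : ℝ → ℝ) (x : ℝ) : ℝ := χ x - P.σ x * deriv (fun y => P.r y * deriv χ y) x

/-- The formal adjoint of `L`. -/
def L (θ : ℝ → ℝ) (x : ℝ) : ℝ :=
  -P.c * P.σ x * deriv (deriv fun y => P.r y * θ y) x + P.c * P.σ x * P.q x * P.r x * θ x

theorem κ_pos : 0 < P.κ :=
  lt_of_le_of_lt (add_nonneg (sq_nonneg _) (mul_nonneg P.δ_nonneg P.b_pos.le)) P.rate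

theorem sq_lt : P.b ^ 2 + 0 * P.b < P.κ := by
  have := P.rate
  have := mul_nonneg P.δ_nonneg P.b_pos.le
  linarith

theorem ψ_hasDerivAt (x : ℝ) : HasDerivAt P.ψ (deriv P.ψ x) x :=
  hasDerivAt_of_smooth P.dec_ψ.contDiff x

theorem dψ_hasDerivAt (x : ℝ) : HasDerivAt (deriv P.ψ) (P.q x * P.ψ x) x := by
  rw [← P.ψ_ode]; exact hasDerivAt_of_smooth P.dec_ψ.deriv.contDiff x

theorem tendsto_zero_of_dec {b : ℝ} (hb : 0 < b) {f : ℝ → ℝ} (h : Dec (expW b) f) :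
    Tendsto f atTop (𝓝 0) ∧ Tendsto f atBot (𝓝 0) := by
  obtain ⟨C, hC⟩ := h.bound
  have ht : Tendsto (fun x : ℝ => C * Real.exp (-(b * x))) atTop (𝓝 0) := by
    have := (Real.tendsto_exp_neg_atTop_nhds_zero.comp
      (tendsto_id.const_mul_atTop hb)).const_mul C
    simpa using this
  constructor
  · refine squeeze_zero_norm' ?_ ht
    filter_upwards [eventually_ge_atTop 0] with x hx
    have := hC x
    rwa [expW, abs_of_nonneg hx] at this
  · refine squeeze_zero_norm' ?_ (ht.comp tendsto_neg_atBot_atTop)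
    filter_upwards [eventually_le_atBot 0] with x hx
    have := hC x
    rwa [expW, abs_of_nonpos hx] at this

/-- A bounded solution of `y'' = q y - F` with decaying `F` decays. -/
theorem dec_of_bounded {y y₁ F : ℝ → ℝ} (g1 : ∀ x, HasDerivAt y (y₁ x) x)
    (g2 : ∀ x, HasDerivAt y₁ (P.q x * y x - F x) x) (hF : Dec (expW P.b) F)
    (hY : ∃ Y, ∀ x, |y x| ≤ Y) : Dec (expW P.b) y := by
  have hy : ContDiff ℝ ∞ y := contDiff_of_second_order (p := fun _ => 0) (F := fun x => -F x) g1
    (fun x => (g2 x).congr_deriv (by ring)) contDiff_const P.dec_q.contDiff hF.contDiff.neg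
  have hyb := exists_expW_bound (κ₁ := fun _ => 0) (F := fun x => -F x) g1 g2 P.b_pos
    (fun x => by ring) hF.neg.bound P.X_nonneg (δ := 0) (fun x _ => by simp) P.q_far P.sq_lt hY
  obtain ⟨A, hA0, hA⟩ := exists_nonneg_bound (fun x => (expW_pos P.b x).le) hyb
  obtain ⟨B, hB0, hB⟩ := exists_nonneg_bound (fun x => (expW_pos P.b x).le) hF.bound
  obtain ⟨Q, hQ0, hQ⟩ := exists_nonneg_bound (w := wOne) (fun x => zero_le_one) P.dec_q.bound
  simp only [wOne, mul_one] at hQ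
  have e1 : deriv y = y₁ := funext fun x => (g1 x).deriv
  have e2 : deriv y₁ = fun x => P.q x * y x - F x := funext fun x => (g2 x).deriv
  have hyd := abs_flux_le_weight (w := expW P.b) (A := A) (B := Q * A + B) (P := 1)
    (K := Real.exp P.b) (ρ := fun _ => 1) (fun x => by simpa using g1 x) g2
    (fun x => by simp) zero_le_one hA0 (by positivity) hA (fun x => by
      refine (abs_sub _ _).trans ?_
      rw [abs_mul, add_mul, mul_assoc]
      exact add_le_add (mul_le_mul (hQ x) (hA x) (abs_nonneg _) hQ0) (hB x))
    (expW_shift P.b_pos.le)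
  refine dec_of_ode (p := fun _ => 0) hy hyb (by rw [e1]; exact ⟨_, hyd⟩) (dec_const 0) P.dec_q
    hF.neg fun x => ?_
  rw [e1, e2]; ring

/-- Variation of constants in which the coefficient of the second solution is integrated from +∞.
Its Wronskian with ψ is then exactly the tail integral, which vanishes at +∞. -/
theorem exists_wronskian_solution {F : ℝ → ℝ} (hF : Dec (expW P.b) F) :
    ∃ y y₁ : ℝ → ℝ, (∀ x, HasDerivAt y (y₁ x) x) ∧
      (∀ x, HasDerivAt y₁ (P.q x * y x - F x) x) ∧
      ∀ x, P.ψ x * y₁ x - deriv P.ψ x * y x = ∫ t in Set.Ioi x, P.ψ t * F t := by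
  obtain ⟨v, v₁, a1, a2, hW, -⟩ := exists_second_solution P.dec_q.contDiff.continuous
    P.ψ_hasDerivAt P.dψ_hasDerivAt P.ψ_ne
  have c2 : Continuous v := continuous_iff_continuousAt.2 fun x => (a1 x).continuousAt
  have cF := hF.contDiff.continuous
  have cψ := P.dec_ψ.contDiff.continuous
  have hi : Integrable fun x => P.ψ x * F x := by
    obtain ⟨C, hC⟩ := (P.dec_ψ 0).mul (hF 0) |>.bound
    refine integrable_of_le_expW (b := P.b + P.b) (C := C) (cψ.mul cF) (by linarith [P.b_pos])
      fun x => ?_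
    rw [← expW_mul]; exact hC x
  have dA := hasDerivAt_integral_Ioi (cψ.fun_mul cF) fun a => hi.integrableOn
  have dB : ∀ x, HasDerivAt (fun x => ∫ t in (0 : ℝ)..x, v t * F t) (v x * F x) x := fun x =>
    intervalIntegral.integral_hasDerivAt_right ((c2.fun_mul cF).intervalIntegrable _ _)
      ((c2.fun_mul cF).stronglyMeasurableAtFilter _ _) (c2.fun_mul cF).continuousAt
  refine ⟨fun x => v x * (∫ t in Set.Ioi x, P.ψ t * F t) + P.ψ x * ∫ t in (0 : ℝ)..x, v t * F t,
    fun x => v₁ x * (∫ t in Set.Ioi x, P.ψ t * F t) +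
      deriv P.ψ x * ∫ t in (0 : ℝ)..x, v t * F t, fun x => ?_, fun x => ?_, fun x => ?_⟩
  · refine (((a1 x).mul (dA x)).add ((P.ψ_hasDerivAt x).mul (dB x))).congr_deriv ?_
    ring
  · refine (((a2 x).mul (dA x)).add ((P.dψ_hasDerivAt x).mul (dB x))).congr_deriv ?_
    linear_combination (-F x) * hW x
  · linear_combination (∫ t in Set.Ioi x, P.ψ t * F t) * hW x

/-- The Fredholm alternative for `-y'' + q y = F` in the class of exponentially decaying
functions, for right-hand sides dominated by the zero mode. -/
theorem exists_dec_solution {F : ℝ → ℝ} (hF : Dec (expW P.b) F) {C X : ℝ}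
    (hFψ : ∀ x, X ≤ |x| → |F x| ≤ C * |P.ψ x|) (h0 : ∫ x, P.ψ x * F x = 0) :
    ∃ y : ℝ → ℝ, Dec (expW P.b) y ∧ ∀ x, -deriv (deriv y) x + P.q x * y x = F x := by
  obtain ⟨y, y₁, g1, g2, hw⟩ := P.exists_wronskian_solution hF
  have cF := hF.contDiff.continuous
  have cψ := P.dec_ψ.contDiff.continuous
  have hi : Integrable fun x => P.ψ x * F x := by
    obtain ⟨C, hC⟩ := (P.dec_ψ 0).mul (hF 0) |>.bound
    refine integrable_of_le_expW (b := P.b + P.b) (C := C) (cψ.mul cF) (by linarith [P.b_pos])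
      fun x => ?_
    rw [← expW_mul]; exact hC x
  have hwtop : Tendsto (fun x => P.ψ x * y₁ x - deriv P.ψ x * y x) atTop (𝓝 0) := by
    simp only [hw]
    have h1 := intervalIntegral_tendsto_integral_Ioi 0 (hi.integrableOn (s := Set.Ioi 0)) tendsto_id
    have h2 : ∀ x : ℝ, ∫ t in Set.Ioi x, P.ψ t * F t =
        (∫ t in Set.Ioi 0, P.ψ t * F t) - ∫ t in (0 : ℝ)..x, P.ψ t * F t := fun x => by
      rw [← intervalIntegral.integral_Ioi_sub_Ioi' (hi.integrableOn (s := Set.Ioi 0))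
        (hi.integrableOn (s := Set.Ioi x))]
      ring
    refine Tendsto.congr (fun x => (h2 x).symm) ?_
    simpa using h1.const_sub (∫ t in Set.Ioi 0, P.ψ t * F t)
  -- The solvability condition enters here: since ∫ ψF = 0, the tail from x to ∞ is minus the tail
  -- from -∞ to x, so the same solution is controlled at both ends.
  have hwbot : Tendsto (fun x => P.ψ x * y₁ x - deriv P.ψ x * y x) atBot (𝓝 0) := by
    simp only [hw]
    have h1 := intervalIntegral_tendsto_integral_Iic 0 (hi.integrableOn (s := Set.Iic 0)) tendsto_id
    have h2 : ∀ x : ℝ, ∫ t in Set.Ioi x, P.ψ t * F t =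
        (∫ t in x..(0 : ℝ), P.ψ t * F t) - ∫ t in Set.Iic 0, P.ψ t * F t := fun x => by
      have e1 := intervalIntegral.integral_Iic_add_Ioi (hi.integrableOn (s := Set.Iic x))
        (hi.integrableOn (s := Set.Ioi x))
      rw [← intervalIntegral.integral_Iic_sub_Iic (hi.integrableOn (s := Set.Iic x))
        (hi.integrableOn (s := Set.Iic 0))]
      linarith
    refine Tendsto.congr (fun x => (h2 x).symm) ?_
    simpa using h1.sub_const (∫ t in Set.Iic 0, P.ψ t * F t)
  obtain ⟨K, hK⟩ := P.dec_ψ.bound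
  have t1 := tendsto_zero_of_dec P.b_pos P.dec_ψ
  have t2 := tendsto_zero_of_dec P.b_pos P.dec_ψ.deriv
  set Z := max P.X X with hZ
  have hZ0 : 0 ≤ Z := P.X_nonneg.trans (le_max_left _ _)
  have hZX : ∀ x, Z ≤ x → P.X ≤ |x| := fun x hx =>
    ((le_max_left _ _).trans hx).trans (le_abs_self x)
  have hZX' : ∀ x, Z ≤ x → X ≤ |x| := fun x hx =>
    ((le_max_right _ _).trans hx).trans (le_abs_self x)
  obtain ⟨Y1, hY1⟩ := bounded_of_wronskian_tendsto_zero (X := Z) (b := P.b) (K := K) (C := C)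
    P.ψ_hasDerivAt P.dψ_hasDerivAt P.ψ_ne
    P.κ_pos (fun x hx => P.q_far x (hZX x hx)) t1.1 t2.1 P.b_pos
    (fun x hx => by
      have := hK x
      rwa [expW, abs_of_nonneg (hZ0.trans hx)] at this) g1 g2
    (fun x hx => hFψ x (hZX' x hx)) hwtop
  have refl1 : ∀ {f f' : ℝ → ℝ}, (∀ x, HasDerivAt f (f' x) x) →
      ∀ x, HasDerivAt (fun x => f (-x)) (-f' (-x)) x := fun h x => hasDerivAt_comp_neg_arg (h (-x))
  obtain ⟨Y2, hY2⟩ := bounded_of_wronskian_tendsto_zero (X := Z) (b := P.b) (K := K) (C := C)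
    (ψ := fun x => P.ψ (-x)) (ψ₁ := fun x => -deriv P.ψ (-x)) (q := fun x => P.q (-x))
    (y := fun x => y (-x)) (y₁ := fun x => -y₁ (-x)) (F := fun x => F (-x))
    (refl1 P.ψ_hasDerivAt)
    (fun x => (refl1 P.dψ_hasDerivAt x).fun_neg.congr_deriv (neg_neg _))
    (fun x => by simpa using P.ψ_ne (-x))
    P.κ_pos (fun x hx => P.q_far (-x) (by rw [abs_neg]; exact hZX x hx))
    (t1.2.comp tendsto_neg_atTop_atBot)
    (by simpa using (t2.2.comp tendsto_neg_atTop_atBot).neg) P.b_pos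
    (fun x hx => by
      have := hK (-x)
      rwa [expW, abs_neg, abs_of_nonneg (hZ0.trans hx)] at this) (refl1 g1)
    (fun x => (refl1 g2 x).fun_neg.congr_deriv (neg_neg _))
    (fun x hx => hFψ (-x) (by rw [abs_neg]; exact hZX' x hx))
    (by
      have := (hwbot.comp tendsto_neg_atTop_atBot).neg
      simp only [Function.comp_def, neg_zero] at this
      refine this.congr fun x => ?_
      ring)
  have cy : Continuous y := continuous_iff_continuousAt.2 fun x => (g1 x).continuousAt
  have hY : ∃ Y, ∀ x, |y x| ≤ Y := by
    obtain ⟨Y0, hY0⟩ := (isCompact_Icc (a := -Z) (b := Z)).exists_bound_of_continuousOn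
      cy.continuousOn
    refine ⟨max Y0 (max Y1 Y2), fun x => ?_⟩
    rcases le_total Z x with h | h
    · exact (hY1 x h).trans ((le_max_left _ _).trans (le_max_right _ _))
    · rcases le_total x (-Z) with h' | h'
      · have := hY2 (-x) (by linarith)
        rw [neg_neg] at this
        exact this.trans ((le_max_right _ _).trans (le_max_right _ _))
      · exact (hY0 x ⟨h', h⟩).trans (le_max_left _ _)
  refine ⟨y, P.dec_of_bounded g1 g2 hF hY, fun x => ?_⟩
  rw [show deriv y = y₁ from funext fun x => (g1 x).deriv, (g2 x).deriv]
  ring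

/-- Square integrable solutions of `y'' = q y` are multiples of the zero mode. -/
theorem eq_mul_zero_mode {y y₁ : ℝ → ℝ} (g1 : ∀ x, HasDerivAt y (y₁ x) x)
    (g2 : ∀ x, HasDerivAt y₁ (P.q x * y x) x) (hi : Integrable fun x => y x ^ 2) :
    ∃ k : ℝ, ∀ x, y x = k * P.ψ x := by
  have cy : Continuous y := continuous_iff_continuousAt.2 fun x => (g1 x).continuousAt
  have hY1 := bounded_of_integrable_sq (X := P.X) P.κ_pos.le
    (fun x hx => P.q_far x (hx.trans (le_abs_self x))) g1 g2 hi
  have hY2 := bounded_of_integrable_sq (X := P.X) (q := fun x => P.q (-x)) (y := fun x => y (-x))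
    (y₁ := fun x => -y₁ (-x)) P.κ_pos.le
    (fun x hx => P.q_far (-x) (by rw [abs_neg]; exact hx.trans (le_abs_self x)))
    (fun x => hasDerivAt_comp_neg_arg (g1 (-x)))
    (fun x => (hasDerivAt_comp_neg_arg (g2 (-x))).fun_neg.congr_deriv (neg_neg _)) hi.comp_neg
  have hY : ∃ Y, ∀ x, |y x| ≤ Y := by
    obtain ⟨Y0, hY0⟩ := (isCompact_Icc (a := -P.X) (b := P.X)).exists_bound_of_continuousOn
      cy.continuousOn
    refine ⟨max Y0 (max |y P.X| |y (-P.X)|), fun x => ?_⟩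
    rcases le_total P.X x with h | h
    · exact (hY1 x h).trans ((le_max_left _ _).trans (le_max_right _ _))
    · rcases le_total x (-P.X) with h' | h'
      · have := hY2 (-x) (by linarith)
        rw [neg_neg] at this
        exact this.trans ((le_max_right _ _).trans (le_max_right _ _))
      · exact (hY0 x ⟨h', h⟩).trans (le_max_left _ _)
  have hzero : Dec (expW P.b) fun _ => (0 : ℝ) := by
    have := P.dec_ψ.const_mul 0
    simpa using this
  have hdec : Dec (expW P.b) y := P.dec_of_bounded (F := fun _ => 0) g1
    (fun x => (g2 x).congr_deriv (by ring)) hzero hY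
  have e1 : deriv y = y₁ := funext fun x => (g1 x).deriv
  have const_of : ∀ {f : ℝ → ℝ}, (∀ x, HasDerivAt f 0 x) → ∀ x, f x = f 0 := fun h x =>
    is_const_of_deriv_eq_zero (fun x => (h x).differentiableAt) (fun x => (h x).deriv) x 0
  -- The Wronskian of two solutions is constant, and it vanishes at infinity because both decay. The
  -- factor k below is the Wronskian of y with the second solution.
  have hW0 : ∀ x, P.ψ x * y₁ x - deriv P.ψ x * y x = 0 := by
    have hc := const_of (f := fun x => P.ψ x * y₁ x - deriv P.ψ x * y x) fun x => by
      refine (((P.ψ_hasDerivAt x).mul (g2 x)).sub ((P.dψ_hasDerivAt x).mul (g1 x))).congr_deriv ?_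
      ring
    have ht : Tendsto (fun x => P.ψ x * y₁ x - deriv P.ψ x * y x) atTop (𝓝 0) := by
      have a1 := (tendsto_zero_of_dec P.b_pos P.dec_ψ).1
      have a2 := (tendsto_zero_of_dec P.b_pos P.dec_ψ.deriv).1
      have a3 := (tendsto_zero_of_dec P.b_pos hdec).1
      have a4 := (tendsto_zero_of_dec P.b_pos hdec.deriv).1
      rw [e1] at a4
      simpa using (a1.mul a4).sub (a2.mul a3)
    have ht' := ht.congr hc
    have := tendsto_nhds_unique ht' tendsto_const_nhds
    intro x
    rw [hc x, ← this]
  obtain ⟨v, v₁, a1, a2, hW, -⟩ := exists_second_solution P.dec_q.contDiff.continuous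
    P.ψ_hasDerivAt P.dψ_hasDerivAt P.ψ_ne
  have hc := const_of (f := fun x => y x * v₁ x - y₁ x * v x) fun x => by
    refine (((g1 x).mul (a2 x)).sub ((g2 x).mul (a1 x))).congr_deriv ?_
    ring
  refine ⟨y 0 * v₁ 0 - y₁ 0 * v 0, fun x => ?_⟩
  rw [← hc x]
  linear_combination (-y x) * hW x + v x * hW0 x

end Coeffs

/-! ### Explicit bounds for derivatives of products -/

/-- The derivatives of `f` of order at most `k` are bounded by `C w`. -/
def BddN (w : ℝ → ℝ) (C : ℝ) : ℕ → (ℝ → ℝ) → Prop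
  | 0, f => ∀ x, |f x| ≤ C * w x
  | k + 1, f => (∀ x, |f x| ≤ C * w x) ∧ BddN w C k (deriv f)

namespace BddN

variable {w f g : ℝ → ℝ} {C D : ℝ} {k : ℕ}

theorem pred (h : BddN w C (k + 1) f) : BddN w C k f := by
  induction k generalizing f with
  | zero => exact h.1
  | succ k ih => exact ⟨h.1, ih h.2⟩

theorem mono (hw : ∀ x, 0 ≤ w x) (hCD : C ≤ D) (h : BddN w C k f) : BddN w D k f := by
  have hle : ∀ x, C * w x ≤ D * w x := fun x => mul_le_mul_of_nonneg_right hCD (hw x)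
  induction k generalizing f with
  | zero => exact fun x => (h x).trans (hle x)
  | succ k ih => exact ⟨fun x => (h.1 x).trans (hle x), ih h.2⟩

theorem add (hf : ContDiff ℝ ∞ f) (hg : ContDiff ℝ ∞ g) (h : BddN w C k f) (h' : BddN w D k g) :
    BddN w (C + D) k (fun x => f x + g x) := by
  have h0 : ∀ {f g : ℝ → ℝ}, (∀ x, |f x| ≤ C * w x) → (∀ x, |g x| ≤ D * w x) →
      ∀ x, |f x + g x| ≤ (C + D) * w x := fun h h' x =>
    (abs_add_le _ _).trans (by linarith [h x, h' x])
  induction k generalizing f g with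
  | zero => exact h0 h h'
  | succ k ih =>
    refine ⟨h0 h.1 h'.1, ?_⟩
    have : deriv (fun x => f x + g x) = fun x => deriv f x + deriv g x := by
      ext x
      exact ((hasDerivAt_of_smooth hf x).add (hasDerivAt_of_smooth hg x)).deriv
    rw [this]
    exact ih (contDiff_infty_deriv hf) (contDiff_infty_deriv hg) h.2 h'.2

theorem mul (hf : ContDiff ℝ ∞ f) (hg : ContDiff ℝ ∞ g) (hw : ∀ x, 0 ≤ w x) (hD : 0 ≤ C * D)
    (h : BddN wOne C k f) (h' : BddN w D k g) :
    BddN w (2 ^ k * (C * D)) k (fun x => f x * g x) := by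
  have h0 : ∀ {f g : ℝ → ℝ}, (∀ x, |f x| ≤ C * wOne x) → (∀ x, |g x| ≤ D * w x) →
      ∀ x, |f x * g x| ≤ (C * D) * w x := fun h h' x => by
    rw [abs_mul]
    refine (mul_le_mul (h x) (h' x) (abs_nonneg _) ((abs_nonneg _).trans (h x))).trans (le_of_eq ?_)
    simp only [wOne]; ring
  induction k generalizing f g with
  | zero => rw [pow_zero, one_mul]; exact h0 h h'
  | succ k ih =>
    have h2 : (1 : ℝ) ≤ 2 ^ (k + 1) := one_le_pow₀ (by norm_num)
    refine ⟨fun x => (h0 h.1 h'.1 x).trans (mul_le_mul_of_nonneg_right ?_ (hw x)), ?_⟩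
    · nlinarith
    · have : deriv (fun x => f x * g x) = fun x => deriv f x * g x + f x * deriv g x := by
        ext x
        exact ((hasDerivAt_of_smooth hf x).mul (hasDerivAt_of_smooth hg x)).deriv
      rw [this]
      have := (ih (contDiff_infty_deriv hf) hg h.2 h'.pred).add
        ((contDiff_infty_deriv hf).mul hg) (hf.mul (contDiff_infty_deriv hg))
        (ih hf (contDiff_infty_deriv hg) h.pred h'.2)
      refine this.mono hw (le_of_eq ?_)
      ring

/-- Each derivative of a stretched cutoff only brings out a factor t ≤ 1. The prefactor s collects
these factors in the induction, so the bounds are uniform in t. -/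
theorem const_mul_comp_mul_left {s t : ℝ} (hs : |s| ≤ 1) (ht0 : 0 ≤ t) (ht1 : t ≤ 1)
    (h : BddN wOne C k f) : BddN wOne C k (fun x => s * f (t * x)) := by
  have h0 : ∀ {f : ℝ → ℝ} {s : ℝ}, |s| ≤ 1 → (∀ x, |f x| ≤ C * wOne x) →
      ∀ x, |s * f (t * x)| ≤ C * wOne x := fun hs h x => by
    rw [abs_mul]
    exact (mul_le_of_le_one_left (abs_nonneg _) hs).trans (h (t * x))
  induction k generalizing f s with
  | zero => exact h0 hs h
  | succ k ih =>
    refine ⟨h0 hs h.1, ?_⟩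
    have : deriv (fun x => s * f (t * x)) = fun x => (s * t) * deriv f (t * x) := by
      ext x
      rw [deriv_const_mul_field, deriv_comp_mul_left, smul_eq_mul, mul_assoc]
    rw [this]
    refine ih ?_ h.2
    rw [abs_mul, abs_of_nonneg ht0]
    exact mul_le_one₀ hs ht0 ht1

theorem comp_mul_left {t : ℝ} (ht0 : 0 ≤ t) (ht1 : t ≤ 1) (h : BddN wOne C k f) :
    BddN wOne C k (fun x => f (t * x)) := by
  simpa using const_mul_comp_mul_left (s := 1) (by simp) ht0 ht1 h

end BddN

theorem DecN.exists_bddN {w f : ℝ → ℝ} {k : ℕ} (hw : ∀ x, 0 ≤ w x) (h : DecN w k f) :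
    ∃ C, 0 ≤ C ∧ BddN w C k f := by
  induction k generalizing f with
  | zero => exact exists_nonneg_bound hw h.2
  | succ k ih =>
    obtain ⟨C, hC0, hC⟩ := exists_nonneg_bound hw h.1.2
    obtain ⟨D, hD0, hD⟩ := ih h.2
    refine ⟨C + D, by positivity, fun x => (hC x).trans ?_, hD.mono hw (by linarith)⟩
    exact mul_le_mul_of_nonneg_right (by linarith) (hw x)

/-! ### Square integrable functions with exponential weights -/

theorem integrable_smul_L2 {F : ℝ → ℝ} (hF : MemLp F 2) (u : L2C) :
    Integrable fun x => F x • u x := by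
  rw [← memLp_one_iff_integrable]
  exact (Lp.memLp u).smul hF

theorem locallyIntegrable_smul_L2 {F : ℝ → ℝ} (hF : Continuous F) (u : L2C) :
    LocallyIntegrable fun x => F x • u x := by
  rw [locallyIntegrable_iff]
  intro K hK
  have hu : LocallyIntegrable u volume := (Lp.memLp u).locallyIntegrable (by norm_num)
  exact (hu.integrableOn_isCompact hK).continuousOn_smul hF.continuousOn hK

theorem exists_represents {f : ℝ → ℝ} {a : ℝ} (h : MemLp (fun x => Real.exp (a * x) * f x) 2) :
    ∃ u : L2C, Represents u a f := by
  have h' : MemLp (fun x => ((Real.exp (a * x) * f x : ℝ) : ℂ)) 2 := h.ofReal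
  exact ⟨h'.toLp, h'.coeFn_toLp⟩

theorem memLp_exp_mul {f : ℝ → ℝ} {a b : ℝ} (hab : |a| < b) (hf : Dec (expW b) f) :
    MemLp (fun x => Real.exp (a * x) * f x) 2 := by
  obtain ⟨C, hC0, hC⟩ := exists_nonneg_bound (fun x => (expW_pos b x).le) hf.bound
  have hc := hf.contDiff.continuous
  refine memLp_of_le_expW (b := b - |a|) (C := C) (by fun_prop) (by linarith) fun x => ?_
  rw [abs_mul, abs_of_pos (Real.exp_pos _)]
  calc Real.exp (a * x) * |f x| ≤ Real.exp (a * x) * (C * expW b x) :=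
        mul_le_mul_of_nonneg_left (hC x) (Real.exp_pos _).le
    _ = C * (Real.exp (a * x) * expW b x) := by ring
    _ ≤ _ := mul_le_mul_of_nonneg_left (exp_mul_expW_le x) hC0

theorem memLp_mul_exp_left {f : ℝ → ℝ} {a b : ℝ} (ha : 0 < a) (hab : a < b) (hc : Continuous f)
    (hf : ∃ C, ∀ x, |f x| ≤ C * leftW b x) : MemLp (fun x => f x * Real.exp (-(a * x))) 2 := by
  obtain ⟨C, hC0, hC⟩ := exists_nonneg_bound (leftW_nonneg b) hf
  refine memLp_of_le_expW (b := min a (b - a)) (C := C) (by fun_prop)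
    (lt_min ha (by linarith)) fun x => ?_
  rw [abs_mul, abs_of_pos (Real.exp_pos _)]
  calc |f x| * Real.exp (-(a * x)) ≤ C * leftW b x * Real.exp (-(a * x)) :=
        mul_le_mul_of_nonneg_right (hC x) (Real.exp_pos _).le
    _ = C * (Real.exp (-(a * x)) * leftW b x) := by ring
    _ ≤ _ := mul_le_mul_of_nonneg_left (exp_mul_leftW_le x) hC0

theorem continuous_leftW (b : ℝ) : Continuous (leftW b) := by
  unfold leftW; fun_prop

theorem dec_leftW_of_expW {b : ℝ} (hb : 0 ≤ b) {f : ℝ → ℝ} (h : Dec (expW b) f) :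
    Dec (leftW b) f :=
  h.mono (K := 1) (fun x => (expW_pos b x).le) fun x => by rw [one_mul]; exact expW_le_leftW hb x

/-! ### The distributional relation and its admissible test functions -/

namespace Coeffs

variable (P : Coeffs)

theorem M_eq {χ : ℝ → ℝ} (h : ContDiff ℝ ∞ χ) (x : ℝ) :
    P.M χ x = χ x - P.σ x * (deriv P.r x * deriv χ x + P.r x * deriv (deriv χ) x) := by
  rw [M, ((hasDerivAt_of_smooth P.dec_r.contDiff x).fun_mul
    (hasDerivAt_of_smooth (contDiff_infty_deriv h) x)).deriv]

theorem L_eq {θ : ℝ → ℝ} (h : ContDiff ℝ ∞ θ) (x : ℝ) :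
    P.L θ x = -P.c * P.σ x * (deriv (deriv P.r) x * θ x + 2 * (deriv P.r x * deriv θ x) +
      P.r x * deriv (deriv θ) x) + P.c * P.σ x * P.q x * P.r x * θ x := by
  have hr := P.dec_r.contDiff
  have e1 : deriv (fun y => P.r y * θ y) = fun y => deriv P.r y * θ y + P.r y * deriv θ y := by
    ext y
    exact ((hasDerivAt_of_smooth hr y).fun_mul (hasDerivAt_of_smooth h y)).deriv
  rw [L, e1, (((hasDerivAt_of_smooth (contDiff_infty_deriv hr) x).fun_mul
    (hasDerivAt_of_smooth h x)).fun_add ((hasDerivAt_of_smooth hr x).fun_mul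
    (hasDerivAt_of_smooth (contDiff_infty_deriv h) x))).deriv]
  ring

theorem dec_M {w χ : ℝ → ℝ} (h : Dec w χ) : Dec w (P.M χ) := by
  rw [show P.M χ = fun x => _ from funext (P.M_eq h.contDiff)]
  exact h.sub (P.dec_σ.one_mul ((P.dec_r.deriv.one_mul h.deriv).add (P.dec_r.one_mul h.deriv.deriv)))

theorem dec_L {w θ : ℝ → ℝ} (h : Dec w θ) : Dec w (P.L θ) := by
  rw [show P.L θ = fun x => _ from funext (P.L_eq h.contDiff)]
  exact ((P.dec_σ.const_mul (-P.c)).one_mul (((P.dec_r.deriv.deriv.one_mul h).add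
    ((P.dec_r.deriv.one_mul h.deriv).const_mul 2)).add (P.dec_r.one_mul h.deriv.deriv))).add
    (((((P.dec_σ.const_mul P.c).one_mul P.dec_q).one_mul P.dec_r)).one_mul h)

/-- K is chosen before w, χ and C, as dominated convergence along a sequence of truncations
requires. -/
theorem exists_bound_M : ∃ K, 0 ≤ K ∧ ∀ (w χ : ℝ → ℝ) (C : ℝ), ContDiff ℝ ∞ χ → BddN w C 2 χ →
    ∀ x, |P.M χ x| ≤ K * (C * w x) := by
  obtain ⟨S, hS0, hS⟩ := exists_nonneg_bound (w := wOne) (fun x => zero_le_one) P.dec_σ.bound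
  obtain ⟨R, hR0, hR⟩ := exists_nonneg_bound (w := wOne) (fun x => zero_le_one) P.dec_r.bound
  obtain ⟨R', hR0', hR'⟩ := exists_nonneg_bound (w := wOne) (fun x => zero_le_one)
    P.dec_r.deriv.bound
  simp only [wOne, mul_one] at hS hR hR'
  refine ⟨1 + S * (R' + R), by positivity, fun w χ C hχ hb x => ?_⟩
  have hb0 := hb.1 x
  have hb1 := hb.2.1 x
  have hb2 : |deriv (deriv χ) x| ≤ C * w x := hb.2.2 x
  have hCw : 0 ≤ C * w x := (abs_nonneg _).trans hb0
  rw [P.M_eq hχ]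
  have e1 : |deriv P.r x * deriv χ x| ≤ R' * (C * w x) := by
    rw [abs_mul]; exact mul_le_mul (hR' x) hb1 (abs_nonneg _) hR0'
  have e2 : |P.r x * deriv (deriv χ) x| ≤ R * (C * w x) := by
    rw [abs_mul]; exact mul_le_mul (hR x) hb2 (abs_nonneg _) hR0
  have e3 : |P.σ x * (deriv P.r x * deriv χ x + P.r x * deriv (deriv χ) x)| ≤
      S * (R' * (C * w x) + R * (C * w x)) := by
    rw [abs_mul]
    exact mul_le_mul (hS x) ((abs_add_le _ _).trans (add_le_add e1 e2)) (abs_nonneg _) hS0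
  refine (abs_sub _ _).trans ?_
  linarith

theorem exists_bound_L : ∃ K, 0 ≤ K ∧ ∀ (w θ : ℝ → ℝ) (C : ℝ), ContDiff ℝ ∞ θ → BddN w C 2 θ →
    ∀ x, |P.L θ x| ≤ K * (C * w x) := by
  have d1 := (P.dec_σ.const_mul (-P.c)).one_mul P.dec_r.deriv.deriv
  have d2 := ((P.dec_σ.const_mul (-P.c)).one_mul P.dec_r.deriv).const_mul 2
  have d3 := (P.dec_σ.const_mul (-P.c)).one_mul P.dec_r
  have d4 := ((P.dec_σ.const_mul P.c).one_mul P.dec_q).one_mul P.dec_r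
  obtain ⟨A, hA0, hA⟩ := exists_nonneg_bound (w := wOne) (fun x => zero_le_one) d1.bound
  obtain ⟨B, hB0, hB⟩ := exists_nonneg_bound (w := wOne) (fun x => zero_le_one) d2.bound
  obtain ⟨D, hD0, hD⟩ := exists_nonneg_bound (w := wOne) (fun x => zero_le_one) d3.bound
  obtain ⟨E, hE0, hE⟩ := exists_nonneg_bound (w := wOne) (fun x => zero_le_one) d4.bound
  simp only [wOne, mul_one] at hA hB hD hE
  refine ⟨A + B + D + E, by positivity, fun w θ C hθ hb x => ?_⟩
  have hb0 := hb.1 x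
  have hb1 := hb.2.1 x
  have hb2 : |deriv (deriv θ) x| ≤ C * w x := hb.2.2 x
  have hm : ∀ {p y K : ℝ}, |p| ≤ K → 0 ≤ K → |y| ≤ C * w x → |p * y| ≤ K * (C * w x) := by
    intro p y K h1 h2 h3
    rw [abs_mul]; exact mul_le_mul h1 h3 (abs_nonneg _) h2
  have e1 := hm (hA x) hA0 hb0
  have e2 := hm (hB x) hB0 hb1
  have e3 := hm (hD x) hD0 hb2
  have e4 := hm (hE x) hE0 hb0
  rw [P.L_eq hθ]
  have := (abs_add_le _ _).trans (add_le_add ((abs_add_le _ _).trans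
    (add_le_add ((abs_add_le _ _).trans (add_le_add e1 e2)) e3)) e4)
  refine le_trans (le_of_eq ?_) (this.trans (le_of_eq ?_))
  · congr 1; ring
  · ring

/-- The relation `M (e^{-ax} f) = ∂ L (e^{-ax} w)` in the sense of distributions. -/
def Rel (a : ℝ) (w f : L2C) : Prop := ∀ χ : ℝ → ℝ, ContDiff ℝ ∞ χ → HasCompactSupport χ →
  ∫ x, (P.M χ x * Real.exp (-(a * x))) • f x =
    -∫ x, (P.L (deriv χ) x * Real.exp (-(a * x))) • w x

theorem integrable_of_test (a : ℝ) {F : ℝ → ℝ} (hF : Dec (expW (|a| + 1)) F) (u : L2C) :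
    Integrable fun x => (F x * Real.exp (-(a * x))) • u x := by
  refine integrable_smul_L2 ?_ u
  have := memLp_exp_mul (a := -a) (b := |a| + 1) (by rw [abs_neg]; linarith) hF
  simpa [mul_comm] using this

/-- The distributional relation extends to test functions that need not have compact support. -/
theorem Rel.extend {P : Coeffs} {a : ℝ} {w f : L2C} (h : P.Rel a w f) (ha : 0 < a) (hab : a < P.b)
    {χ : ℝ → ℝ} (hχ : Dec (leftW P.b) χ) :
    ∫ x, (P.M χ x * Real.exp (-(a * x))) • f x =
      -∫ x, (P.L (deriv χ) x * Real.exp (-(a * x))) • w x := by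
  have hχs := hχ.contDiff
  -- The truncations are ζ(x/(N+1)) χ(x). Near any fixed point they eventually coincide with χ, so
  -- all the derivatives involved converge pointwise.
  let ζ : ContDiffBump (0 : ℝ) := ⟨1, 2, one_pos, one_lt_two⟩
  have hζs : ContDiff ℝ ∞ ζ := ζ.contDiff
  obtain ⟨D, hD0, hD⟩ := (dec_of_hasCompactSupport (w := wOne) continuous_const
    (fun x => zero_lt_one) hζs ζ.hasCompactSupport 3).exists_bddN (fun x => zero_le_one)
  obtain ⟨C, hC0, hC⟩ := (hχ 3).exists_bddN (leftW_nonneg P.b)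
  set t : ℕ → ℝ := fun N => 1 / ((N : ℝ) + 1) with ht
  have ht0 : ∀ N, 0 < t N := fun N => by positivity
  have ht1 : ∀ N, t N ≤ 1 := fun N => by
    rw [ht]; simp only; rw [div_le_one (by positivity)]; linarith [(Nat.cast_nonneg N : (0 : ℝ) ≤ N)]
  set Z : ℕ → ℝ → ℝ := fun N x => ζ (t N * x) with hZ
  have hZs : ∀ N, ContDiff ℝ ∞ (Z N) := fun N => hζs.comp (contDiff_const.mul contDiff_id)
  have hZc : ∀ N, HasCompactSupport (Z N) := fun N => by
    refine hasCompactSupport_of_bound (R := 2 / t N) fun x hx => ζ.zero_of_le_dist ?_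
    rw [dist_zero_right, Real.norm_eq_abs, abs_mul, abs_of_pos (ht0 N)]
    rw [div_lt_iff₀ (ht0 N)] at hx
    change (2 : ℝ) ≤ _
    linarith
  set χN : ℕ → ℝ → ℝ := fun N x => Z N x * χ x with hχN
  have hs : ∀ N, ContDiff ℝ ∞ (χN N) := fun N => (hZs N).mul hχs
  have hc : ∀ N, HasCompactSupport (χN N) := fun N => (hZc N).mul_right
  -- Three derivatives are controlled because the second order operator L⋆ is applied to χ'.
  have hb : ∀ N, BddN (leftW P.b) (2 ^ 3 * (D * C)) 3 (χN N) := fun N =>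
    BddN.mul (hZs N) hχs (leftW_nonneg P.b) (by positivity)
      (hD.comp_mul_left (ht0 N).le (ht1 N)) hC
  set E := 2 ^ 3 * (D * C) with hE
  have hE0 : 0 ≤ E := by positivity
  have hev : ∀ x, ∀ᶠ N in atTop, χN N =ᶠ[𝓝 x] χ := by
    intro x
    obtain ⟨N₀, hN₀⟩ := exists_nat_gt (|x| + 1)
    filter_upwards [eventually_ge_atTop N₀] with N hN
    have hx1 : ∀ᶠ y in 𝓝 x, |y| < |x| + 1 :=
      continuous_abs.continuousAt.eventually_lt continuousAt_const (by simp)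
    filter_upwards [hx1] with y hy
    have : Z N y = 1 := by
      refine ζ.one_of_mem_closedBall ?_
      rw [Metric.mem_closedBall, dist_zero_right, Real.norm_eq_abs, abs_mul, abs_of_pos (ht0 N)]
      change _ ≤ (1 : ℝ)
      rw [ht]; simp only
      rw [div_mul_eq_mul_div, one_mul, div_le_one (by positivity)]
      have : (N₀ : ℝ) ≤ N := by exact_mod_cast hN
      linarith
    simp [hχN, this]
  have hlim : ∀ (T : (ℝ → ℝ) → ℝ → ℝ) (u : L2C) (K : ℝ), 0 ≤ K →
      (∀ N, Continuous (T (χN N))) → (∀ N x, |T (χN N) x| ≤ K * (E * leftW P.b x)) →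
      (∀ x, ∀ᶠ N in atTop, T (χN N) x = T χ x) →
      Tendsto (fun N => ∫ x, (T (χN N) x * Real.exp (-(a * x))) • u x) atTop
        (𝓝 (∫ x, (T χ x * Real.exp (-(a * x))) • u x)) := by
    intro T u K hK0 hTc hTb hTe
    -- The condition 0 < a < b is used here: it makes the majorant square integrable, hence
    -- integrable against `u`.
    have hG : MemLp (fun x => (K * (E * leftW P.b x)) * Real.exp (-(a * x))) 2 :=
      memLp_mul_exp_left ha hab ((continuous_leftW P.b).const_mul _ |>.const_mul _)
        ⟨K * E, fun x => by
          rw [abs_of_nonneg (mul_nonneg hK0 (mul_nonneg hE0 (leftW_nonneg _ _)))]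
          exact le_of_eq (by ring)⟩
    refine tendsto_integral_of_dominated_convergence
      (fun x => ‖((K * (E * leftW P.b x)) * Real.exp (-(a * x))) • u x‖)
      (fun N => ?_) (integrable_smul_L2 hG u).norm (fun N => Eventually.of_forall fun x => ?_)
      (Eventually.of_forall fun x => ?_)
    · have hcN := hTc N
      have hE : Continuous fun x => T (χN N) x * Real.exp (-(a * x)) := hcN.mul (by fun_prop)
      exact hE.aestronglyMeasurable.smul (Lp.aestronglyMeasurable u)
    · rw [norm_smul, norm_smul]
      refine mul_le_mul_of_nonneg_right ?_ (norm_nonneg _)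
      rw [Real.norm_eq_abs, Real.norm_eq_abs, abs_mul, abs_mul]
      refine mul_le_mul_of_nonneg_right ((hTb N x).trans (le_abs_self _)) (abs_nonneg _)
    · refine tendsto_const_nhds.congr' ?_
      filter_upwards [hTe x] with N hN
      rw [hN]
  obtain ⟨K₁, hK₁, hM⟩ := P.exists_bound_M
  obtain ⟨K₂, hK₂, hL⟩ := P.exists_bound_L
  have hd1 : ∀ N, Dec (leftW P.b) (χN N) := fun N => by
    have hz := dec_of_hasCompactSupport (w := wOne) continuous_const (fun x => zero_lt_one)
      (hZs N) (hZc N)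
    exact hz.one_mul hχ
  have lim1 := hlim P.M f K₁ hK₁ (fun N => (P.dec_M (hd1 N)).contDiff.continuous)
    (fun N x => hM _ _ _ (hs N) (hb N).pred x) (fun x => by
      filter_upwards [hev x] with N hN
      have hd : deriv (fun y => P.r y * deriv (χN N) y) x = deriv (fun y => P.r y * deriv χ y) x := by
        refine EventuallyEq.deriv_eq ?_
        filter_upwards [hN.deriv] with y hy
        rw [hy]
      rw [M, M, hN.eq_of_nhds, hd])
  have lim2 := hlim (fun χ => P.L (deriv χ)) w K₂ hK₂
    (fun N => (P.dec_L (hd1 N).deriv).contDiff.continuous)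
    (fun N x => hL _ _ _ (contDiff_infty_deriv (hs N)) (hb N).2 x) (fun x => by
      filter_upwards [hev x] with N hN
      have hd : deriv (fun y => P.r y * deriv (χN N) y) =ᶠ[𝓝 x]
          deriv (fun y => P.r y * deriv χ y) := by
        refine EventuallyEq.deriv ?_
        filter_upwards [hN.deriv] with y hy
        rw [hy]
      simp only [L]
      rw [hN.deriv.eq_of_nhds, hd.deriv_eq])
  refine tendsto_nhds_unique lim1 ?_
  simp only [fun N => h (χN N) (hs N) (hc N)]
  exact lim2.neg

/-- Integration by parts: classical solutions satisfy the distributional relation. -/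
theorem integral_M_mul_eq {v k χ : ℝ → ℝ} (hv : ContDiff ℝ ∞ v) (hk : ContDiff ℝ ∞ k)
    (hχ : ContDiff ℝ ∞ χ) (hc : HasCompactSupport χ)
    (hrel : ∀ x, P.σi x * k x - deriv (fun y => P.r y * deriv k y) x =
      deriv (fun y => P.c * P.r y * (-deriv (deriv v) y + P.q y * v y)) x) :
    ∫ x, P.M χ x * (P.σi x * k x) = -∫ x, P.L (deriv χ) x * (P.σi x * v x) := by
  have hr := P.dec_r.contDiff
  have hq := P.dec_q.contDiff
  have hχ' := contDiff_infty_deriv hχ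
  have hv' := contDiff_infty_deriv hv
  have hv'' := contDiff_infty_deriv hv'
  have hk' := contDiff_infty_deriv hk
  set τ : ℝ → ℝ := fun y => P.r y * deriv χ y with hτ
  set j : ℝ → ℝ := fun y => P.r y * deriv k y with hj
  set ℓ : ℝ → ℝ := fun y => P.c * P.r y * (-deriv (deriv v) y + P.q y * v y) with hℓ
  have sτ : ContDiff ℝ ∞ τ := hr.mul hχ'
  have sτ' := contDiff_infty_deriv sτ
  have sj : ContDiff ℝ ∞ j := hr.mul hk'
  have sℓ : ContDiff ℝ ∞ ℓ := (contDiff_const.mul hr).mul (hv''.neg.add (hq.mul hv))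
  have cτ : HasCompactSupport τ := hc.deriv.mul_left
  -- J collects the boundary terms of all the integrations by parts; its derivative is the sum of
  -- the two integrands.
  set J : ℝ → ℝ := fun x => χ x * j x - τ x * k x + χ x * ℓ x +
    P.c * (τ x * deriv v x - deriv τ x * v x) with hJ
  have sJ : ContDiff ℝ ∞ J := (((hχ.mul sj).sub (sτ.mul hk)).add (hχ.mul sℓ)).add
    (contDiff_const.mul ((sτ.mul hv').sub (sτ'.mul hv)))
  have cJ : HasCompactSupport J :=
    ((hc.mul_right.sub cτ.mul_right).add hc.mul_right).add
      ((cτ.mul_right.sub cτ.deriv.mul_right).mul_left)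
  have dJ : ∀ x, deriv J x = P.M χ x * (P.σi x * k x) + P.L (deriv χ) x * (P.σi x * v x) := by
    intro x
    have d := hasDerivAt_of_smooth hχ x
    have e := ((((d.mul (hasDerivAt_of_smooth sj x)).sub
      ((hasDerivAt_of_smooth sτ x).mul (hasDerivAt_of_smooth hk x))).add
      (d.mul (hasDerivAt_of_smooth sℓ x))).add
      ((((hasDerivAt_of_smooth sτ x).mul (hasDerivAt_of_smooth hv' x)).sub
        ((hasDerivAt_of_smooth sτ' x).mul (hasDerivAt_of_smooth hv x))).const_mul P.c))
    refine e.deriv.trans ?_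
    have h1 := hrel x
    have h2 := P.σi_mul x
    rw [M, L, ← h1]
    change _ = (χ x - P.σ x * deriv τ x) * (P.σi x * k x) +
      (-P.c * P.σ x * deriv (deriv τ) x + P.c * P.σ x * P.q x * P.r x * deriv χ x) *
        (P.σi x * v x)
    simp only [hτ, hj, hℓ]
    linear_combination (deriv τ x * k x + P.c * deriv (deriv τ) x * v x -
      P.c * P.q x * P.r x * deriv χ x * v x) * h2
  have h0 := integral_deriv_eq_zero sJ cJ
  simp only [dJ] at h0
  have dχ := dec_of_hasCompactSupport (continuous_expW 1) (expW_pos 1) hχ hc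
  have i1 : Integrable fun x => P.M χ x * (P.σi x * k x) := by
    refine ((P.dec_M dχ).contDiff.continuous.mul
      (P.dec_σi.contDiff.continuous.mul hk.continuous)).integrable_of_hasCompactSupport ?_
    refine HasCompactSupport.mul_right ?_
    exact hc.sub cτ.deriv.mul_left
  have i2 : Integrable fun x => P.L (deriv χ) x * (P.σi x * v x) := by
    refine ((P.dec_L dχ.deriv).contDiff.continuous.mul
      (P.dec_σi.contDiff.continuous.mul hv.continuous)).integrable_of_hasCompactSupport ?_
    refine HasCompactSupport.mul_right ?_
    exact cτ.deriv.deriv.mul_left.add hc.deriv.mul_left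
  rw [integral_add i1 i2] at h0
  linarith

theorem integral_smul_represents {F f : ℝ → ℝ} {a : ℝ} {u : L2C} (h : Represents u a f) :
    ∫ x, (F x * Real.exp (-(a * x))) • u x = ((∫ x, F x * f x : ℝ) : ℂ) := by
  rw [← integral_complex_ofReal]
  refine integral_congr_ae ?_
  filter_upwards [h] with x hx
  rw [hx, Complex.real_smul, ← Complex.ofReal_mul]
  congr 1
  have : Real.exp (-(a * x)) * Real.exp (a * x) = 1 := by rw [← Real.exp_add]; simp
  linear_combination F x * f x * this

theorem rel_of_classical {v k : ℝ → ℝ} (hv : ContDiff ℝ ∞ v) (hk : ContDiff ℝ ∞ k)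
    (hrel : ∀ x, P.σi x * k x - deriv (fun y => P.r y * deriv k y) x =
      deriv (fun y => P.c * P.r y * (-deriv (deriv v) y + P.q y * v y)) x) {a : ℝ} {w f : L2C}
    (hw : Represents w a fun x => P.σi x * v x) (hf : Represents f a fun x => P.σi x * k x) :
    P.Rel a w f := by
  intro χ hχ hc
  rw [integral_smul_represents hf, integral_smul_represents hw,
    P.integral_M_mul_eq hv hk hχ hc hrel]
  push_cast
  rfl

end Coeffs

/-! ### Kernel, domain and range of the distributional relation -/

theorem inner_represents {w y : L2C} {a : ℝ} {F : ℝ → ℝ} (h : Represents w a F) :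
    inner ℂ w y = ∫ x, (F x * Real.exp (a * x)) • y x := by
  rw [L2.inner_def]
  refine integral_congr_ae ?_
  filter_upwards [h] with x hx
  rw [hx, RCLike.inner_apply, Complex.conj_ofReal, Complex.real_smul, mul_comm,
    mul_comm (Real.exp _)]

theorem integral_smul_zero_L2 (F : ℝ → ℝ) : ∫ x, F x • (0 : L2C) x = 0 := by
  have : (fun x => F x • (0 : L2C) x) =ᵐ[volume] fun _ => (0 : ℂ) := by
    filter_upwards [Lp.coeFn_zero ℂ 2 (volume : Measure ℝ)] with x hx
    rw [hx]; simp
  rw [integral_congr_ae this, integral_zero]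

/-- An element of `L²` is determined by its pairings with test functions. -/
theorem eq_zero_of_test {u : L2C} {F : ℝ → ℝ} (hF : Continuous F) (hF0 : ∀ x, F x ≠ 0)
    (h : ∀ ρ : ℝ → ℝ, ContDiff ℝ ∞ ρ → HasCompactSupport ρ → ∫ x, (ρ x * F x) • u x = 0) :
    u = 0 := by
  have h0 := ae_eq_zero_of_integral_contDiff_smul_eq_zero (locallyIntegrable_smul_L2 hF u)
    fun ρ hs hc => by simpa only [smul_smul] using h ρ hs hc
  refine (Lp.eq_zero_iff_ae_eq_zero).2 ?_
  filter_upwards [h0] with x hx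
  simpa [hF0 x] using hx

/-- On the negative half-line the function is at least |κ| in modulus. This removes the constant of
integration in `exists_eq_of_orthogonal_range`. -/
theorem eq_zero_of_memLp_exp {a : ℝ} (ha : 0 < a) {κ : ℂ}
    (h : MemLp (fun x : ℝ => κ * (Real.exp (-(a * x)) : ℂ)) 2) : κ = 0 := by
  have h2 := (memLp_two_iff_integrable_sq_norm h.1).1 h
  have h3 : IntegrableOn (fun _ : ℝ => ‖κ‖ ^ 2) (Set.Iic 0) := by
    refine Integrable.mono' h2.integrableOn aestronglyMeasurable_const ?_
    refine (ae_restrict_iff' measurableSet_Iic).2 (Eventually.of_forall fun x hx => ?_)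
    rw [norm_mul, Complex.norm_real, Real.norm_of_nonneg (by positivity : 0 ≤ ‖κ‖ ^ 2),
      Real.norm_of_nonneg (Real.exp_pos _).le]
    have : 1 ≤ Real.exp (-(a * x)) := Real.one_le_exp (by
      have := mul_nonpos_of_nonneg_of_nonpos ha.le (Set.mem_Iic.1 hx)
      linarith)
    exact pow_le_pow_left₀ (norm_nonneg _) (le_mul_of_one_le_right (norm_nonneg _) this) 2
  rw [integrableOn_const_iff] at h3
  simpa using h3

namespace Coeffs

variable {P : Coeffs} {a : ℝ}

theorem exists_pos_le {r ri : ℝ → ℝ} (hr : ∀ x, 0 < r x) (hri : ∀ x, ri x * r x = 1)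
    (h : Dec wOne ri) : ∃ r₀, 0 < r₀ ∧ ∀ x, r₀ ≤ r x := by
  obtain ⟨C, hC⟩ := h.bound
  refine ⟨(|C| + 1)⁻¹, by positivity, fun x => ?_⟩
  have h1 : ri x ≤ |C| + 1 := by
    have := (le_abs_self _).trans (hC x)
    simp only [wOne, mul_one] at this
    linarith [le_abs_self C]
  rw [inv_le_iff_one_le_mul₀ (by positivity)]
  calc (1 : ℝ) = ri x * r x := (hri x).symm
    _ ≤ (|C| + 1) * r x := mul_le_mul_of_nonneg_right h1 (hr x).le
    _ = _ := by ring

variable (P) in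
/-- Solvability of `σ⁻¹ k - (r k')' = R` in the class of exponentially decaying functions. -/
theorem exists_green {R : ℝ → ℝ} (hR : Dec (expW P.b) R) : ∃ k : ℝ → ℝ, Dec (expW P.b) k ∧
    ∀ x, P.σi x * k x - deriv (fun y => P.r y * deriv k y) x = R x := by
  obtain ⟨r₀, h1, h2⟩ := exists_pos_le P.r_pos P.ri_mul P.dec_ri
  have hσi : ∀ x, 0 < P.σi x := fun x => by
    have := P.σi_mul x
    by_contra! h
    nlinarith [P.σ_pos x]
  obtain ⟨s₀, h3, h4⟩ := exists_pos_le hσi (fun x => by rw [mul_comm]; exact P.σi_mul x) P.dec_σ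
  exact exists_decaying_solution P.dec_r P.dec_σi P.dec_ri h1 h2
    (fun x => eq_inv_of_mul_eq_one_left (P.ri_mul x)) h3 h4 hR P.b_pos P.X_nonneg P.drift_far
    P.pot_far P.rate

variable (P) in
theorem σi_pos (x : ℝ) : 0 < P.σi x := by
  have := P.σi_mul x
  by_contra! h
  nlinarith [P.σ_pos x]

/-- Every test function ρ is M⋆k for some exponentially decaying k, and such k may be used as a test
function in the relation; hence f pairs to zero with all ρ e^(-ax). -/
theorem Rel.eq_zero (ha : 0 < a) (hab : a < P.b) {f : L2C} (h : P.Rel a 0 f) : f = 0 := by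
  refine eq_zero_of_test (F := fun x => Real.exp (-(a * x))) (by fun_prop)
    (fun x => (Real.exp_pos _).ne') fun ρ hs hc => ?_
  have dρ := dec_of_hasCompactSupport (continuous_expW P.b) (expW_pos P.b) hs hc
  obtain ⟨k, hk, hke⟩ := P.exists_green (P.dec_σi.one_mul dρ)
  have hM : P.M k = ρ := by
    ext x
    have := hke x
    rw [M]
    linear_combination P.σ x * this + (ρ x - k x) * P.σi_mul x
  have := h.extend ha hab (dec_leftW_of_expW P.b_pos.le hk)
  rw [integral_smul_zero_L2, hM, neg_zero] at this
  exact this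

variable (P) in
theorem dec_source {v : ℝ → ℝ} (hv : Dec (expW P.b) v) :
    Dec (expW P.b) (fun x => P.c * P.r x * (-deriv (deriv v) x + P.q x * v x)) :=
  (P.dec_r.const_mul P.c).one_mul (hv.deriv.deriv.neg.add (P.dec_q.one_mul hv))

theorem abs_lt_b (ha : 0 < a) (hab : a < P.b) : |a| < P.b := by rwa [abs_of_pos ha]

/-- The domain contains e^(ax) σ⁻¹ v for every test function v, since the equation for the image is
solvable in the decaying class. -/
theorem eq_zero_of_orthogonal_domain (ha : 0 < a) (hab : a < P.b) {y : L2C}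
    (h : ∀ w f, P.Rel a w f → inner ℂ w y = 0) : y = 0 := by
  refine eq_zero_of_test (F := fun x => P.σi x * Real.exp (a * x))
    (P.dec_σi.contDiff.continuous.mul (by fun_prop))
    (fun x => mul_ne_zero (P.σi_pos x).ne' (Real.exp_pos _).ne') fun v hs hc => ?_
  have dv := dec_of_hasCompactSupport (continuous_expW P.b) (expW_pos P.b) hs hc
  obtain ⟨k, hk, hke⟩ := P.exists_green (P.dec_source dv).deriv
  obtain ⟨w, hw⟩ := exists_represents (memLp_exp_mul (abs_lt_b ha hab) (P.dec_σi.one_mul dv))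
  obtain ⟨f, hf⟩ := exists_represents (memLp_exp_mul (abs_lt_b ha hab) (P.dec_σi.one_mul hk))
  have := h w f (P.rel_of_classical hs hk.contDiff hke hw hf)
  rw [inner_represents hw] at this
  rw [← this]
  congr 1; ext x; congr 1; ring

/-- Dual form of integrating ∂L(e^(-ax)w) = 0. For ρ ⊥ ψ solve -τ'' + qτ = ρ and test with χ =
∫_{-∞}^x r⁻¹τ, for which L⋆χ' = cσρ. Thus σe^(-ax)w annihilates ψ^⊥. That χ need not vanish at +∞ is
what excludes an integration constant. -/
theorem Rel.exists_eq_zero_mode (ha : 0 < a) (hab : a < P.b) {w : L2C} (h : P.Rel a w 0) :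
    ∃ α : ℂ, ∀ᵐ x, w x = α * ((Real.exp (a * x) * (P.σi x * P.ψ x) : ℝ) : ℂ) := by
  have hFc : Continuous fun x => P.σ x * Real.exp (-(a * x)) :=
    P.dec_σ.contDiff.continuous.mul (by fun_prop)
  obtain ⟨α, hα⟩ := ae_eq_smul_of_integral_eq_zero (g := P.ψ)
    (locallyIntegrable_smul_L2 hFc w) P.dec_ψ.contDiff.continuous fun ρ hs hc h0 => by
    have dρ := dec_of_hasCompactSupport (continuous_expW P.b) (expW_pos P.b) hs hc
    obtain ⟨R, hR0, hR⟩ := exists_bound_support hc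
    obtain ⟨τ, hτ, hτe⟩ := P.exists_dec_solution (C := 0) (X := R + 1) dρ
      (fun x hx => by rw [hR x (by linarith)]; simp) (by simpa only [mul_comm] using h0)
    obtain ⟨dχ, hχ⟩ := dec_primitive P.b_pos (P.dec_ri.one_mul hτ)
    have hL : P.L (deriv fun x => ∫ t in Set.Iic x, P.ri t * τ t) = fun x => P.c * P.σ x * ρ x := by
      have e1 : (deriv fun x => ∫ t in Set.Iic x, P.ri t * τ t) = fun x => P.ri x * τ x :=
        funext fun x => (hχ x).deriv
      have e2 : (fun y => P.r y * (P.ri y * τ y)) = τ := by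
        ext y
        linear_combination τ y * P.ri_mul y
      ext x
      rw [e1, L, e2, ← hτe x]
      linear_combination P.c * P.σ x * P.q x * τ x * P.ri_mul x
    have := h.extend ha hab dχ
    rw [integral_smul_zero_L2, hL, eq_comm, neg_eq_zero] at this
    have e : ∀ x, (P.c * P.σ x * ρ x * Real.exp (-(a * x))) • w x =
        P.c • (ρ x • (P.σ x * Real.exp (-(a * x))) • w x) := fun x => by
      rw [smul_smul, smul_smul]; congr 1; ring
    simp only [e] at this
    rw [integral_smul, smul_eq_zero] at this
    exact this.resolve_left P.c_pos.ne'
  refine ⟨α, ?_⟩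
  filter_upwards [hα] with x hx
  have e3 : Real.exp (a * x) * P.σi x * (P.σ x * Real.exp (-(a * x))) = 1 := by
    have : Real.exp (a * x) * Real.exp (-(a * x)) = 1 := by rw [← Real.exp_add]; simp
    linear_combination Real.exp (a * x) * Real.exp (-(a * x)) * P.σi_mul x + this
  calc w x = (Real.exp (a * x) * P.σi x * (P.σ x * Real.exp (-(a * x)))) • w x := by
        rw [e3, one_smul]
    _ = (Real.exp (a * x) * P.σi x) • (P.σ x * Real.exp (-(a * x))) • w x := by rw [smul_smul]
    _ = _ := by
      rw [hx, Complex.real_smul]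
      push_cast; ring

theorem exists_represents_left (ha : 0 < a) (hab : a < P.b) {χ : ℝ → ℝ}
    (hχ : Dec (leftW P.b) χ) : ∃ u : L2C, Represents u (-a) χ := by
  refine exists_represents ?_
  have := memLp_mul_exp_left ha hab hχ.contDiff.continuous hχ.bound
  simpa only [mul_comm, neg_mul, mul_neg] using this

/-- This is the formula for the adjoint operator on vectors e^(-ax) M⋆χ; conjugation passes from the
bilinear pairing to the inner product. -/
theorem Rel.inner_eq (ha : 0 < a) (hab : a < P.b) {w f : L2C} (h : P.Rel a w f) {χ : ℝ → ℝ}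
    (hχ : Dec (leftW P.b) χ) {u v : L2C} (hu : Represents u (-a) (P.M χ))
    (hv : Represents v (-a) fun x => -P.L (deriv χ) x) : inner ℂ f u = inner ℂ w v := by
  rw [← inner_conj_symm f u, ← inner_conj_symm w v]
  congr 1
  rw [inner_represents hu, inner_represents hv]
  have := h.extend ha hab hχ
  simp only [neg_mul, neg_smul, integral_neg]
  exact this

/-- The range contains e^(ax)K' whenever ∫ K' M⋆W = 0. Hence e^(ax)y - β M⋆W annihilates all
derivatives of test functions for a suitable β, so it is a constant κ, and square integrability of y
at -∞ gives κ = 0. -/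
theorem exists_eq_of_orthogonal_range (ha : 0 < a) (hab : a < P.b) {W : ℝ → ℝ}
    (hW : Dec (leftW P.b) W) (hW' : ∀ x, deriv W x = P.ri x * P.ψ x) {y : L2C}
    (h : ∀ w f, P.Rel a w f → inner ℂ f y = 0) :
    ∃ β : ℂ, ∀ᵐ x, y x = β * ((Real.exp (-a * x) * P.M W x : ℝ) : ℂ) := by
  have hMs := (P.dec_M hW).contDiff
  have key : ∀ K : ℝ → ℝ, ContDiff ℝ ∞ K → HasCompactSupport K →
      ∫ x, deriv K x * P.M W x = 0 → ∫ x, deriv K x • Real.exp (a * x) • y x = 0 := by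
    intro K hs hc h0
    have dK := dec_of_hasCompactSupport (continuous_expW P.b) (expW_pos P.b) hs hc
    -- For the image e^(ax)K' one has M K' = ∂(K - r(σK')'). It suffices to solve cr(-τ'' + qτ) = K
    -- - r(σK')', that is -τ'' + qτ = ρ.
    set ρ : ℝ → ℝ := fun x => P.c⁻¹ * (P.ri x * K x - deriv (fun y => P.σ y * deriv K y) x) with hρ
    have dρ : Dec (expW P.b) ρ :=
      ((P.dec_ri.one_mul dK).sub (P.dec_σ.one_mul dK.deriv).deriv).const_mul _
    have cρ : HasCompactSupport ρ := by
      refine HasCompactSupport.mul_left ?_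
      exact hc.mul_left.sub hc.deriv.mul_left.deriv
    have sψ := P.dec_ψ.contDiff
    have sψ' := contDiff_infty_deriv sψ
    have sσ := P.dec_σ.contDiff
    have s1 : ContDiff ℝ ∞ (fun y => P.σ y * deriv K y) := sσ.mul (contDiff_infty_deriv hs)
    have hρ0 : ∫ x, P.ψ x * ρ x = 0 := by
      -- J' = K' M⋆W + cψρ, so the Fredholm condition ρ ⊥ ψ is the hypothesis on K.
      set J : ℝ → ℝ := fun x => K x * P.M W x - P.ψ x * (P.σ x * deriv K x) +
        K x * (P.σ x * deriv P.ψ x) with hJ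
      have sJ : ContDiff ℝ ∞ J := ((hs.mul hMs).sub (sψ.mul s1)).add (hs.mul (sσ.mul sψ'))
      have cJ : HasCompactSupport J :=
        (hc.mul_right.sub (hc.deriv.mul_left.mul_left)).add hc.mul_right
      have e0 : (fun y => P.r y * deriv W y) = P.ψ := by
        ext y; rw [hW']; linear_combination P.ψ y * P.ri_mul y
      have eM : P.M W = fun x => W x - P.σ x * deriv P.ψ x := by
        ext x; rw [M, e0]
      have s2 : ContDiff ℝ ∞ (fun y => P.σ y * deriv P.ψ y) := sσ.mul sψ'
      have dJ : ∀ x, deriv J x = deriv K x * P.M W x + P.c * (P.ψ x * ρ x) := by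
        intro x
        have dM : HasDerivAt (P.M W) (P.ri x * P.ψ x - deriv (fun y => P.σ y * deriv P.ψ y) x) x := by
          rw [eM, ← hW']
          exact (hasDerivAt_of_smooth hW.contDiff x).sub (hasDerivAt_of_smooth s2 x)
        have e := (((hasDerivAt_of_smooth hs x).mul dM).sub
          ((hasDerivAt_of_smooth sψ x).mul (hasDerivAt_of_smooth s1 x))).add
          ((hasDerivAt_of_smooth hs x).mul (hasDerivAt_of_smooth s2 x))
        refine e.deriv.trans ?_
        simp only [hρ]
        have := mul_inv_cancel₀ P.c_pos.ne'
        linear_combination (-P.ψ x * (P.ri x * K x - deriv (fun y => P.σ y * deriv K y) x)) * this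
      have h1 := integral_deriv_eq_zero sJ cJ
      simp only [dJ] at h1
      have i1 : Integrable fun x => deriv K x * P.M W x :=
        ((contDiff_infty_deriv hs).continuous.mul hMs.continuous).integrable_of_hasCompactSupport
          hc.deriv.mul_right
      have i2 : Integrable fun x => P.ψ x * ρ x :=
        (sψ.continuous.mul dρ.contDiff.continuous).integrable_of_hasCompactSupport cρ.mul_left
      rw [integral_add i1 (i2.const_mul _), h0, zero_add, integral_const_mul] at h1
      exact (mul_eq_zero.1 h1).resolve_left P.c_pos.ne'
    obtain ⟨R, hR0, hR⟩ := exists_bound_support cρ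
    obtain ⟨τ, hτ, hτe⟩ := P.exists_dec_solution (C := 0) (X := R + 1) dρ
      (fun x hx => by rw [hR x (by linarith)]; simp) hρ0
    have hrel : ∀ x, P.σi x * (P.σ x * deriv K x) -
        deriv (fun y => P.r y * deriv (fun y => P.σ y * deriv K y) y) x =
        deriv (fun y => P.c * P.r y * (-deriv (deriv τ) y + P.q y * τ y)) x := by
      intro x
      have e1 : (fun y => P.c * P.r y * (-deriv (deriv τ) y + P.q y * τ y)) =
          fun y => K y - P.r y * deriv (fun y => P.σ y * deriv K y) y := by
        ext y
        rw [hτe y]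
        simp only [hρ]
        have := mul_inv_cancel₀ P.c_pos.ne'
        linear_combination (P.r y * (P.ri y * K y - deriv (fun y => P.σ y * deriv K y) y)) * this +
          K y * P.ri_mul y
      rw [e1, ((hasDerivAt_of_smooth hs x).fun_sub
        (hasDerivAt_of_smooth (P.dec_r.contDiff.mul (contDiff_infty_deriv s1)) x)).deriv]
      linear_combination deriv K x * P.σi_mul x
    have dk : Dec (expW P.b) (fun y => P.σ y * deriv K y) := P.dec_σ.one_mul dK.deriv
    obtain ⟨w, hw⟩ := exists_represents (memLp_exp_mul (abs_lt_b ha hab) (P.dec_σi.one_mul hτ))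
    obtain ⟨f, hf⟩ := exists_represents (memLp_exp_mul (abs_lt_b ha hab) (P.dec_σi.one_mul dk))
    have := h w f (P.rel_of_classical hτ.contDiff s1 hrel hw hf)
    rw [inner_represents hf] at this
    rw [← this]
    congr 1; ext x
    rw [smul_smul]
    congr 1
    linear_combination (-deriv K x * Real.exp (a * x)) * P.σi_mul x
  have hly : LocallyIntegrable fun x => Real.exp (a * x) • y x :=
    locallyIntegrable_smul_L2 (by fun_prop) y
  have hcM : Continuous fun x => (P.M W x : ℂ) := Complex.continuous_ofReal.comp hMs.continuous
  have hsub : ∀ (β : ℂ) {K : ℝ → ℝ}, ContDiff ℝ ∞ K → HasCompactSupport K →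
      ∫ x, deriv K x • (Real.exp (a * x) • y x - β * (P.M W x : ℂ)) =
        (∫ x, deriv K x • Real.exp (a * x) • y x) - β * ((∫ x, deriv K x * P.M W x : ℝ) : ℂ) := by
    intro β K hs hc
    simp only [smul_sub]
    have i1 := hly.integrable_smul_left_of_hasCompactSupport
      (contDiff_infty_deriv hs).continuous hc.deriv
    have i2 := (hcM.const_mul β).locallyIntegrable (μ := volume)
      |>.integrable_smul_left_of_hasCompactSupport (contDiff_infty_deriv hs).continuous hc.deriv
    rw [integral_sub i1 i2]
    congr 1
    rw [← integral_complex_ofReal, ← integral_const_mul]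
    congr 1; ext x
    rw [Complex.real_smul]; push_cast; ring
  obtain ⟨β, hβ⟩ : ∃ β : ℂ, ∀ K : ℝ → ℝ, ContDiff ℝ ∞ K → HasCompactSupport K →
      ∫ x, deriv K x • (Real.exp (a * x) • y x - β * (P.M W x : ℂ)) = 0 := by
    by_cases hex : ∃ K : ℝ → ℝ, ContDiff ℝ ∞ K ∧ HasCompactSupport K ∧
        ∫ x, deriv K x * P.M W x ≠ 0
    · obtain ⟨K₀, hs₀, hc₀, hne⟩ := hex
      set m₀ := ∫ x, deriv K₀ x * P.M W x with hm₀
      set j₀ := ∫ x, deriv K₀ x • Real.exp (a * x) • y x with hj₀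
      refine ⟨j₀ / (m₀ : ℂ), fun K hs hc => ?_⟩
      set m₁ := ∫ x, deriv K x * P.M W x with hm₁
      have s3 : ContDiff ℝ ∞ fun x => K x - m₁ / m₀ * K₀ x := hs.sub (contDiff_const.mul hs₀)
      have c3 : HasCompactSupport fun x => K x - m₁ / m₀ * K₀ x := hc.sub hc₀.mul_left
      have d3 : deriv (fun x => K x - m₁ / m₀ * K₀ x) = fun x => deriv K x - m₁ / m₀ * deriv K₀ x :=
        funext fun x => ((hasDerivAt_of_smooth hs x).fun_sub
          ((hasDerivAt_of_smooth hs₀ x).const_mul _)).deriv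
      have i1 : ∀ {K : ℝ → ℝ}, ContDiff ℝ ∞ K → HasCompactSupport K →
          Integrable fun x => deriv K x * P.M W x := fun hs hc =>
        ((contDiff_infty_deriv hs).continuous.mul hMs.continuous).integrable_of_hasCompactSupport
          hc.deriv.mul_right
      have i2 : ∀ {K : ℝ → ℝ}, ContDiff ℝ ∞ K → HasCompactSupport K →
          Integrable fun x => deriv K x • Real.exp (a * x) • y x := fun hs hc =>
        hly.integrable_smul_left_of_hasCompactSupport (contDiff_infty_deriv hs).continuous hc.deriv
      have h3 := key _ s3 c3 (by
        rw [d3]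
        simp only [sub_mul, mul_assoc]
        rw [integral_sub (i1 hs hc) ((i1 hs₀ hc₀).const_mul _), integral_const_mul, ← hm₀, ← hm₁,
          div_mul_cancel₀ _ hne, sub_self])
      rw [d3] at h3
      simp only [sub_smul, mul_smul] at h3
      have i3 : Integrable fun x => (m₁ / m₀) • deriv K₀ x • Real.exp (a * x) • y x :=
        (i2 hs₀ hc₀).smul (m₁ / m₀)
      rw [integral_sub (i2 hs hc) i3, integral_smul, ← hj₀,
        Complex.real_smul] at h3
      rw [hsub _ hs hc, ← hm₁, ← h3]
      push_cast; ring
    · push Not at hex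
      refine ⟨0, fun K hs hc => ?_⟩
      rw [hsub _ hs hc, zero_mul, sub_zero]
      exact key K hs hc (hex K hs hc)
  -- Test functions of mean zero are derivatives of test functions, so what remains is a constant.
  obtain ⟨κ, hκ⟩ := ae_eq_smul_of_integral_eq_zero (g := fun _ => 1)
    (hly.sub (hcM.const_mul β).locallyIntegrable) continuous_const fun ρ hs hc h0 => by
      obtain ⟨K, sK, cK, rfl⟩ := exists_test_primitive hs hc (by simpa using h0)
      exact hβ K sK cK
  have hexp : ∀ x, (Real.exp (-a * x) : ℂ) * (Real.exp (a * x) : ℂ) = 1 := fun x => by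
    rw [← Complex.ofReal_mul, ← Real.exp_add]; simp
  have hy : ∀ᵐ x, y x = β * ((Real.exp (-a * x) * P.M W x : ℝ) : ℂ) +
      κ * (Real.exp (-(a * x)) : ℂ) := by
    filter_upwards [hκ] with x hx
    simp only [Pi.sub_apply, Complex.real_smul, Complex.ofReal_one, mul_one] at hx
    rw [← neg_mul, ← one_mul (y x), ← hexp x, Complex.ofReal_mul]
    linear_combination (Real.exp (-a * x) : ℂ) * hx
  have hκ0 : κ = 0 := by
    obtain ⟨u, hu⟩ := exists_represents_left ha hab (P.dec_M hW)
    refine eq_zero_of_memLp_exp ha (((Lp.memLp y).sub ((Lp.memLp u).const_mul β)).ae_eq ?_)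
    filter_upwards [hy, hu] with x h1 h2
    rw [Pi.sub_apply, h1, h2]; ring
  refine ⟨β, ?_⟩
  filter_upwards [hy] with x hx
  rw [hx, hκ0]; ring

end Coeffs

/-! ### Primitives of powers -/

/-- The primitive of `τ ^ p` that vanishes at `1`. -/
def powInt (p t : ℝ) : ℝ := ∫ τ in (1 : ℝ)..t, τ ^ p

theorem powInt_one (p : ℝ) : powInt p 1 = 0 := intervalIntegral.integral_same

theorem hasDerivAt_powInt (p : ℝ) {t : ℝ} (ht : 0 < t) : HasDerivAt (powInt p) (t ^ p) t := by
  have hc : ContinuousOn (fun τ : ℝ => τ ^ p) (Set.Ioi 0) := fun τ hτ =>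
    (Real.continuousAt_rpow_const τ p (Or.inl (ne_of_gt hτ))).continuousWithinAt
  refine intervalIntegral.integral_hasDerivAt_right ?_ ?_ ?_
  · refine (hc.mono fun τ hτ => ?_).intervalIntegrable
    exact (lt_min zero_lt_one ht).trans_le hτ.1
  · exact hc.stronglyMeasurableAtFilter isOpen_Ioi t ht
  · exact hc.continuousAt (Ioi_mem_nhds ht)

theorem exists_rpow_bounds (p H : ℝ) :
    ∃ C, 0 < C ∧ ∀ t ∈ Set.Icc 1 H, C⁻¹ ≤ t ^ p ∧ t ^ p ≤ C := by
  rcases le_or_gt 1 H with hH | hH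
  · refine ⟨H ^ |p|, by positivity, fun t ht => ?_⟩
    have h0 : 0 < t := by linarith [ht.1]
    have h1 : t ^ |p| ≤ H ^ |p| := Real.rpow_le_rpow h0.le ht.2 (abs_nonneg p)
    refine ⟨?_, (Real.rpow_le_rpow_of_exponent_le ht.1 (le_abs_self p)).trans h1⟩
    calc (H ^ |p|)⁻¹ ≤ (t ^ |p|)⁻¹ := inv_anti₀ (by positivity) h1
      _ = t ^ (-|p|) := (Real.rpow_neg h0.le _).symm
      _ ≤ _ := Real.rpow_le_rpow_of_exponent_le ht.1 (neg_abs_le p)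
  · exact ⟨1, one_pos, fun t ht => absurd (ht.1.trans ht.2) (not_le.2 hH)⟩

theorem exists_eq_slope_of_one_le {f f' : ℝ → ℝ} (hf : ∀ t, 0 < t → HasDerivAt f (f' t) t) {H t u : ℝ}
    (ht : t ∈ Set.Icc 1 H) (hu : u ∈ Set.Icc 1 H) :
    ∃ ξ ∈ Set.Icc 1 H, f t - f u = f' ξ * (t - u) ∧ |ξ - u| ≤ |t - u| := by
  have key : ∀ {t u : ℝ}, t ∈ Set.Icc 1 H → u ∈ Set.Icc 1 H → u < t →
      ∃ ξ ∈ Set.Icc u t, f t - f u = f' ξ * (t - u) := by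
    intro t u ht hu hut
    obtain ⟨ξ, hξ, e⟩ := exists_hasDerivAt_eq_slope f f' hut
      (fun τ hτ => (hf τ (by linarith [hu.1, hτ.1])).continuousAt.continuousWithinAt)
      (fun τ hτ => hf τ (by linarith [hu.1, hτ.1]))
    exact ⟨ξ, ⟨hξ.1.le, hξ.2.le⟩, by rw [e, div_mul_cancel₀ _ (by linarith)]⟩
  rcases lt_trichotomy u t with h | h | h
  · obtain ⟨ξ, hξ, e⟩ := key ht hu h
    refine ⟨ξ, ⟨hu.1.trans hξ.1, hξ.2.trans ht.2⟩, e, ?_⟩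
    rw [abs_of_nonneg (by linarith [hξ.1]), abs_of_nonneg (by linarith)]
    linarith [hξ.2]
  · subst h
    exact ⟨u, hu, by simp, by simp⟩
  · obtain ⟨ξ, hξ, e⟩ := key hu ht h
    refine ⟨ξ, ⟨ht.1.trans hξ.1, hξ.2.trans hu.2⟩, by linarith, ?_⟩
    rw [abs_of_nonpos (by linarith [hξ.2]), abs_of_nonpos (by linarith)]
    linarith [hξ.1]

/-- On a bounded range of amplitudes the change of variable is bi-Lipschitz, so estimates pass
freely between φ and `powInt p φ`. -/
theorem exists_powInt_bounds (p H : ℝ) : ∃ C, 0 < C ∧ ∀ t ∈ Set.Icc 1 H, ∀ u ∈ Set.Icc 1 H,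
    |t - u| ≤ C * |powInt p t - powInt p u| ∧ |powInt p t - powInt p u| ≤ C * |t - u| := by
  obtain ⟨C, hC, hb⟩ := exists_rpow_bounds p H
  refine ⟨C, hC, fun t ht u hu => ?_⟩
  obtain ⟨ξ, hξ, e, -⟩ := exists_eq_slope_of_one_le (fun t ht => hasDerivAt_powInt p ht) ht hu
  have h0 : 0 < ξ ^ p := Real.rpow_pos_of_pos (by linarith [hξ.1]) p
  rw [e, abs_mul, abs_of_pos h0]
  refine ⟨?_, mul_le_mul_of_nonneg_right (hb ξ hξ).2 (abs_nonneg _)⟩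
  rw [← mul_assoc]
  refine le_mul_of_one_le_left (abs_nonneg _) ?_
  calc (1 : ℝ) = C * C⁻¹ := (mul_inv_cancel₀ hC.ne').symm
    _ ≤ _ := mul_le_mul_of_nonneg_left (hb ξ hξ).1 hC.le

theorem strictMonoOn_powInt (p : ℝ) : StrictMonoOn (powInt p) (Set.Ici 1) := by
  refine strictMonoOn_of_hasDerivWithinAt_pos (convex_Ici 1) (f' := fun t => t ^ p)
    (fun t ht => (hasDerivAt_powInt p
      (zero_lt_one.trans_le ht)).continuousAt.continuousWithinAt) (fun t ht => ?_) fun t ht => ?_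
  all_goals rw [interior_Ici] at ht
  · exact (hasDerivAt_powInt p (zero_lt_one.trans ht)).hasDerivWithinAt
  · exact Real.rpow_pos_of_pos (zero_lt_one.trans ht) p

theorem powInt_pos (p : ℝ) {t : ℝ} (ht : 1 < t) : 0 < powInt p t := by
  rw [← powInt_one p]
  exact strictMonoOn_powInt p Set.self_mem_Ici ht.le ht

/-! ### The profile equation as a Hamiltonian system -/

/-- The momentum `φ ^ (-m) φ'`. -/
def psi (m : ℝ) (φ : ℝ → ℝ) (x : ℝ) : ℝ := φ x ^ (-m) * deriv φ x

/-- The force `t ^ (-n) (t - 1 - (t ^ n - 1) / s)`. -/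
def force (n s t : ℝ) : ℝ := t ^ (1 - n) - t ^ (-n) - s⁻¹ + s⁻¹ * t ^ (-n)

/-- The derivative of the force. -/
def dforce (n s t : ℝ) : ℝ := (1 - n) * t ^ (-n) + (n - n * s⁻¹) * t ^ (-n - 1)

theorem hasDerivAt_force (n s : ℝ) {t : ℝ} (ht : 0 < t) :
    HasDerivAt (force n s) (dforce n s t) t := by
  have h : ∀ p : ℝ, HasDerivAt (fun t : ℝ => t ^ p) (p * t ^ (p - 1)) t := fun p =>
    Real.hasDerivAt_rpow_const (Or.inl ht.ne')
  refine ((((h (1 - n)).sub (h (-n))).sub_const s⁻¹).add ((h (-n)).const_mul s⁻¹)).congr_deriv ?_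
  rw [dforce, show 1 - n - 1 = -n by ring]
  ring

theorem force_one (n s : ℝ) : force n s 1 = 0 := by simp [force]

theorem force_sub (n s c t : ℝ) : force n s t = force n c t - (s⁻¹ - c⁻¹) * (1 - t ^ (-n)) := by
  simp only [force]; ring

/-- Minus the potential, up to the choice of the speed: `A - B / s` is a primitive of
`t ^ (-m) force n s t`. -/
def potA (n m t : ℝ) : ℝ := powInt (1 - n - m) t - powInt (-n - m) t

/-- See `potA`. -/
def potB (n m t : ℝ) : ℝ := powInt (-m) t - powInt (-n - m) t

theorem hasDerivAt_potA (n m : ℝ) {t : ℝ} (ht : 0 < t) :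
    HasDerivAt (potA n m) (t ^ (-n - m) * (t - 1)) t := by
  refine ((hasDerivAt_powInt _ ht).sub (hasDerivAt_powInt _ ht)).congr_deriv ?_
  rw [show 1 - n - m = (-n - m) + 1 by ring, Real.rpow_add_one ht.ne']
  ring

theorem hasDerivAt_potB (n m : ℝ) {t : ℝ} (ht : 0 < t) :
    HasDerivAt (potB n m) (t ^ (-n - m) * (t ^ n - 1)) t := by
  refine ((hasDerivAt_powInt _ ht).sub (hasDerivAt_powInt _ ht)).congr_deriv ?_
  rw [mul_sub, ← Real.rpow_add ht, show -n - m + n = -m by ring]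
  ring

theorem potA_one (n m : ℝ) : potA n m 1 = 0 := by simp [potA, powInt_one]

theorem potB_one (n m : ℝ) : potB n m 1 = 0 := by simp [potB, powInt_one]

theorem potA_pos (n m : ℝ) {t : ℝ} (ht : 1 < t) : 0 < potA n m t := by
  have : StrictMonoOn (potA n m) (Set.Ici 1) := by
    refine strictMonoOn_of_hasDerivWithinAt_pos (convex_Ici 1)
      (f' := fun t => t ^ (-n - m) * (t - 1)) (fun t ht => (hasDerivAt_potA n m
        (zero_lt_one.trans_le ht)).continuousAt.continuousWithinAt) (fun t ht => ?_) fun t ht => ?_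
    all_goals rw [interior_Ici] at ht
    · exact (hasDerivAt_potA n m (zero_lt_one.trans ht)).hasDerivWithinAt
    · exact mul_pos (Real.rpow_pos_of_pos (zero_lt_one.trans ht) _) (sub_pos.2 ht)
  rw [← potA_one n m]
  exact this Set.self_mem_Ici ht.le ht

/-- Strict convexity of t^n: secant slopes from 1 increase. -/
theorem rpow_slope_lt {n t u : ℝ} (hn : 1 < n) (ht : 1 < t) (htu : t < u) :
    (t ^ n - 1) * (u - 1) < (u ^ n - 1) * (t - 1) := by
  have := (strictConvexOn_rpow hn).secant_strict_mono (a := 1) (x := t) (y := u)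
    (Set.mem_Ici.2 zero_le_one) (Set.mem_Ici.2 (by linarith)) (Set.mem_Ici.2 (by linarith))
    (by linarith) (by linarith) htu
  rw [Real.one_rpow, div_lt_div_iff₀ (by linarith) (by linarith)] at this
  exact this

/-- A and B are integrals of u - 1 and u^n - 1 against the same positive weight. The difference of
the two sides, as a function of the upper limit u with t fixed, increases by `rpow_slope_lt`. -/
theorem potB_lt {n m t : ℝ} (hn : 1 < n) (ht : 1 < t) :
    (t - 1) * potB n m t < (t ^ n - 1) * potA n m t := by
  have hd : ∀ u, 0 < u → HasDerivAt (fun u => (t ^ n - 1) * potA n m u - (t - 1) * potB n m u)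
      ((t ^ n - 1) * (u ^ (-n - m) * (u - 1)) - (t - 1) * (u ^ (-n - m) * (u ^ n - 1))) u :=
    fun u hu => ((hasDerivAt_potA n m hu).const_mul _).sub ((hasDerivAt_potB n m hu).const_mul _)
  have : StrictMonoOn (fun u => (t ^ n - 1) * potA n m u - (t - 1) * potB n m u)
      (Set.Icc 1 t) := by
    refine strictMonoOn_of_hasDerivWithinAt_pos (convex_Icc 1 t)
      (f' := fun u => (t ^ n - 1) * (u ^ (-n - m) * (u - 1)) -
        (t - 1) * (u ^ (-n - m) * (u ^ n - 1)))
      (fun u hu => (hd u (zero_lt_one.trans_le hu.1)).continuousAt.continuousWithinAt)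
      (fun u hu => ?_) fun u hu => ?_
    all_goals rw [interior_Icc] at hu
    · exact (hd u (zero_lt_one.trans hu.1)).hasDerivWithinAt
    · have h1 := rpow_slope_lt hn hu.1 hu.2
      have h2 : 0 < u ^ (-n - m) := Real.rpow_pos_of_pos (zero_lt_one.trans hu.1) _
      have : 0 < u ^ (-n - m) * ((t ^ n - 1) * (u - 1) - (u ^ n - 1) * (t - 1)) :=
        mul_pos h2 (by linarith)
      calc (0 : ℝ) < _ := this
        _ = (t ^ n - 1) * (u ^ (-n - m) * (u - 1)) - (t - 1) * (u ^ (-n - m) * (u ^ n - 1)) := by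
          ring
  have := this (Set.left_mem_Icc.2 ht.le) (Set.right_mem_Icc.2 ht.le) ht
  simp only [potA_one, potB_one] at this
  linarith

/-- The speed of the wave with a given maximum. -/
def speedOf (n m t : ℝ) : ℝ := potB n m t / potA n m t

/-- The numerator of (B/A)' is t^(-n-m) times the positive difference in `potB_lt`. -/
theorem exists_hasDerivAt_speedOf {n : ℝ} (m : ℝ) {t : ℝ} (hn : 1 < n) (ht : 1 < t) :
    ∃ d, 0 < d ∧ HasDerivAt (speedOf n m) d t := by
  have h0 : 0 < t := by linarith
  have hA := potA_pos n m ht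
  refine ⟨_, ?_, (hasDerivAt_potB n m h0).div (hasDerivAt_potA n m h0) hA.ne'⟩
  have h1 := potB_lt (m := m) hn ht
  have h2 : 0 < t ^ (-n - m) := Real.rpow_pos_of_pos h0 _
  refine div_pos ?_ (by positivity)
  have := mul_pos h2 (sub_pos.2 h1)
  calc (0 : ℝ) < _ := this
    _ = _ := by ring

theorem strictMonoOn_speedOf {n : ℝ} (m : ℝ) (hn : 1 < n) :
    StrictMonoOn (speedOf n m) (Set.Ioi 1) := by
  refine strictMonoOn_of_deriv_pos (convex_Ioi 1) (fun t ht => ?_) fun t ht => ?_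
  · obtain ⟨d, -, hd⟩ := exists_hasDerivAt_speedOf m hn ht
    exact hd.continuousAt.continuousWithinAt
  · rw [interior_Ioi] at ht
    obtain ⟨d, hd0, hd⟩ := exists_hasDerivAt_speedOf m hn ht
    rwa [hd.deriv]

namespace IsSolitaryWave

variable {n m s : ℝ} {φ : ℝ → ℝ}

theorem pos (h : IsSolitaryWave n m s φ) (x : ℝ) : 0 < φ x := zero_lt_one.trans (h.one_lt x)

theorem rpow_hasDerivAt (h : IsSolitaryWave n m s φ) (p x : ℝ) :
    HasDerivAt (fun y => φ y ^ p) (p * φ x ^ (p - 1) * deriv φ x) x := by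
  have hd := (h.contDiff.differentiable (by norm_num) x).hasDerivAt
  exact (hd.rpow_const (Or.inl (h.pos x).ne')).congr_deriv (by ring)

theorem deriv_eq (h : IsSolitaryWave n m s φ) (x : ℝ) : deriv φ x = φ x ^ m * psi m φ x := by
  rw [psi, ← mul_assoc, ← Real.rpow_add (h.pos x), add_neg_cancel, Real.rpow_zero, one_mul]

theorem hasDerivAt (h : IsSolitaryWave n m s φ) (x : ℝ) :
    HasDerivAt φ (φ x ^ m * psi m φ x) x := by
  rw [← h.deriv_eq]; exact (h.contDiff.differentiable (by norm_num) x).hasDerivAt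

theorem continuous (h : IsSolitaryWave n m s φ) : Continuous φ := h.contDiff.continuous

theorem psi_hasDerivAt (h : IsSolitaryWave n m s φ) (hs : s ≠ 0) (x : ℝ) :
    HasDerivAt (psi m φ) (force n s (φ x)) x := by
  have hd : DifferentiableAt ℝ (psi m φ) x :=
    (h.rpow_hasDerivAt (-m) x).differentiableAt.mul (h.contDiff.differentiable_deriv_two x)
  have hode := h.ode x
  change _ + s * φ x ^ n * deriv (psi m φ) x = 0 at hode
  refine hd.hasDerivAt.congr_deriv ?_
  have hp := Real.rpow_pos_of_pos (h.pos x) n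
  have e1 : φ x ^ (-n) * φ x ^ n = 1 := by
    rw [← Real.rpow_add (h.pos x), neg_add_cancel, Real.rpow_zero]
  have e2 : φ x ^ (1 - n) * φ x ^ n = φ x := by
    rw [← Real.rpow_add (h.pos x), sub_add_cancel, Real.rpow_one]
  have e3 : s * s⁻¹ = 1 := mul_inv_cancel₀ hs
  refine mul_left_cancel₀ (mul_ne_zero hs hp.ne') ?_
  rw [force]
  linear_combination hode - s * e2 + s * e1 + (φ x ^ n) * e3 - (s * s⁻¹) * e1 - e3

theorem contDiff_infty (h : IsSolitaryWave n m s φ) (hs : s ≠ 0) :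
    ContDiff ℝ ∞ φ ∧ ContDiff ℝ ∞ (psi m φ) := by
  have key : ∀ k : ℕ, ContDiff ℝ k φ ∧ ContDiff ℝ k (psi m φ) := by
    intro k
    induction k with
    | zero =>
      refine ⟨?_, ?_⟩ <;> simp only [Nat.cast_zero, contDiff_zero]
      · exact h.continuous
      · exact continuous_iff_continuousAt.2 fun x => (h.psi_hasDerivAt hs x).continuousAt
    | succ k ih =>
      have a1 : deriv φ = fun x => φ x ^ m * psi m φ x := funext h.deriv_eq
      have a2 : deriv (psi m φ) = fun x => force n s (φ x) :=
        funext fun x => (h.psi_hasDerivAt hs x).deriv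
      have hp : ∀ p : ℝ, ContDiff ℝ k fun x => φ x ^ p := fun p =>
        ih.1.rpow_const_of_ne fun x => (h.pos x).ne'
      refine ⟨?_, ?_⟩
      · rw [Nat.cast_succ, contDiff_succ_iff_deriv]
        refine ⟨fun x => (h.hasDerivAt x).differentiableAt, by simp, ?_⟩
        rw [a1]; exact (hp m).mul ih.2
      · rw [Nat.cast_succ, contDiff_succ_iff_deriv]
        refine ⟨fun x => (h.psi_hasDerivAt hs x).differentiableAt, by simp, ?_⟩
        rw [a2]
        exact (((hp (1 - n)).sub (hp (-n))).sub contDiff_const).add (contDiff_const.mul (hp (-n)))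
  exact ⟨_root_.contDiff_infty.2 fun k => (key k).1, _root_.contDiff_infty.2 fun k => (key k).2⟩

theorem psi_neg_arg (h : IsSolitaryWave n m s φ) (x : ℝ) : psi m φ (-x) = -psi m φ x := by
  have e : deriv φ (-x) = -deriv φ x := by
    have e1 : HasDerivAt (fun y => φ (-y)) (-deriv φ (-x)) x :=
      hasDerivAt_comp_neg_arg (h.contDiff.differentiable (by norm_num) (-x)).hasDerivAt
    have e2 : (fun y => φ (-y)) = φ := funext h.even
    rw [e2] at e1
    rw [e1.deriv, neg_neg]
  rw [psi, psi, h.even, e]; ring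

theorem psi_zero (h : IsSolitaryWave n m s φ) : psi m φ 0 = 0 := by
  have := h.psi_neg_arg 0
  rw [neg_zero] at this; linarith

theorem comp_hasDerivAt (h : IsSolitaryWave n m s φ) {F : ℝ → ℝ} {F' x : ℝ}
    (hF : HasDerivAt F F' (φ x)) : HasDerivAt (fun y => F (φ y)) (F' * (φ x ^ m * psi m φ x)) x :=
  HasDerivAt.comp x hF (h.hasDerivAt x)

theorem powInt_hasDerivAt (h : IsSolitaryWave n m s φ) (x : ℝ) :
    HasDerivAt (fun y => powInt (-m) (φ y)) (psi m φ x) x := by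
  refine (h.comp_hasDerivAt (hasDerivAt_powInt (-m) (h.pos x))).congr_deriv ?_
  rw [← mul_assoc, ← Real.rpow_add (h.pos x), neg_add_cancel, Real.rpow_zero, one_mul]

theorem tendsto_comp (h : IsSolitaryWave n m s φ) {F : ℝ → ℝ} (hF : ContinuousAt F 1) :
    Tendsto (fun x => F (φ x)) atTop (𝓝 (F 1)) := hF.tendsto.comp h.tendsto_atTop

theorem continuousAt_force (n s : ℝ) : ContinuousAt (force n s) 1 :=
  (hasDerivAt_force n s one_pos).continuousAt

/-- No decay of the derivative is assumed of a wave; interpolation between u → 0 and u'' = force(φ)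
→ 0 provides it. -/
theorem tendsto_psi (h : IsSolitaryWave n m s φ) (hs : s ≠ 0) :
    Tendsto (psi m φ) atTop (𝓝 0) := by
  have t1 := h.tendsto_comp (hasDerivAt_powInt (-m) one_pos).continuousAt
  have t2 := h.tendsto_comp (continuousAt_force n s)
  rw [powInt_one] at t1
  rw [force_one] at t2
  rw [Metric.tendsto_atTop] at t1 t2 ⊢
  intro ε hε
  obtain ⟨N1, h1⟩ := t1 (ε / 4) (by positivity)
  obtain ⟨N2, h2⟩ := t2 (ε / 4) (by positivity)
  refine ⟨max N1 N2, fun x hx => ?_⟩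
  have := abs_deriv_le_of_abs_le (A := ε / 4) (B := ε / 4) (x := x) h.powInt_hasDerivAt
    (h.psi_hasDerivAt hs)
    (fun t ht => by
      have := h1 t ((le_max_left _ _).trans (hx.le.trans ht.1))
      rw [Real.dist_eq, sub_zero] at this; exact this.le)
    (fun t ht => by
      have := h2 t ((le_max_right _ _).trans (hx.le.trans ht.1))
      rw [Real.dist_eq, sub_zero] at this; exact this.le)
  rw [Real.dist_eq, sub_zero]
  linarith

/-- Conservation of energy. -/
theorem psi_sq (h : IsSolitaryWave n m s φ) (hs : s ≠ 0) (x : ℝ) :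
    psi m φ x ^ 2 / 2 = potA n m (φ x) - s⁻¹ * potB n m (φ x) := by
  have hd : ∀ x, HasDerivAt
      (fun x => psi m φ x ^ 2 / 2 - (potA n m (φ x) - s⁻¹ * potB n m (φ x))) 0 x := by
    intro x
    have e1 := (((h.psi_hasDerivAt hs x).pow 2).div_const 2).sub
      ((h.comp_hasDerivAt (hasDerivAt_potA n m (h.pos x))).sub
        ((h.comp_hasDerivAt (hasDerivAt_potB n m (h.pos x))).const_mul s⁻¹))
    refine e1.congr_deriv ?_
    have e2 : φ x ^ (-n - m) * φ x ^ m = φ x ^ (-n) := by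
      rw [← Real.rpow_add (h.pos x)]; congr 1; ring
    have e3 : φ x ^ (-n) * φ x ^ n = 1 := by
      rw [← Real.rpow_add (h.pos x), neg_add_cancel, Real.rpow_zero]
    have e4 : φ x ^ (1 - n) = φ x ^ (-n) * φ x := by
      rw [show 1 - n = -n + 1 by ring, Real.rpow_add_one (h.pos x).ne']
    rw [force, e4]
    simp only [Nat.cast_ofNat, Nat.add_one_sub_one, pow_one]
    linear_combination (-psi m φ x * (φ x - 1 - s⁻¹ * (φ x ^ n - 1))) * e2 +
      psi m φ x * s⁻¹ * e3
  have hc : ∀ x, psi m φ x ^ 2 / 2 - (potA n m (φ x) - s⁻¹ * potB n m (φ x)) =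
      psi m φ 0 ^ 2 / 2 - (potA n m (φ 0) - s⁻¹ * potB n m (φ 0)) := fun x =>
    is_const_of_deriv_eq_zero (fun x => (hd x).differentiableAt) (fun x => (hd x).deriv) x 0
  have ht : Tendsto (fun x => psi m φ x ^ 2 / 2 - (potA n m (φ x) - s⁻¹ * potB n m (φ x)))
      atTop (𝓝 0) := by
    have t1 := (h.tendsto_psi hs).pow 2 |>.div_const 2
    have t2 := h.tendsto_comp (hasDerivAt_potA n m one_pos).continuousAt
    have t3 := h.tendsto_comp (hasDerivAt_potB n m one_pos).continuousAt
    rw [potA_one] at t2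
    rw [potB_one] at t3
    simpa using t1.sub (t2.sub (t3.const_mul s⁻¹))
  have := tendsto_nhds_unique (ht.congr hc) tendsto_const_nhds
  linarith [hc x]

/-- In this form the energy law shows that φ stays where the increasing function B/A is at most s,
and that ψ vanishes only where B/A equals s. -/
theorem psi_sq' (h : IsSolitaryWave n m s φ) (hs : 0 < s) (x : ℝ) :
    psi m φ x ^ 2 = 2 * potA n m (φ x) / s * (s - speedOf n m (φ x)) := by
  have := h.psi_sq hs.ne' x
  have hA := potA_pos n m (h.one_lt x)
  have e : speedOf n m (φ x) * potA n m (φ x) = potB n m (φ x) := div_mul_cancel₀ _ hA.ne'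
  rw [div_mul_eq_mul_div, eq_div_iff hs.ne']
  have e3 : s⁻¹ * s = 1 := inv_mul_cancel₀ hs.ne'
  linear_combination 2 * s * this - 2 * potB n m (φ x) * e3 + 2 * e

theorem speedOf_max (h : IsSolitaryWave n m s φ) (hs : 0 < s) : speedOf n m (φ 0) = s := by
  have := h.psi_sq' hs 0
  rw [h.psi_zero] at this
  have hA := potA_pos n m (h.one_lt 0)
  have h2 : 2 * potA n m (φ 0) / s ≠ 0 := by positivity
  have := (mul_eq_zero.1 (this.symm.trans (by norm_num))).resolve_left h2
  linarith

theorem le_max (h : IsSolitaryWave n m s φ) (hn : 1 < n) (hs : 0 < s) (x : ℝ) : φ x ≤ φ 0 := by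
  have hA := potA_pos n m (h.one_lt x)
  have h2 : 0 < 2 * potA n m (φ x) / s := by positivity
  have h3 : 0 ≤ s - speedOf n m (φ x) := by
    by_contra! hneg
    nlinarith [h.psi_sq' hs x, sq_nonneg (psi m φ x)]
  rw [← (strictMonoOn_speedOf m hn).le_iff_le (h.one_lt x) (h.one_lt 0), h.speedOf_max hs]
  linarith

theorem eq_max_of_psi_eq_zero (h : IsSolitaryWave n m s φ) (hn : 1 < n) (hs : 0 < s) {x : ℝ}
    (hx : psi m φ x = 0) : φ x = φ 0 := by
  have hA := potA_pos n m (h.one_lt x)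
  have h2 : 2 * potA n m (φ x) / s ≠ 0 := by positivity
  have := h.psi_sq' hs x
  rw [hx] at this
  have := (mul_eq_zero.1 (this.symm.trans (by norm_num))).resolve_left h2
  refine (strictMonoOn_speedOf m hn).injOn (h.one_lt x) (h.one_lt 0) ?_
  rw [h.speedOf_max hs]; linarith

theorem force_eq {n s t : ℝ} (ht : 0 < t) :
    force n s t = t ^ (-n) * (t - 1 - s⁻¹ * (t ^ n - 1)) := by
  have e3 : t ^ (-n) * t ^ n = 1 := by
    rw [← Real.rpow_add ht, neg_add_cancel, Real.rpow_zero]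
  have e4 : t ^ (1 - n) = t ^ (-n) * t := by
    rw [show 1 - n = -n + 1 by ring, Real.rpow_add_one ht.ne']
  rw [force, e4]
  linear_combination s⁻¹ * e3

/-- At the maximum B = sA, so `potB_lt` becomes s(φ(0) - 1) < φ(0)^n - 1. -/
theorem force_max_neg (h : IsSolitaryWave n m s φ) (hn : 1 < n) (hs : 0 < s) :
    force n s (φ 0) < 0 := by
  have h1 := potB_lt (m := m) hn (h.one_lt 0)
  have hA := potA_pos n m (h.one_lt 0)
  have e : speedOf n m (φ 0) * potA n m (φ 0) = potB n m (φ 0) := div_mul_cancel₀ _ hA.ne'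
  rw [h.speedOf_max hs] at e
  rw [← e] at h1
  have h2 : (φ 0 - 1) * s < φ 0 ^ n - 1 := by
    by_contra! h3
    nlinarith
  rw [force_eq (h.pos 0)]
  refine mul_neg_of_pos_of_neg (Real.rpow_pos_of_pos (h.pos 0) _) ?_
  have h4 : 0 < s⁻¹ := inv_pos.2 hs
  have e3 : s⁻¹ * s = 1 := inv_mul_cancel₀ hs.ne'
  have h5 := mul_lt_mul_of_pos_left h2 h4
  have h6 : s⁻¹ * ((φ 0 - 1) * s) = φ 0 - 1 := by linear_combination (φ 0 - 1) * e3
  linarith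

theorem force_ne_of_psi_eq_zero (h : IsSolitaryWave n m s φ) (hn : 1 < n) (hs : 0 < s) {x : ℝ}
    (hx : psi m φ x = 0) : force n s (φ x) ≠ 0 := by
  rw [h.eq_max_of_psi_eq_zero hn hs hx]
  exact (h.force_max_neg hn hs).ne

theorem psi_continuous (h : IsSolitaryWave n m s φ) (hs : s ≠ 0) : Continuous (psi m φ) :=
  continuous_iff_continuousAt.2 fun x => (h.psi_hasDerivAt hs x).continuousAt

/-- A second zero of ψ is again at the maximal height. The minimum over [0, x] is then either at an
end or critical, hence also of that height, so φ is constant on [0, x] and the force vanishes at the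
maximum. -/
theorem psi_ne_zero (h : IsSolitaryWave n m s φ) (hn : 1 < n) (hs : 0 < s) {x : ℝ} (hx : 0 < x) :
    psi m φ x ≠ 0 := by
  intro h0
  have e0 := h.eq_max_of_psi_eq_zero hn hs h0
  obtain ⟨y, hy, hmin⟩ := (isCompact_Icc (a := 0) (b := x)).exists_isMinOn
    ⟨0, le_refl 0, hx.le⟩ h.continuous.continuousOn
  have hy0 : φ y = φ 0 := by
    rcases hy.1.eq_or_lt with h1 | h1
    · rw [← h1]
    rcases hy.2.eq_or_lt with h2 | h2
    · rw [h2, e0]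
    have hloc : IsLocalMin φ y := hmin.isLocalMin (Icc_mem_nhds h1 h2)
    have := hloc.deriv_eq_zero
    exact h.eq_max_of_psi_eq_zero hn hs (by rw [psi, this, mul_zero])
  have hconst : ∀ z ∈ Set.Icc 0 x, φ z = φ 0 := fun z hz =>
    le_antisymm (h.le_max hn hs z) (hy0 ▸ hmin hz)
  have hz : ∀ z ∈ Set.Ioo 0 x, psi m φ z = 0 := fun z hz => by
    have : φ =ᶠ[𝓝 z] fun _ => φ 0 := by
      filter_upwards [Icc_mem_nhds hz.1 hz.2] with t ht using hconst t ht
    rw [psi, this.deriv_eq, deriv_const, mul_zero]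
  have hm : x / 2 ∈ Set.Ioo 0 x := ⟨by linarith, by linarith⟩
  have : psi m φ =ᶠ[𝓝 (x / 2)] fun _ => 0 := by
    filter_upwards [Ioo_mem_nhds hm.1 hm.2] with t ht using hz t ht
  have hd := (h.psi_hasDerivAt hs.ne' (x / 2)).deriv
  rw [this.deriv_eq, deriv_const] at hd
  exact h.force_ne_of_psi_eq_zero hn hs (hz _ hm) hd.symm

/-- ψ has constant sign on (0, ∞), and a positive sign would lift φ above its maximum. -/
theorem psi_neg (h : IsSolitaryWave n m s φ) (hn : 1 < n) (hs : 0 < s) {x : ℝ} (hx : 0 < x) :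
    psi m φ x < 0 := by
  by_contra! h0
  have h1 : 0 < psi m φ x := lt_of_le_of_ne h0 (h.psi_ne_zero hn hs hx).symm
  have hpos : ∀ y, 0 < y → 0 < psi m φ y := by
    intro y hy
    by_contra! h2
    obtain ⟨z, hz, hz0⟩ := (isPreconnected_Ioi (a := (0 : ℝ))).intermediate_value (Set.mem_Ioi.2 hy)
      (Set.mem_Ioi.2 hx) (h.psi_continuous hs.ne').continuousOn ⟨h2, h1.le⟩
    exact h.psi_ne_zero hn hs hz hz0
  have hmono : StrictMonoOn φ (Set.Ici 0) := by
    refine strictMonoOn_of_deriv_pos (convex_Ici 0) h.continuous.continuousOn fun y hy => ?_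
    rw [interior_Ici] at hy
    rw [h.deriv_eq]
    exact mul_pos (Real.rpow_pos_of_pos (h.pos y) _) (hpos y hy)
  have := hmono Set.self_mem_Ici hx.le hx
  exact absurd (h.le_max hn hs x) (not_le.2 this)

theorem antitoneOn (h : IsSolitaryWave n m s φ) (hn : 1 < n) (hs : 0 < s) :
    AntitoneOn φ (Set.Ici 0) := by
  refine antitoneOn_of_deriv_nonpos (convex_Ici 0) h.continuous.continuousOn
    (fun x _ => (h.hasDerivAt x).differentiableAt.differentiableWithinAt) fun y hy => ?_
  rw [interior_Ici] at hy
  rw [h.deriv_eq]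
  exact mul_nonpos_of_nonneg_of_nonpos (Real.rpow_pos_of_pos (h.pos y) _).le
    (h.psi_neg hn hs hy).le

end IsSolitaryWave

/-! ### Exponential decay of the wave and the coefficients of the linearization -/

theorem gammaOf_pos {n c : ℝ} (hn : 0 < n) (hc : n < c) : 0 < gammaOf n c :=
  Real.sqrt_pos.2 (div_pos (by linarith) (by linarith))

theorem gammaOf_sq {n c : ℝ} (hn : 0 < n) (hc : n < c) : gammaOf n c ^ 2 = 1 - n * c⁻¹ := by
  have h0 : c ≠ 0 := by linarith
  rw [gammaOf, Real.sq_sqrt (div_nonneg (by linarith) (by linarith))]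
  field_simp

theorem dforce_one (n s : ℝ) : dforce n s 1 = 1 - n * s⁻¹ := by simp [dforce]

/-- In the variable `powInt (-m)` the slope of the force at amplitude 1 is 1 - n/c. By joint
continuity in speed and amplitude it stays above κ nearby, uniformly for speeds near c. -/
theorem exists_force_monotone {n m c κ : ℝ} (hc : c ≠ 0) (hκ : κ < 1 - n * c⁻¹) :
    ∃ ε, 0 < ε ∧ ∀ᶠ s in 𝓝 c, ∀ t ∈ Set.Icc 1 (1 + ε), ∀ u ∈ Set.Icc 1 (1 + ε), u ≤ t →
      κ * (powInt (-m) t - powInt (-m) u) ≤ force n s t - force n s u := by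
  have hcont : ContinuousAt (fun p : ℝ × ℝ => dforce n p.1 p.2 - κ * p.2 ^ (-m)) (c, 1) := by
    have h1 : ∀ p : ℝ, ContinuousAt (fun x : ℝ × ℝ => x.2 ^ p) (c, 1) := fun p =>
      continuousAt_snd.rpow_const (Or.inl one_ne_zero)
    have h2 : ContinuousAt (fun x : ℝ × ℝ => x.1⁻¹) (c, 1) := continuousAt_fst.inv₀ hc
    unfold dforce
    exact (((h1 _).const_mul _).add ((continuousAt_const.sub (h2.const_mul _)).mul (h1 _))).sub
      ((h1 _).const_mul _)
  have hpos : ∀ᶠ p : ℝ × ℝ in 𝓝 (c, 1), 0 < dforce n p.1 p.2 - κ * p.2 ^ (-m) := by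
    refine continuousAt_const.eventually_lt hcont ?_
    simp only [dforce_one, Real.one_rpow]; linarith
  rw [nhds_prod_eq, eventually_prod_iff] at hpos
  obtain ⟨pa, ha, pb, hb, hab⟩ := hpos
  obtain ⟨ε, hε, hball⟩ := Metric.nhds_basis_closedBall.eventually_iff.1 hb
  refine ⟨ε, hε, ha.mono fun s hs t ht u hu hut => ?_⟩
  obtain ⟨ξ, hξ, e, -⟩ := exists_eq_slope_of_one_le
    (f := fun t => force n s t - κ * powInt (-m) t) (f' := fun t => dforce n s t - κ * t ^ (-m))
    (fun t ht => (hasDerivAt_force n s ht).sub ((hasDerivAt_powInt (-m) ht).const_mul κ)) ht hu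
  have hξ1 : ξ ∈ Metric.closedBall (1 : ℝ) ε := by
    rw [Metric.mem_closedBall, Real.dist_eq, abs_of_nonneg (by linarith [hξ.1])]
    linarith [hξ.2]
  have := hab hs (hball hξ1)
  have h2 := mul_nonneg this.le (sub_nonneg.2 hut)
  simp only at e h2
  linarith

theorem abs_dforce_le {n s t : ℝ} (hn : 1 < n) (hs : n < s) (ht : 1 ≤ t) :
    |dforce n s t| ≤ 2 * n := by
  have h1 : ∀ p : ℝ, p ≤ 0 → t ^ p ≤ 1 ∧ 0 < t ^ p := fun p hp =>
    ⟨Real.rpow_le_one_of_one_le_of_nonpos ht hp, Real.rpow_pos_of_pos (by linarith) p⟩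
  have a1 := h1 (-n) (by linarith)
  have a2 := h1 (-n - 1) (by linarith)
  have hs1 : s⁻¹ ≤ 1 := inv_le_one_of_one_le₀ (by linarith)
  have hs0 : 0 < s⁻¹ := inv_pos.2 (by linarith)
  have hns : n * s⁻¹ ≤ n := mul_le_of_le_one_right (by linarith) hs1
  have hns0 : 0 ≤ n * s⁻¹ := mul_nonneg (by linarith) hs0.le
  rw [dforce, abs_le]
  constructor <;> nlinarith

theorem abs_force_le {n s t : ℝ} (hn : 1 < n) (hs : n < s) (ht : 1 ≤ t) :
    |force n s t| ≤ 2 * n * (t - 1) := by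
  obtain ⟨ξ, hξ, e, -⟩ := exists_eq_slope_of_one_le (fun t ht => hasDerivAt_force n s ht)
    (H := t) (t := t) (u := 1) ⟨ht, le_rfl⟩ ⟨le_rfl, ht⟩
  rw [force_one, sub_zero] at e
  rw [e, abs_mul, abs_of_nonneg (sub_nonneg.2 ht)]
  exact mul_le_mul_of_nonneg_right (abs_dforce_le hn hs hξ.1) (sub_nonneg.2 ht)

theorem dec_zero (w : ℝ → ℝ) : Dec w fun _ => 0 := by
  intro k
  induction k with
  | zero => exact ⟨contDiff_const, 0, fun x => by simp⟩
  | succ k ih => exact ⟨⟨contDiff_const, 0, fun x => by simp⟩, by simpa using ih⟩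

namespace IsSolitaryWave

variable {n m s : ℝ} {φ : ℝ → ℝ}

theorem abs_arg (h : IsSolitaryWave n m s φ) (x : ℝ) : φ |x| = φ x := by
  rcases abs_choice x with e | e <;> rw [e]
  exact h.even x

theorem abs_psi_abs_arg (h : IsSolitaryWave n m s φ) (x : ℝ) : |psi m φ (|x|)| = |psi m φ x| := by
  rcases abs_choice x with e | e <;> rw [e]
  rw [h.psi_neg_arg, abs_neg]

/-- Beyond X the wave stays below 1 + ε by monotonicity, so u'' = force(φ) ≥ κu and the barrier
applies. Evenness and the maximum of u cover the rest. -/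
theorem powInt_le (h : IsSolitaryWave n m s φ) (hn : 1 < n) (hs : n < s) {b κ ε X : ℝ} (hb : 0 < b)
    (hbκ : b ^ 2 < κ) (hX : 0 ≤ X) (hφX : φ X ≤ 1 + ε)
    (hκ : ∀ t ∈ Set.Icc 1 (1 + ε), κ * powInt (-m) t ≤ force n s t) (x : ℝ) :
    powInt (-m) (φ x) ≤ powInt (-m) (φ 0) * Real.exp (b * X) * expW b x := by
  have hs0 : 0 < s := by linarith
  have hmax : ∀ x, powInt (-m) (φ x) ≤ powInt (-m) (φ 0) := fun x =>
    (strictMonoOn_powInt (-m)).monotoneOn (h.one_lt x).le (h.one_lt 0).le (h.le_max hn hs0 x)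
  have h0 := powInt_pos (-m) (h.one_lt 0)
  have far := le_exp_of_barrier (κ₁ := fun _ => 0) (κ₂ := fun _ => κ) (δ := 0) (B := 0) (X := X)
    (κ := κ) h.powInt_hasDerivAt (h.psi_hasDerivAt hs0.ne') hb (fun x hx => by
      have := hκ (φ x) ⟨(h.one_lt x).le, (h.antitoneOn hn hs0 hX (hX.trans hx) hx).trans hφX⟩
      simpa using this) (fun _ _ => by simp) (fun _ _ _ => le_rfl) (by simpa using hbκ)
    (fun x _ => hmax x) (C := powInt (-m) (φ 0) * Real.exp (b * X)) (by positivity) le_rfl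
    (mul_nonneg (by linarith) (by positivity))
  rw [← h.abs_arg]
  rcases le_total X |x| with hx | hx
  · exact far _ hx
  · refine (hmax _).trans ?_
    rw [mul_assoc, expW, ← Real.exp_add]
    exact le_mul_of_one_le_right h0.le (Real.one_le_exp (by nlinarith))

/-- Exponential decay, with constants that only depend on a bound of the amplitude and on the
place beyond which the wave is small. -/
theorem uniform_decay (n m : ℝ) (hn : 1 < n) {b κ ε X H : ℝ} (hb : 0 < b) (hbκ : b ^ 2 < κ)
    (hX : 0 ≤ X) : ∃ C, 0 ≤ C ∧ ∀ s φ, IsSolitaryWave n m s φ → n < s → φ 0 ≤ H → φ X ≤ 1 + ε →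
      (∀ t ∈ Set.Icc 1 (1 + ε), κ * powInt (-m) t ≤ force n s t) →
      ∀ x, powInt (-m) (φ x) ≤ C * expW b x ∧ φ x - 1 ≤ C * expW b x ∧
        |force n s (φ x)| ≤ C * expW b x ∧ |psi m φ x| ≤ C * expW b x := by
  obtain ⟨D, hD, hDb⟩ := exists_powInt_bounds (-m) H
  set C₀ := |powInt (-m) H| * Real.exp (b * X) with hC₀
  have hC₀0 : 0 ≤ C₀ := by positivity
  set C₁ := 2 * n * (D * C₀) with hC₁
  have hC₁0 : 0 ≤ C₁ := by positivity
  have key : ∀ s φ, IsSolitaryWave n m s φ → n < s → φ 0 ≤ H → φ X ≤ 1 + ε →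
      (∀ t ∈ Set.Icc 1 (1 + ε), κ * powInt (-m) t ≤ force n s t) →
      ∀ x, powInt (-m) (φ x) ≤ C₀ * expW b x ∧ φ x - 1 ≤ D * C₀ * expW b x ∧
        |force n s (φ x)| ≤ C₁ * expW b x := by
    intro s φ h hs hH hφX hκ x
    have hs0 : 0 < s := by linarith
    have hxH : φ x ∈ Set.Icc 1 H := ⟨(h.one_lt x).le, (h.le_max hn hs0 x).trans hH⟩
    have e1 : powInt (-m) (φ x) ≤ C₀ * expW b x := by
      refine (h.powInt_le hn hs hb hbκ hX hφX hκ x).trans ?_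
      refine mul_le_mul_of_nonneg_right (mul_le_mul_of_nonneg_right ?_ (Real.exp_pos _).le)
        (expW_pos _ _).le
      refine le_trans ?_ (le_abs_self _)
      exact (strictMonoOn_powInt (-m)).monotoneOn (h.one_lt 0).le ((h.one_lt 0).le.trans hH) hH
    have e2 : φ x - 1 ≤ D * C₀ * expW b x := by
      have := (hDb (φ x) hxH 1 ⟨le_rfl, hxH.1.trans hxH.2⟩).1
      rw [powInt_one, sub_zero, abs_of_pos (powInt_pos _ (h.one_lt x)),
        abs_of_pos (sub_pos.2 (h.one_lt x))] at this
      refine this.trans ?_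
      rw [mul_assoc]
      exact mul_le_mul_of_nonneg_left e1 hD.le
    refine ⟨e1, e2, (abs_force_le hn hs (h.one_lt x).le).trans ?_⟩
    rw [hC₁, mul_assoc (2 * n)]
    exact mul_le_mul_of_nonneg_left e2 (by linarith)
  set C₂ := (1 * (2 * C₀) + C₁) * Real.exp b with hC₂
  have hC₂0 : 0 ≤ C₂ := by positivity
  refine ⟨C₀ + D * C₀ + C₁ + C₂, by positivity, fun s φ h hs hH hφX hκ x => ?_⟩
  have hs0 : 0 < s := by linarith
  have k := key s φ h hs hH hφX hκ
  have hψ := abs_flux_le_weight (w := expW b) (A := C₀) (B := C₁) (P := 1)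
    (K := Real.exp b) (ρ := fun _ => 1) (fun x => by simpa using h.powInt_hasDerivAt x)
    (h.psi_hasDerivAt hs0.ne') (fun x => by simp) zero_le_one hC₀0 hC₁0
    (fun x => by rw [abs_of_pos (powInt_pos _ (h.one_lt x))]; exact (k x).1)
    (fun x => (k x).2.2) (expW_shift hb.le) x
  have hw := (expW_pos b x).le
  have hDC : 0 ≤ D * C₀ := by positivity
  refine ⟨(k x).1.trans ?_, (k x).2.1.trans ?_, (k x).2.2.trans ?_, hψ.trans ?_⟩ <;>
    refine mul_le_mul_of_nonneg_right ?_ hw <;> linarith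

variable {c : ℝ}

theorem exists_decay (h : IsSolitaryWave n m c φ) (hn : 1 < n) (hc : n < c) :
    ∃ C, 0 ≤ C ∧ ∀ x, φ x - 1 ≤ C * expW (gammaOf n c / 2) x ∧
      |force n c (φ x)| ≤ C * expW (gammaOf n c / 2) x ∧
      |psi m φ x| ≤ C * expW (gammaOf n c / 2) x := by
  have hγ := gammaOf_pos (by linarith : 0 < n) hc
  have hγ2 := gammaOf_sq (by linarith : 0 < n) hc
  obtain ⟨ε, hε, hmono⟩ := exists_force_monotone (m := m) (n := n) (c := c)
    (κ := gammaOf n c ^ 2 / 2) (by linarith) (by nlinarith)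
  have hm := hmono.self_of_nhds
  obtain ⟨X, hX, hφX⟩ := ((eventually_ge_atTop (0 : ℝ)).and
    (h.tendsto_atTop.eventually_le_const (by linarith : (1 : ℝ) < 1 + ε))).exists
  obtain ⟨C, hC0, hC⟩ := uniform_decay n m hn (b := gammaOf n c / 2) (κ := gammaOf n c ^ 2 / 2)
    (ε := ε) (X := X) (H := φ 0) (by linarith) (by nlinarith) hX
  refine ⟨C, hC0, fun x => (hC c φ h hc le_rfl hφX (fun t ht => ?_) x).2⟩
  have := hm t ht 1 ⟨le_rfl, by linarith⟩ ht.1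
  simpa [powInt_one, force_one] using this

/-- The algebra generated by the real powers of φ and by ψ is closed under differentiation, so
bounds on the generators bound all derivatives. -/
theorem dec_wOne (h : IsSolitaryWave n m c φ) (hn : 1 < n) (hc : n < c) :
    (∀ p : ℝ, Dec wOne fun x => φ x ^ p) ∧ Dec wOne (psi m φ) := by
  have hc0 : 0 < c := by linarith
  obtain ⟨sφ, sψ⟩ := h.contDiff_infty hc0.ne'
  have sp : ∀ p : ℝ, ContDiff ℝ ∞ fun x => φ x ^ p := fun p =>
    sφ.rpow_const_of_ne fun x => (h.pos x).ne'
  have bp : ∀ p : ℝ, ∃ C, ∀ x, |φ x ^ p| ≤ C * wOne x := fun p => by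
    obtain ⟨C, -, hC⟩ := exists_rpow_bounds p (φ 0)
    refine ⟨C, fun x => ?_⟩
    rw [abs_of_pos (Real.rpow_pos_of_pos (h.pos x) p), wOne, mul_one]
    exact (hC _ ⟨(h.one_lt x).le, h.le_max hn hc0 x⟩).2
  have bψ : ∃ C, ∀ x, |psi m φ x| ≤ C * wOne x := by
    obtain ⟨C, hC0, hC⟩ := h.exists_decay hn hc
    refine ⟨C, fun x => (hC x).2.2.trans (mul_le_mul_of_nonneg_left ?_ hC0)⟩
    rw [expW, wOne, Real.exp_le_one_iff]
    have := mul_nonneg (gammaOf_pos (by linarith : 0 < n) hc).le (abs_nonneg x)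
    linarith
  have key : ∀ k, (∀ p : ℝ, DecN wOne k fun x => φ x ^ p) ∧ DecN wOne k (psi m φ) := by
    intro k
    induction k with
    | zero => exact ⟨fun p => ⟨sp p, bp p⟩, sψ, bψ⟩
    | succ k ih =>
      refine ⟨fun p => ⟨⟨sp p, bp p⟩, ?_⟩, ⟨sψ, bψ⟩, ?_⟩
      · have e : deriv (fun x => φ x ^ p) = fun x => p * (φ x ^ (p - 1 + m) * psi m φ x) := by
          ext x
          rw [(h.rpow_hasDerivAt p x).deriv, h.deriv_eq, Real.rpow_add (h.pos x)]
          ring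
        rw [e]
        have := (decN_const p k).mul ((ih.1 (p - 1 + m)).mul ih.2)
        simp only [wOne, one_mul] at this
        exact this
      · have e : deriv (psi m φ) = fun x => (φ x ^ (1 - n) + (-1) * φ x ^ (-n)) +
            (-c⁻¹ + c⁻¹ * φ x ^ (-n)) := by
          ext x
          rw [(h.psi_hasDerivAt hc0.ne' x).deriv, force]
          ring
        rw [e]
        have hm : ∀ (a p : ℝ), DecN wOne k fun x => a * φ x ^ p := fun a p => by
          have := (decN_const a k).mul (ih.1 p)
          simp only [wOne, one_mul] at this
          exact this
        exact ((ih.1 _).add (hm _ _)).add ((decN_const _ k).add (hm _ _))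
  exact ⟨fun p k => (key k).1 p, fun k => (key k).2⟩

/-- The potential of the linearized equation for the momentum. -/
def pot (n m c : ℝ) (φ : ℝ → ℝ) (x : ℝ) : ℝ := φ x ^ m * dforce n c (φ x)

theorem dec_pot (h : IsSolitaryWave n m c φ) (hn : 1 < n) (hc : n < c) :
    Dec wOne (pot n m c φ) := by
  have hp := (h.dec_wOne hn hc).1
  exact (hp m).one_mul (((hp _).const_mul _).add ((hp _).const_mul _))

theorem force_hasDerivAt (h : IsSolitaryWave n m c φ) (x : ℝ) :
    HasDerivAt (fun x => force n c (φ x)) (pot n m c φ x * psi m φ x) x :=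
  (h.comp_hasDerivAt (hasDerivAt_force n c (h.pos x))).congr_deriv (by rw [pot]; ring)

theorem deriv_psi (h : IsSolitaryWave n m c φ) (hc : c ≠ 0) :
    deriv (psi m φ) = fun x => force n c (φ x) := funext fun x => (h.psi_hasDerivAt hc x).deriv

theorem deriv_deriv_psi (h : IsSolitaryWave n m c φ) (hc : c ≠ 0) (x : ℝ) :
    deriv (deriv (psi m φ)) x = pot n m c φ x * psi m φ x := by
  rw [h.deriv_psi hc, (h.force_hasDerivAt x).deriv]

theorem dec_psi (h : IsSolitaryWave n m c φ) (hn : 1 < n) (hc : n < c) :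
    Dec (expW (gammaOf n c / 2)) (psi m φ) := by
  have hc0 : c ≠ 0 := by linarith
  obtain ⟨C, hC0, hC⟩ := h.exists_decay hn hc
  refine dec_of_ode (p := fun _ => 0) (h.contDiff_infty hc0).2 ⟨C, fun x => (hC x).2.2⟩
    ⟨C, fun x => ?_⟩ (dec_const 0) (h.dec_pot hn hc) (dec_zero _) fun x => ?_
  · rw [h.deriv_psi hc0]; exact (hC x).2.1
  · rw [h.deriv_deriv_psi hc0]; ring

/-- The three quantities tend to γ², 0 and 1; the thresholds lie strictly on the correct side, as γ²
< 1. -/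
theorem exists_far (h : IsSolitaryWave n m c φ) (hn : 1 < n) (hc : n < c) :
    ∃ X, 0 ≤ X ∧ ∀ x, X ≤ |x| → gammaOf n c ^ 2 / 2 ≤ pot n m c φ x ∧
      |φ x ^ (-n) * (n * φ x ^ (n - 1) * (φ x ^ m * psi m φ x))| ≤ gammaOf n c / 4 ∧
      gammaOf n c ^ 2 / 2 ≤ φ x ^ (-n) * φ x ^ m := by
  have hγ := gammaOf_pos (by linarith : 0 < n) hc
  have hγ2 := gammaOf_sq (by linarith : 0 < n) hc
  have hc0 : 0 < c := by linarith
  have hp : ∀ p : ℝ, Tendsto (fun x => φ x ^ p) atTop (𝓝 1) := fun p => by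
    simpa using h.tendsto_comp (Real.continuousAt_rpow_const 1 p (Or.inl one_ne_zero))
  have t1 : Tendsto (pot n m c φ) atTop (𝓝 (1 - n * c⁻¹)) := by
    have := (hp m).mul (((hp (-n)).const_mul (1 - n)).add ((hp (-n - 1)).const_mul (n - n * c⁻¹)))
    refine this.trans (le_of_eq ?_)
    congr 1; ring
  have t2 : Tendsto (fun x => |φ x ^ (-n) * (n * φ x ^ (n - 1) * (φ x ^ m * psi m φ x))|) atTop
      (𝓝 0) := by
    have := ((hp (-n)).mul (((hp (n - 1)).const_mul n).mul
      ((hp m).mul (h.tendsto_psi hc0.ne')))).abs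
    simpa using this
  have t3 : Tendsto (fun x => φ x ^ (-n) * φ x ^ m) atTop (𝓝 1) := by
    simpa using (hp (-n)).mul (hp m)
  have hlt1 : gammaOf n c ^ 2 / 2 < 1 := by
    have : 0 < n * c⁻¹ := mul_pos (by linarith) (inv_pos.2 hc0)
    linarith
  obtain ⟨X, hX⟩ := eventually_atTop.1 ((t1.eventually_const_le
    (by nlinarith : gammaOf n c ^ 2 / 2 < 1 - n * c⁻¹)).and
    ((t2.eventually_le_const (by linarith : 0 < gammaOf n c / 4)).and
      (t3.eventually_const_le hlt1)))
  refine ⟨max X 0, le_max_right _ _, fun x hx => ?_⟩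
  have := hX |x| ((le_max_left _ _).trans hx)
  rw [pot, h.abs_arg] at this
  refine ⟨this.1, ?_, this.2.2⟩
  have h2 := this.2.1
  simp only [abs_mul, h.abs_psi_abs_arg] at h2 ⊢
  exact h2

/-- The coefficients of the operator linearized at a solitary wave. -/
def coeffs (h : IsSolitaryWave n m c φ) (hn : 1 < n) (hc : n < c) : Coeffs where
  c := c
  -- With δ = γ/4 and κ = γ²/2 one has b² + δb = 3γ²/8 < κ, while b still exceeds the bound γ/3 on
  -- the weight a.
  b := gammaOf n c / 2
  X := (h.exists_far hn hc).choose
  δ := gammaOf n c / 4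
  κ := gammaOf n c ^ 2 / 2
  r := fun x => φ x ^ n
  ri := fun x => φ x ^ (-n)
  σ := fun x => φ x ^ (-m)
  σi := fun x => φ x ^ m
  q := pot n m c φ
  ψ := psi m φ
  c_pos := by linarith
  b_pos := half_pos (gammaOf_pos (by linarith) hc)
  X_nonneg := (h.exists_far hn hc).choose_spec.1
  δ_nonneg := by have := gammaOf_pos (by linarith : 0 < n) hc; linarith
  dec_r := (h.dec_wOne hn hc).1 n
  dec_ri := (h.dec_wOne hn hc).1 (-n)
  dec_σ := (h.dec_wOne hn hc).1 (-m)
  dec_σi := (h.dec_wOne hn hc).1 m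
  dec_q := h.dec_pot hn hc
  dec_ψ := h.dec_psi hn hc
  r_pos := fun x => Real.rpow_pos_of_pos (h.pos x) n
  σ_pos := fun x => Real.rpow_pos_of_pos (h.pos x) (-m)
  ri_mul := fun x => by rw [← Real.rpow_add (h.pos x), neg_add_cancel, Real.rpow_zero]
  σi_mul := fun x => by rw [← Real.rpow_add (h.pos x), add_neg_cancel, Real.rpow_zero]
  ψ_ode := h.deriv_deriv_psi (by linarith)
  ψ_ne := fun x => by
    rw [h.deriv_psi (by linarith)]
    by_cases h0 : psi m φ x = 0
    · have := h.force_ne_of_psi_eq_zero hn (by linarith) h0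
      positivity
    · positivity
  q_far := fun x hx => ((h.exists_far hn hc).choose_spec.2 x hx).1
  drift_far := fun x hx => by
    have := ((h.exists_far hn hc).choose_spec.2 x hx).2.1
    rw [(h.rpow_hasDerivAt n x).deriv, h.deriv_eq]
    exact this
  pot_far := fun x hx => ((h.exists_far hn hc).choose_spec.2 x hx).2.2
  rate := by
    have := gammaOf_pos (by linarith : 0 < n) hc
    nlinarith

theorem adjM_eq (h : IsSolitaryWave n m c φ) (hn : 1 < n) (hc : n < c) (χ : ℝ → ℝ) :
    adjM n m φ χ = (h.coeffs hn hc).M χ := rfl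

/-- The zeroth order coefficient c - nφ⁻¹ + cn(φ⁻¹ - 1) equals cφ^n force'(φ), which is the term
cσqr of the abstract operator. -/
theorem adjL_eq (h : IsSolitaryWave n m c φ) (hn : 1 < n) (hc : n < c) (θ : ℝ → ℝ) :
    adjL n m c φ θ = (h.coeffs hn hc).L θ := by
  ext x
  change _ = -c * φ x ^ (-m) * deriv (deriv fun y => φ y ^ n * θ y) x +
    c * φ x ^ (-m) * (φ x ^ m * dforce n c (φ x)) * φ x ^ n * θ x
  have e1 := (h.coeffs hn hc).σi_mul x
  change φ x ^ m * φ x ^ (-m) = 1 at e1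
  have e2 : φ x ^ (-n) * φ x ^ n = 1 := (h.coeffs hn hc).ri_mul x
  have e3 : φ x ^ (-n - 1) * φ x ^ n = (φ x)⁻¹ := by
    rw [← Real.rpow_add (h.pos x), ← Real.rpow_neg_one]; congr 1; ring
  have e4 : c * c⁻¹ = 1 := mul_inv_cancel₀ (by linarith)
  rw [adjL, dforce]
  linear_combination (-c * ((1 - n) * φ x ^ (-n) + (n - n * c⁻¹) * φ x ^ (-n - 1)) *
    φ x ^ n * θ x) * e1 - c * (1 - n) * θ x * e2 - c * (n - n * c⁻¹) * θ x * e3 +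
    n * (φ x)⁻¹ * θ x * e4

end IsSolitaryWave

/-! ### Differentiable dependence of the wave on its speed -/

/-- Taylor's formula of order one with respect to the variable `powInt (-m)`. -/
theorem exists_taylor {F F' G' : ℝ → ℝ} {m H : ℝ} (hF : ∀ t, 0 < t → HasDerivAt F (F' t) t)
    (hG : ∀ t, 0 < t → HasDerivAt (fun t => F' t * t ^ m) (G' t) t)
    (hG' : ContinuousOn G' (Set.Icc 1 H)) :
    ∃ C, 0 ≤ C ∧ ∀ t ∈ Set.Icc 1 H, ∀ u ∈ Set.Icc 1 H,
      |F t - F u - F' u * u ^ m * (powInt (-m) t - powInt (-m) u)| ≤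
        C * (powInt (-m) t - powInt (-m) u) ^ 2 := by
  obtain ⟨B, hB⟩ := isCompact_Icc.exists_bound_of_continuousOn hG'
  obtain ⟨D, hD, hDb⟩ := exists_powInt_bounds (-m) H
  obtain ⟨E, hE, hEb⟩ := exists_rpow_bounds (-m) H
  refine ⟨E * |B| * D ^ 2, by positivity, fun t ht u hu => ?_⟩
  -- Since dF/du = F' t^m in the new variable, the mean value theorem is applied to the remainder
  -- and once more to F' t^m; each application contributes one factor t - u.
  obtain ⟨ξ, hξ, e, hξu⟩ := exists_eq_slope_of_one_le
    (fun t ht => (hF t ht).sub ((hasDerivAt_powInt (-m) ht).const_mul (F' u * u ^ m))) ht hu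
  obtain ⟨ζ, hζ, e2, -⟩ := exists_eq_slope_of_one_le hG hξ hu
  have hξ0 : 0 < ξ := by linarith [hξ.1]
  have e3 : ξ ^ m * ξ ^ (-m) = 1 := by
    rw [← Real.rpow_add hξ0, add_neg_cancel, Real.rpow_zero]
  have e4 : F t - F u - F' u * u ^ m * (powInt (-m) t - powInt (-m) u) =
      ξ ^ (-m) * (G' ζ * (ξ - u)) * (t - u) := by
    simp only [Pi.sub_apply] at e
    rw [← e2]
    linear_combination e - F' ξ * (t - u) * e3
  have h1 : |ξ ^ (-m)| ≤ E := by
    rw [abs_of_pos (Real.rpow_pos_of_pos hξ0 _)]; exact (hEb ξ hξ).2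
  have h2 : |G' ζ| ≤ |B| := (hB ζ hζ).trans (le_abs_self B)
  have h3 := (hDb t ht u hu).1
  rw [e4, abs_mul, abs_mul, abs_mul, ← sq_abs (powInt (-m) t - powInt (-m) u)]
  calc |ξ ^ (-m)| * (|G' ζ| * |ξ - u|) * |t - u| ≤ E * (|B| * |t - u|) * |t - u| := by gcongr
    _ = E * |B| * |t - u| ^ 2 := by ring
    _ ≤ E * |B| * (D * |powInt (-m) t - powInt (-m) u|) ^ 2 := by gcongr
    _ = _ := by ring

theorem exists_taylor_force (n m c H : ℝ) : ∃ C, 0 ≤ C ∧ ∀ t ∈ Set.Icc 1 H, ∀ u ∈ Set.Icc 1 H,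
    |force n c t - force n c u - dforce n c u * u ^ m * (powInt (-m) t - powInt (-m) u)| ≤
      C * (powInt (-m) t - powInt (-m) u) ^ 2 := by
  have h : ∀ (p : ℝ) {t : ℝ}, 0 < t → HasDerivAt (fun t : ℝ => t ^ p) (p * t ^ (p - 1)) t :=
    fun p t ht => Real.hasDerivAt_rpow_const (Or.inl ht.ne')
  have hc : ∀ p : ℝ, ContinuousOn (fun t : ℝ => t ^ p) (Set.Icc 1 H) := fun p t ht =>
    (h p (by linarith [ht.1])).continuousAt.continuousWithinAt
  refine exists_taylor (fun t ht => hasDerivAt_force n c ht)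
    (fun t ht => (((h (-n) ht).const_mul (1 - n)).add
      ((h (-n - 1) ht).const_mul (n - n * c⁻¹))).mul (h m ht)) ?_
  have hd : ContinuousOn (dforce n c) (Set.Icc 1 H) :=
    ((hc _).const_mul _).add ((hc _).const_mul _)
  exact ((((((hc _).const_mul _).const_mul _).add (((hc _).const_mul _).const_mul _))).mul
    (hc _)).add (hd.mul ((hc _).const_mul _))

theorem exists_taylor_id (m H : ℝ) : ∃ C, 0 ≤ C ∧ ∀ t ∈ Set.Icc 1 H, ∀ u ∈ Set.Icc 1 H,
    |t - u - u ^ m * (powInt (-m) t - powInt (-m) u)| ≤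
      C * (powInt (-m) t - powInt (-m) u) ^ 2 := by
  have h : ∀ (p : ℝ) {t : ℝ}, 0 < t → HasDerivAt (fun t : ℝ => t ^ p) (p * t ^ (p - 1)) t :=
    fun p t ht => Real.hasDerivAt_rpow_const (Or.inl ht.ne')
  have hc : ContinuousOn (fun t : ℝ => m * t ^ (m - 1)) (Set.Icc 1 H) := fun t ht =>
    ((h (m - 1) (by linarith [ht.1])).continuousAt.const_mul m).continuousWithinAt
  have := exists_taylor (F := fun t => t) (F' := fun _ => 1) (m := m) (H := H)
    (fun t _ => hasDerivAt_id t) (fun t ht => by simpa using h m ht) hc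
  simpa using this

namespace IsSolitaryWave

variable {n m c s : ℝ} {f g : ℝ → ℝ}

theorem abs_inv_sub_inv_le {s c : ℝ} (hs : 1 < s) (hc : 1 < c) : |s⁻¹ - c⁻¹| ≤ |s - c| := by
  have h1 : s⁻¹ - c⁻¹ = -(s - c) * (s * c)⁻¹ := by field_simp; ring
  have h2 : (s * c)⁻¹ ≤ 1 := inv_le_one_of_one_le₀ (by nlinarith)
  rw [h1, abs_mul, abs_neg, abs_of_pos (by positivity : 0 < (s * c)⁻¹)]
  exact mul_le_of_le_one_right (abs_nonneg _) h2

theorem one_sub_rpow_mem {n t : ℝ} (hn : 1 < n) (ht : 1 < t) : |1 - t ^ (-n)| ≤ 1 := by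
  have h1 : t ^ (-n) ≤ 1 := Real.rpow_le_one_of_one_le_of_nonpos ht.le (by linarith)
  have h2 : 0 < t ^ (-n) := Real.rpow_pos_of_pos (by linarith) _
  rw [abs_le]; constructor <;> linarith

/-- Lipschitz dependence of the wave on its speed on bounded intervals. -/
theorem exists_gronwall (h : IsSolitaryWave n m c f) (hn : 1 < n) (hc : n < c) (H X : ℝ)
    (hfH : f 0 ≤ H) : ∃ C, 0 ≤ C ∧ ∀ s g, IsSolitaryWave n m s g → n < s → g 0 ≤ H →
      ∀ x ∈ Set.Icc 0 X,
        |powInt (-m) (g x) - powInt (-m) (f x)| ≤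
          C * (|powInt (-m) (g 0) - powInt (-m) (f 0)| + |s - c|) := by
  obtain ⟨D, hD, hDb⟩ := exists_powInt_bounds (-m) H
  refine ⟨Real.exp ((2 * n * D + 1) * X), (Real.exp_pos _).le, fun s g k hs hgH x hx => ?_⟩
  have hc0 : 0 < c := by linarith
  have hs0 : 0 < s := by linarith
  have := gronwall_second_order (X := X) (K := 2 * n * D) (ε := |s - c|)
    (ε₀ := |powInt (-m) (g 0) - powInt (-m) (f 0)|)
    (fun x => (k.powInt_hasDerivAt x).sub (h.powInt_hasDerivAt x))
    (fun x => (k.psi_hasDerivAt hs0.ne' x).sub (h.psi_hasDerivAt hc0.ne' x))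
    (by positivity) (abs_nonneg _) (fun x _ => ?_) (by simp) (by simp [k.psi_zero, h.psi_zero])
    x hx
  · rw [mul_comm]; exact this.1
  · have hfx : f x ∈ Set.Icc 1 H := ⟨(h.one_lt x).le, (h.le_max hn hc0 x).trans hfH⟩
    have hgx : g x ∈ Set.Icc 1 H := ⟨(k.one_lt x).le, (k.le_max hn hs0 x).trans hgH⟩
    obtain ⟨ξ, hξ, e, -⟩ := exists_eq_slope_of_one_le (fun t ht => hasDerivAt_force n c ht) hgx hfx
    have e1 : |force n c (g x) - force n c (f x)| ≤
        2 * n * D * |powInt (-m) (g x) - powInt (-m) (f x)| := by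
      rw [e, abs_mul, mul_assoc]
      exact mul_le_mul (abs_dforce_le hn hc hξ.1) (hDb _ hgx _ hfx).1 (abs_nonneg _) (by linarith)
    have e2 : |(s⁻¹ - c⁻¹) * (1 - g x ^ (-n))| ≤ |s - c| := by
      rw [abs_mul]
      exact (mul_le_of_le_one_right (abs_nonneg _) (one_sub_rpow_mem hn (k.one_lt x))).trans
        (abs_inv_sub_inv_le (by linarith) (by linarith))
    rw [force_sub n s c]
    calc |force n c (g x) - (s⁻¹ - c⁻¹) * (1 - g x ^ (-n)) - force n c (f x)| =
        |(force n c (g x) - force n c (f x)) - (s⁻¹ - c⁻¹) * (1 - g x ^ (-n))| := by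
          congr 1; ring
      _ ≤ _ := (abs_sub _ _).trans (add_le_add e1 e2)

/-- Second order comparison with the solution of the linearized equation. -/
theorem exists_gronwall_linearized (h : IsSolitaryWave n m c f) (hn : 1 < n) (hc : n < c) (H X : ℝ)
    (hfH : f 0 ≤ H) {v v₁ : ℝ → ℝ} (hv : ∀ x, HasDerivAt v (v₁ x) x)
    (hv₁ : ∀ x, HasDerivAt v₁ (pot n m c f x * v x + (1 - f x ^ (-n)) * (c ^ 2)⁻¹) x)
    (hv0 : v₁ 0 = 0) : ∃ C, 0 ≤ C ∧ ∀ s g, IsSolitaryWave n m s g → n < s → g 0 ≤ H →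
      ∀ x ∈ Set.Icc 0 X,
        |powInt (-m) (g x) - powInt (-m) (f x) - (s - c) * v x| ≤
          C * (|powInt (-m) (g 0) - powInt (-m) (f 0) - (s - c) * v 0| +
            (|powInt (-m) (g 0) - powInt (-m) (f 0)| + |s - c|) ^ 2) ∧
        |psi m g x - psi m f x - (s - c) * v₁ x| ≤
          C * (|powInt (-m) (g 0) - powInt (-m) (f 0) - (s - c) * v 0| +
            (|powInt (-m) (g 0) - powInt (-m) (f 0)| + |s - c|) ^ 2) := by
  obtain ⟨D, hD, hDb⟩ := exists_powInt_bounds (-m) H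
  obtain ⟨C₁, hC₁, hG⟩ := h.exists_gronwall hn hc H X hfH
  obtain ⟨C₂, hC₂, hT⟩ := exists_taylor_force n m c H
  obtain ⟨Q, hQ0, hQ⟩ := exists_nonneg_bound (w := wOne) (fun x => zero_le_one)
    (h.dec_pot hn hc).bound
  simp only [wOne, mul_one] at hQ
  -- The three quadratic errors: Taylor remainder of the force, second order part of s⁻¹ at c, and
  -- the change of the factor 1 - φ^(-n) between the two waves.
  set A := C₂ * C₁ ^ 2 + 1 + n * D * C₁ with hA
  have hA0 : 0 ≤ A := by positivity
  refine ⟨Real.exp ((Q + 1) * X) * (1 + A), by positivity, fun s g k hs hgH x hx => ?_⟩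
  have hc0 : 0 < c := by linarith
  have hs0 : 0 < s := by linarith
  set δ₀ := |powInt (-m) (g 0) - powInt (-m) (f 0)| + |s - c| with hδ₀
  set e₀ := |powInt (-m) (g 0) - powInt (-m) (f 0) - (s - c) * v 0| with he₀
  have hδ₀0 : 0 ≤ δ₀ := by positivity
  have he₀0 : 0 ≤ e₀ := abs_nonneg _
  have key := gronwall_second_order (X := X) (K := Q) (ε := A * δ₀ ^ 2) (ε₀ := e₀)
    (fun x => ((k.powInt_hasDerivAt x).sub (h.powInt_hasDerivAt x)).sub
      ((hv x).const_mul (s - c)))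
    (fun x => ((k.psi_hasDerivAt hs0.ne' x).sub (h.psi_hasDerivAt hc0.ne' x)).sub
      ((hv₁ x).const_mul (s - c)))
    hQ0 (by positivity) (fun x hx => ?_) (by simp [he₀])
    (by simp [k.psi_zero, h.psi_zero, hv0]) x hx
  · have hle : (e₀ + A * δ₀ ^ 2) * Real.exp ((Q + 1) * X) ≤
        Real.exp ((Q + 1) * X) * (1 + A) * (e₀ + δ₀ ^ 2) := by
      have h1 : e₀ + A * δ₀ ^ 2 ≤ (1 + A) * (e₀ + δ₀ ^ 2) := by
        have := mul_nonneg hA0 he₀0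
        have := sq_nonneg δ₀
        linarith
      calc _ = Real.exp ((Q + 1) * X) * (e₀ + A * δ₀ ^ 2) := by ring
        _ ≤ Real.exp ((Q + 1) * X) * ((1 + A) * (e₀ + δ₀ ^ 2)) :=
          mul_le_mul_of_nonneg_left h1 (Real.exp_pos _).le
        _ = _ := by ring
    exact ⟨key.1.trans hle, key.2.trans hle⟩
  · have hfx : f x ∈ Set.Icc 1 H := ⟨(h.one_lt x).le, (h.le_max hn hc0 x).trans hfH⟩
    have hgx : g x ∈ Set.Icc 1 H := ⟨(k.one_lt x).le, (k.le_max hn hs0 x).trans hgH⟩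
    set d := powInt (-m) (g x) - powInt (-m) (f x) with hd
    have hdx : |d| ≤ C₁ * δ₀ := hG s g k hs hgH x hx
    have t1 : |force n c (g x) - force n c (f x) - pot n m c f x * d| ≤ C₂ * C₁ ^ 2 * δ₀ ^ 2 := by
      rw [pot, mul_comm (f x ^ m)]
      refine (hT _ hgx _ hfx).trans ?_
      rw [mul_assoc, ← mul_pow, ← hd, ← sq_abs]
      exact mul_le_mul_of_nonneg_left (pow_le_pow_left₀ (abs_nonneg _) hdx 2) hC₂
    have t2 : |pot n m c f x * (d - (s - c) * v x)| ≤ Q * |d - (s - c) * v x| := by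
      rw [abs_mul]; exact mul_le_mul_of_nonneg_right (hQ x) (abs_nonneg _)
    have hsδ : |s - c| ≤ δ₀ := by rw [hδ₀]; linarith [abs_nonneg (powInt (-m) (g 0) - powInt (-m) (f 0))]
    have t3 : |(s - c) ^ 2 * (c ^ 2 * s)⁻¹ * (1 - f x ^ (-n))| ≤ δ₀ ^ 2 := by
      have i1 : (c ^ 2 * s)⁻¹ ≤ 1 := inv_le_one_of_one_le₀ (by
        have : 1 ≤ c ^ 2 := one_le_pow₀ (by linarith)
        nlinarith)
      rw [abs_mul, abs_mul, abs_of_pos (by positivity : 0 < (c ^ 2 * s)⁻¹), abs_pow]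
      refine (mul_le_of_le_one_right (by positivity) (one_sub_rpow_mem hn (h.one_lt x))).trans ?_
      refine (mul_le_of_le_one_right (by positivity) i1).trans ?_
      exact pow_le_pow_left₀ (abs_nonneg _) hsδ 2
    have t4 : |(s⁻¹ - c⁻¹) * (f x ^ (-n) - g x ^ (-n))| ≤ n * D * C₁ * δ₀ ^ 2 := by
      obtain ⟨ξ, hξ, e, -⟩ := exists_eq_slope_of_one_le (f := fun t => t ^ (-n))
        (f' := fun t => -n * t ^ (-n - 1))
        (fun t ht => Real.hasDerivAt_rpow_const (Or.inl ht.ne')) hgx hfx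
      have hξ0 : 0 < ξ := by linarith [hξ.1]
      have i1 : |f x ^ (-n) - g x ^ (-n)| ≤ n * D * (C₁ * δ₀) := by
        rw [abs_sub_comm, e, abs_mul, abs_mul, abs_neg, abs_of_pos (by linarith : 0 < n),
          abs_of_pos (Real.rpow_pos_of_pos hξ0 _), mul_assoc, mul_assoc]
        refine mul_le_mul_of_nonneg_left ?_ (by linarith)
        refine (mul_le_of_le_one_left (abs_nonneg _)
          (Real.rpow_le_one_of_one_le_of_nonpos hξ.1 (by linarith))).trans ?_
        exact (hDb _ hgx _ hfx).1.trans (mul_le_mul_of_nonneg_left hdx hD.le)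
      rw [abs_mul]
      calc _ ≤ δ₀ * (n * D * (C₁ * δ₀)) :=
            mul_le_mul ((abs_inv_sub_inv_le (by linarith) (by linarith)).trans hsδ) i1
              (abs_nonneg _) hδ₀0
        _ = _ := by ring
    have e5 : s⁻¹ - c⁻¹ + (s - c) * (c ^ 2)⁻¹ = (s - c) ^ 2 * (c ^ 2 * s)⁻¹ := by
      field_simp; ring
    have e6 : force n s (g x) - force n c (f x) -
        (s - c) * (pot n m c f x * v x + (1 - f x ^ (-n)) * (c ^ 2)⁻¹) =
        (force n c (g x) - force n c (f x) - pot n m c f x * d) +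
        pot n m c f x * (d - (s - c) * v x) -
        (s - c) ^ 2 * (c ^ 2 * s)⁻¹ * (1 - f x ^ (-n)) -
        (s⁻¹ - c⁻¹) * (f x ^ (-n) - g x ^ (-n)) := by
      rw [← e5, force_sub n s c]; ring
    rw [e6]
    have := (abs_sub _ _).trans (add_le_add ((abs_sub _ _).trans (add_le_add
      ((abs_add_le _ _).trans (add_le_add t1 t2)) t3)) t4)
    refine this.trans (le_of_eq ?_)
    simp only [Pi.sub_apply]
    rw [hA]; ring

/-- Lipschitz dependence of the wave on its speed near infinity. -/
theorem abs_sub_le_far (h : IsSolitaryWave n m c f) (k : IsSolitaryWave n m s g) (hn : 1 < n)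
    (hc : n < c) (hs : n < s) {κ ε X : ℝ} (hκ0 : 0 < κ) (hX : 0 ≤ X) (hfX : f X ≤ 1 + ε)
    (hgX : g X ≤ 1 + ε)
    (hκ : ∀ t ∈ Set.Icc 1 (1 + ε), ∀ u ∈ Set.Icc 1 (1 + ε), u ≤ t →
      κ * (powInt (-m) t - powInt (-m) u) ≤ force n c t - force n c u) {K : ℝ} (hK0 : 0 < K)
    (hK : |powInt (-m) (g X) - powInt (-m) (f X)| ≤ K) (hKs : |s - c| < κ * K) :
    ∀ x, X ≤ x → |powInt (-m) (g x) - powInt (-m) (f x)| ≤ K := by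
  have hc0 : 0 < c := by linarith
  have hs0 : 0 < s := by linarith
  have d1 : ∀ x, HasDerivAt (fun x => powInt (-m) (g x) - powInt (-m) (f x))
      (psi m g x - psi m f x) x := fun x => (k.powInt_hasDerivAt x).sub (h.powInt_hasDerivAt x)
  have d2 : ∀ x, HasDerivAt (fun x => psi m g x - psi m f x)
      (force n s (g x) - force n c (f x)) x := fun x =>
    (k.psi_hasDerivAt hs0.ne' x).sub (h.psi_hasDerivAt hc0.ne' x)
  have ht : Tendsto (fun x => powInt (-m) (g x) - powInt (-m) (f x)) atTop (𝓝 0) := by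
    have hP := (hasDerivAt_powInt (-m) one_pos).continuousAt
    simpa using (k.tendsto_comp hP).sub (h.tendsto_comp hP)
  have hf : ∀ x, X ≤ x → f x ∈ Set.Icc 1 (1 + ε) := fun x hx =>
    ⟨(h.one_lt x).le, (h.antitoneOn hn hc0 hX (hX.trans hx) hx).trans hfX⟩
  have hg : ∀ x, X ≤ x → g x ∈ Set.Icc 1 (1 + ε) := fun x hx =>
    ⟨(k.one_lt x).le, (k.antitoneOn hn hs0 hX (hX.trans hx) hx).trans hgX⟩
  have hmono : ∀ {t u : ℝ}, 1 < t → 1 < u → powInt (-m) u < powInt (-m) t → u ≤ t :=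
    fun ht hu hlt => ((strictMonoOn_powInt (-m)).lt_iff_lt hu.le ht.le).1 hlt |>.le
  have hE : ∀ x, |(s⁻¹ - c⁻¹) * (1 - g x ^ (-n))| ≤ |s - c| := fun x => by
    rw [abs_mul]
    exact (mul_le_of_le_one_right (abs_nonneg _) (one_sub_rpow_mem hn (k.one_lt x))).trans
      (abs_inv_sub_inv_le (by linarith) (by linarith))
  -- Where the difference d of the u-variables exceeds K, d'' ≥ κd - |s - c| > κK - |s - c| > 0, so
  -- an interior maximum above K is impossible.
  have up := nonpos_of_max_principle (X := X) (fun x => (d1 x).sub_const K) d2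
    (by linarith [le_abs_self (powInt (-m) (g X) - powInt (-m) (f X))])
    (by filter_upwards [ht.eventually_lt_const hK0] with x hx; linarith) fun x hx hpos _ => by
      have := hκ _ (hg x hx.le) _ (hf x hx.le) (hmono (k.one_lt x) (h.one_lt x) (by linarith))
      have h3 := mul_lt_mul_of_pos_left (sub_pos.1 hpos) hκ0
      have h4 := (abs_le.1 (hE x)).2
      rw [force_sub n s c]; linarith
  have dn := nonpos_of_max_principle (X := X)
    (fun x => (d1 x).fun_neg.sub_const K) (fun x => (d2 x).fun_neg)
    (by linarith [neg_abs_le (powInt (-m) (g X) - powInt (-m) (f X))])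
    (by filter_upwards [ht.eventually_const_lt (neg_lt_zero.2 hK0)] with x hx; linarith)
    fun x hx hpos _ => by
      have := hκ _ (hf x hx.le) _ (hg x hx.le) (hmono (h.one_lt x) (k.one_lt x) (by linarith))
      have h3 := mul_lt_mul_of_pos_left (sub_pos.1 hpos) hκ0
      have h4 := (abs_le.1 (hE x)).1
      rw [force_sub n s c]; linarith
  intro x hx
  rw [abs_le]
  constructor
  · linarith [dn x hx]
  · linarith [up x hx]

/-- Differentiability of the amplitude with respect to the speed. -/
theorem exists_hasDerivAt_max {φ : ℝ → ℝ → ℝ} (hn : 1 < n) (hc : n < c)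
    (hφ : ∀ᶠ s in 𝓝 c, IsSolitaryWave n m s (φ s)) :
    ∃ d, HasDerivAt (fun s => φ s 0) d c := by
  have h := hφ.self_of_nhds
  have hpos : ∀ᶠ s in 𝓝 c, 0 < s := lt_mem_nhds (by linarith)
  have hS : ∀ᶠ s in 𝓝 c, speedOf n m (φ s 0) = s := by
    filter_upwards [hφ, hpos] with s hs h0 using hs.speedOf_max h0
  have hmono := strictMonoOn_speedOf m hn
  obtain ⟨d, hd0, hd⟩ := exists_hasDerivAt_speedOf m hn (h.one_lt 0)
  -- The amplitude is a one-sided inverse of the speed function. Its continuity at c, still to be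
  -- shown, follows from strict monotonicity of that function.
  refine ⟨d⁻¹, HasDerivAt.of_local_left_inverse ?_ hd hd0.ne' hS⟩
  have hSc : speedOf n m (φ c 0) = c := hS.self_of_nhds
  refine tendsto_order.2 ⟨fun l hl => ?_, fun u hu => ?_⟩
  · rcases le_or_gt l 1 with h1 | h1
    · filter_upwards [hφ] with s hs using lt_of_le_of_lt h1 (hs.one_lt 0)
    · have hlt : speedOf n m l < c := by
        have := hmono h1 (h.one_lt 0) hl
        rwa [hSc] at this
      filter_upwards [hφ, hS, lt_mem_nhds hlt] with s h1' h2 h3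
      rw [← h2] at h3
      exact (hmono.lt_iff_lt h1 (h1'.one_lt 0)).1 h3
  · have hu1 : 1 < u := (h.one_lt 0).trans hu
    have hlt : c < speedOf n m u := by
      have := hmono (h.one_lt 0) hu1 hu
      rwa [hSc] at this
    filter_upwards [hφ, hS, gt_mem_nhds hlt] with s h1' h2 h3
    rw [← h2] at h3
    exact (hmono.lt_iff_lt (h1'.one_lt 0) hu1).1 h3

end IsSolitaryWave

namespace IsSolitaryWave

open Asymptotics

variable {n m c : ℝ} {φ : ℝ → ℝ → ℝ}

/-- Pointwise differentiability of the wave with respect to its speed. -/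
theorem hasDerivAt_speed_of_nonneg (hn : 1 < n) (hc : n < c)
    (hφ : ∀ᶠ s in 𝓝 c, IsSolitaryWave n m s (φ s)) {v v₁ : ℝ → ℝ} (hv : ∀ x, HasDerivAt v (v₁ x) x)
    (hv₁ : ∀ x, HasDerivAt v₁ (pot n m c (φ c) x * v x + (1 - φ c x ^ (-n)) * (c ^ 2)⁻¹) x)
    (hv0 : HasDerivAt (fun s => powInt (-m) (φ s 0)) (v 0) c) (hv10 : v₁ 0 = 0) {x : ℝ}
    (hx : 0 ≤ x) : HasDerivAt (fun s => powInt (-m) (φ s x)) (v x) c ∧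
      HasDerivAt (fun s => psi m (φ s) x) (v₁ x) c := by
  have h := hφ.self_of_nhds
  obtain ⟨d, hd⟩ := exists_hasDerivAt_max hn hc hφ
  have hH : ∀ᶠ s in 𝓝 c, φ s 0 ≤ φ c 0 + 1 :=
    hd.continuousAt.eventually_le_const (by simp)
  obtain ⟨C, hC0, hC⟩ := h.exists_gronwall_linearized hn hc (φ c 0 + 1) x (by linarith) hv hv₁ hv10
  have hO : (fun s => |powInt (-m) (φ s 0) - powInt (-m) (φ c 0)| + |s - c|) =O[𝓝 c]
      fun s => s - c := by
    refine IsBigO.add ?_ ?_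
    · exact (isBigO_abs_left).2 hv0.differentiableAt.isBigO_sub
    · exact (isBigO_abs_left).2 (isBigO_refl _ _)
  -- Differentiability of the amplitude makes the initial deviation O(s - c), so the quadratic error
  -- of the comparison is o(s - c).
  have hsq : (fun s => (|powInt (-m) (φ s 0) - powInt (-m) (φ c 0)| + |s - c|) ^ 2) =o[𝓝 c]
      fun s => s - c := by
    refine (hO.pow 2).trans_isLittleO ?_
    have : Tendsto (fun s => s - c) (𝓝 c) (𝓝 0) := by
      have : ContinuousAt (fun s => s - c) c := by fun_prop
      simpa [ContinuousAt] using this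
    exact (isLittleO_pow_id one_lt_two).comp_tendsto this
  have hlin : (fun s => |powInt (-m) (φ s 0) - powInt (-m) (φ c 0) - (s - c) * v 0|) =o[𝓝 c]
      fun s => s - c := isLittleO_abs_left.2 (by simpa using hv0.isLittleO)
  have htot := (hlin.add hsq).const_mul_left C
  have hev : ∀ᶠ s in 𝓝 c, n < s := lt_mem_nhds hc
  constructor
  · refine HasDerivAt.of_isLittleO (IsBigO.trans_isLittleO (IsBigO.of_bound 1 ?_) htot)
    filter_upwards [hφ, hev, hH] with s h1 h2 h3
    have := (hC s (φ s) h1 h2 h3 x ⟨hx, le_rfl⟩).1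
    rw [one_mul, smul_eq_mul, Real.norm_eq_abs]
    exact this.trans (le_abs_self _)
  · refine HasDerivAt.of_isLittleO (IsBigO.trans_isLittleO (IsBigO.of_bound 1 ?_) htot)
    filter_upwards [hφ, hev, hH] with s h1 h2 h3
    have := (hC s (φ s) h1 h2 h3 x ⟨hx, le_rfl⟩).2
    rw [one_mul, smul_eq_mul, Real.norm_eq_abs]
    exact this.trans (le_abs_self _)

/-- Taylor's formula expresses φ through u with a quadratic remainder, so differentiability
transfers back without inverting the change of variable. -/
theorem hasDerivAt_of_powInt (hφ : ∀ᶠ s in 𝓝 c, IsSolitaryWave n m s (φ s)) {H : ℝ}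
    (hH : ∀ᶠ s in 𝓝 c, ∀ x, φ s x ≤ H) {v x : ℝ}
    (hv : HasDerivAt (fun s => powInt (-m) (φ s x)) v c) :
    HasDerivAt (fun s => φ s x) (φ c x ^ m * v) c := by
  obtain ⟨C, hC0, hC⟩ := exists_taylor_id m H
  have hc := hφ.self_of_nhds
  have hHc := hH.self_of_nhds x
  have h1 : (fun s => φ s x - φ c x - φ c x ^ m * (powInt (-m) (φ s x) - powInt (-m) (φ c x)))
      =o[𝓝 c] fun s => s - c := by
    have hO := hv.differentiableAt.isBigO_sub
    have hsq : (fun s => (powInt (-m) (φ s x) - powInt (-m) (φ c x)) ^ 2) =o[𝓝 c]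
        fun s => s - c := by
      refine (hO.pow 2).trans_isLittleO ?_
      have : Tendsto (fun s => s - c) (𝓝 c) (𝓝 0) := by
        have : ContinuousAt (fun s => s - c) c := by fun_prop
        simpa [ContinuousAt] using this
      exact (isLittleO_pow_id one_lt_two).comp_tendsto this
    refine IsBigO.trans_isLittleO (IsBigO.of_bound C ?_) hsq
    filter_upwards [hφ, hH] with s hs hHs
    have := hC (φ s x) ⟨(hs.one_lt x).le, hHs x⟩ (φ c x) ⟨(hc.one_lt x).le, hHc⟩
    rwa [Real.norm_eq_abs, Real.norm_eq_abs, 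
      abs_of_nonneg (sq_nonneg (powInt (-m) (φ s x) - powInt (-m) (φ c x)))]
  have h2 := (hv.isLittleO).const_mul_left (φ c x ^ m)
  refine HasDerivAt.of_isLittleO ((h1.add h2).congr_left fun s => ?_)
  simp only [smul_eq_mul]; ring

theorem forcing_dec {f : ℝ → ℝ} (h : IsSolitaryWave n m c f) (hn : 1 < n) (hc : n < c) :
    Dec (expW (gammaOf n c / 2)) fun x => 1 - f x ^ (-n) := by
  have hp := h.dec_wOne hn hc
  have hd : ∀ x, HasDerivAt (fun x => 1 - f x ^ (-n))
      (n * (f x ^ (-n - 1) * (f x ^ m * psi m f x))) x := fun x => by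
    refine ((h.rpow_hasDerivAt (-n) x).const_sub 1).congr_deriv ?_
    rw [h.deriv_eq]; ring
  obtain ⟨C, hC0, hC⟩ := h.exists_decay hn hc
  refine Dec.of_deriv (contDiff_const.sub (hp.1 (-n)).contDiff) ⟨n * C, fun x => ?_⟩ ?_
  · obtain ⟨ξ, hξ, e, -⟩ := exists_eq_slope_of_one_le (f := fun t => t ^ (-n))
      (f' := fun t => -n * t ^ (-n - 1)) (fun t ht => Real.hasDerivAt_rpow_const (Or.inl ht.ne'))
      (H := f x) ⟨(h.one_lt x).le, le_rfl⟩ ⟨le_rfl, (h.one_lt x).le⟩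
    have hξ0 : 0 < ξ := by linarith [hξ.1]
    simp only [Real.one_rpow] at e
    rw [abs_sub_comm, e, abs_mul, abs_mul, abs_neg, abs_of_pos (by linarith : 0 < n),
      abs_of_pos (Real.rpow_pos_of_pos hξ0 _), abs_of_pos (sub_pos.2 (h.one_lt x)), mul_assoc,
      mul_assoc]
    refine mul_le_mul_of_nonneg_left ((mul_le_of_le_one_left (sub_nonneg.2 (h.one_lt x).le)
      (Real.rpow_le_one_of_one_le_of_nonpos hξ.1 (by linarith))).trans (hC x).1) (by linarith)
  · rw [show deriv (fun x => 1 - f x ^ (-n)) = _ from funext fun x => (hd x).deriv]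
    exact ((hp.1 _).one_mul ((hp.1 m).one_mul (h.dec_psi hn hc))).const_mul n

/-- Uniform Lipschitz dependence on the speed, and uniform decay. -/
theorem exists_uniform_bounds (hn : 1 < n) (hc : n < c)
    (hφ : ∀ᶠ s in 𝓝 c, IsSolitaryWave n m s (φ s))
    (hcont : ∀ x, 0 ≤ x → ContinuousAt (fun s => powInt (-m) (φ s x)) c)
    {d : ℝ} (hd : HasDerivAt (fun s => powInt (-m) (φ s 0)) d c) :
    ∃ C, 0 ≤ C ∧ ∀ᶠ s in 𝓝 c, ∀ x,
      |powInt (-m) (φ s x) - powInt (-m) (φ c x)| ≤ C * |s - c| ∧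
      |φ s x - φ c x| ≤ C * |s - c| ∧ |psi m (φ s) x - psi m (φ c) x| ≤ C * |s - c| ∧
      φ s x - 1 ≤ C * expW (gammaOf n c / 2) x ∧
      |psi m (φ s) x| ≤ C * expW (gammaOf n c / 2) x := by
  have h := hφ.self_of_nhds
  have hγ := gammaOf_pos (by linarith : 0 < n) hc
  have hγ2 := gammaOf_sq (by linarith : 0 < n) hc
  set κ := gammaOf n c ^ 2 / 2 with hκ
  have hκ0 : 0 < κ := by positivity
  obtain ⟨ε, hε, hmono⟩ := exists_force_monotone (m := m) (n := n) (c := c)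
    (κ := κ) (by linarith) (by nlinarith)
  obtain ⟨X, hX, hφX⟩ := ((eventually_ge_atTop (0 : ℝ)).and
    (h.tendsto_atTop.eventually_lt_const (by linarith : (1 : ℝ) < 1 + ε))).exists
  obtain ⟨D₀, hD₀⟩ := exists_hasDerivAt_max hn hc hφ
  set H := φ c 0 + 1 with hHdef
  have hH : ∀ᶠ s in 𝓝 c, φ s 0 ≤ H := hD₀.continuousAt.eventually_le_const (by simp [hHdef])
  have hns : ∀ᶠ s in 𝓝 c, n < s := lt_mem_nhds hc
  have hsX : ∀ᶠ s in 𝓝 c, φ s X ≤ 1 + ε := by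
    have h1 : powInt (-m) (φ c X) < powInt (-m) (1 + ε) :=
      strictMonoOn_powInt (-m) (h.one_lt X).le (Set.mem_Ici.2 (by linarith)) hφX
    filter_upwards [(hcont X hX).eventually_lt_const h1, hφ] with s hs h2
    exact ((strictMonoOn_powInt (-m)).lt_iff_lt (h2.one_lt X).le
      (Set.mem_Ici.2 (by linarith))).1 hs |>.le
  obtain ⟨C₁, hC₁, hU⟩ := uniform_decay n m hn (b := gammaOf n c / 2) (κ := κ)
    (ε := ε) (X := X) (H := H) (by linarith) (by nlinarith) hX
  obtain ⟨C₂, hC₂, hG⟩ := h.exists_gronwall hn hc H X (by simp [hHdef])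
  obtain ⟨D, hD, hDb⟩ := exists_powInt_bounds (-m) H
  obtain ⟨E, hE0, hE⟩ := hd.differentiableAt.isBigO_sub.exists_pos
  rw [IsBigOWith] at hE
  -- The first summand is the Gronwall bound on [0, X] with E the Lipschitz constant of the
  -- amplitude; the second ensures |s - c| < κK|s - c| for the maximum principle beyond X.
  set K := C₂ * (E + 1) + 2 * κ⁻¹ with hK
  have hκi : 0 < κ⁻¹ := inv_pos.2 hκ0
  have hK0 : 0 < K := by positivity
  set B := 2 * n * D * K + 1 with hB
  have hB0 : 0 ≤ B := by positivity
  refine ⟨K + D * K + (2 * K + B) + C₁, by positivity, ?_⟩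
  filter_upwards [hφ, hns, hH, hsX, hmono, hE] with s k hs hsH hsX' hsm hsE
  have hc0 : 0 < c := by linarith
  have hs0 : 0 < s := by linarith
  have dec := hU s (φ s) k hs hsH hsX' fun t ht => by
    have := hsm t ht 1 ⟨le_rfl, by linarith⟩ ht.1
    simpa [powInt_one, force_one] using this
  have hfx : ∀ x, φ c x ∈ Set.Icc 1 H := fun x =>
    ⟨(h.one_lt x).le, (h.le_max hn hc0 x).trans (by simp [hHdef])⟩
  have hgx : ∀ x, φ s x ∈ Set.Icc 1 H := fun x => ⟨(k.one_lt x).le, (k.le_max hn hs0 x).trans hsH⟩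
  have near : ∀ x ∈ Set.Icc 0 X, |powInt (-m) (φ s x) - powInt (-m) (φ c x)| ≤ K * |s - c| := by
    intro x hx
    refine (hG s (φ s) k hs hsH x hx).trans ?_
    have : |powInt (-m) (φ s 0) - powInt (-m) (φ c 0)| ≤ E * |s - c| := hsE
    calc _ ≤ C₂ * (E * |s - c| + |s - c|) := by gcongr
      _ = C₂ * (E + 1) * |s - c| := by ring
      _ ≤ _ := mul_le_mul_of_nonneg_right (by linarith) (abs_nonneg _)
  have pos : ∀ x, 0 ≤ x → |powInt (-m) (φ s x) - powInt (-m) (φ c x)| ≤ K * |s - c| := by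
    intro x hx
    rcases le_total x X with hxX | hxX
    · exact near x ⟨hx, hxX⟩
    · rcases eq_or_ne s c with rfl | hsc
      · simp
      · have hsc' : 0 < |s - c| := abs_pos.2 (sub_ne_zero.2 hsc)
        refine h.abs_sub_le_far k hn hc hs hκ0 hX hφX.le hsX' hmono.self_of_nhds
          (mul_pos hK0 hsc') (near X ⟨hX, le_rfl⟩) ?_ x hxX
        have e : κ * κ⁻¹ = 1 := mul_inv_cancel₀ hκ0.ne'
        have e1 : κ * (K * |s - c|) = κ * (C₂ * (E + 1)) * |s - c| + 2 * |s - c| := by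
          rw [hK]; linear_combination 2 * |s - c| * e
        rw [e1]
        have : 0 ≤ κ * (C₂ * (E + 1)) * |s - c| := by positivity
        linarith
  have all : ∀ x, |powInt (-m) (φ s x) - powInt (-m) (φ c x)| ≤ K * |s - c| := fun x => by
    rw [← k.abs_arg, ← h.abs_arg x]; exact pos _ (abs_nonneg x)
  have all2 : ∀ x, |φ s x - φ c x| ≤ D * K * |s - c| := fun x =>
    (hDb _ (hgx x) _ (hfx x)).1.trans (by
      rw [mul_assoc]; exact mul_le_mul_of_nonneg_left (all x) hD.le)
  have all3 : ∀ x, |force n s (φ s x) - force n c (φ c x)| ≤ B * |s - c| := fun x => by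
    obtain ⟨ξ, hξ, e, -⟩ := exists_eq_slope_of_one_le (fun t ht => hasDerivAt_force n c ht)
      (hgx x) (hfx x)
    have e1 : |force n c (φ s x) - force n c (φ c x)| ≤ 2 * n * D * K * |s - c| := by
      rw [e, abs_mul, mul_assoc (2 * n) D K, mul_assoc (2 * n)]
      exact mul_le_mul (abs_dforce_le hn hc hξ.1) (all2 x) (abs_nonneg _) (by linarith)
    have e2 : |(s⁻¹ - c⁻¹) * (1 - φ s x ^ (-n))| ≤ |s - c| := by
      rw [abs_mul]
      exact (mul_le_of_le_one_right (abs_nonneg _) (one_sub_rpow_mem hn (k.one_lt x))).trans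
        (abs_inv_sub_inv_le (by linarith) (by linarith))
    rw [force_sub n s c, hB, add_mul, one_mul,
      show force n c (φ s x) - (s⁻¹ - c⁻¹) * (1 - φ s x ^ (-n)) - force n c (φ c x) =
        (force n c (φ s x) - force n c (φ c x)) - (s⁻¹ - c⁻¹) * (1 - φ s x ^ (-n)) by ring]
    exact (abs_sub _ _).trans (add_le_add e1 e2)
  intro x
  have all4 := abs_deriv_le_of_abs_le (x := x)
    (fun x => (k.powInt_hasDerivAt x).sub (h.powInt_hasDerivAt x))
    (fun x => (k.psi_hasDerivAt hs0.ne' x).sub (h.psi_hasDerivAt hc0.ne' x))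
    (fun t _ => all t) (fun t _ => all3 t)
  have hsc := abs_nonneg (s - c)
  have hw := (expW_pos (gammaOf n c / 2) x).le
  have hDK : 0 ≤ D * K := by positivity
  refine ⟨(all x).trans ?_, (all2 x).trans ?_, all4.trans ?_, (dec x).2.1.trans ?_,
    (dec x).2.2.2.trans ?_⟩
  · exact mul_le_mul_of_nonneg_right (by linarith) hsc
  · exact mul_le_mul_of_nonneg_right (by linarith) hsc
  · calc 2 * (K * |s - c|) + B * |s - c| = (2 * K + B) * |s - c| := by ring
      _ ≤ _ := mul_le_mul_of_nonneg_right (by linarith) hsc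
  · exact mul_le_mul_of_nonneg_right (by linarith) hw
  · exact mul_le_mul_of_nonneg_right (by linarith) hw

/-- The derivative of the wave with respect to its speed. -/
theorem exists_variation (hn : 1 < n) (hc : n < c)
    (hφ : ∀ᶠ s in 𝓝 c, IsSolitaryWave n m s (φ s)) :
    ∃ v : ℝ → ℝ, Dec (expW (gammaOf n c / 2)) v ∧
      (∀ x, deriv (deriv v) x = pot n m c (φ c) x * v x + (1 - φ c x ^ (-n)) * (c ^ 2)⁻¹) ∧
      (∀ x, HasDerivAt (fun s => φ s x) (φ c x ^ m * v x) c) ∧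
      (∀ x, HasDerivAt (fun s => psi m (φ s) x) (deriv v x) c) ∧
      ∃ C, 0 ≤ C ∧ ∀ᶠ s in 𝓝 c, ∀ x,
        |φ s x - φ c x| ≤ C * |s - c| ∧ |psi m (φ s) x - psi m (φ c) x| ≤ C * |s - c| ∧
        φ s x - 1 ≤ C * expW (gammaOf n c / 2) x ∧
        |psi m (φ s) x| ≤ C * expW (gammaOf n c / 2) x := by
  have h := hφ.self_of_nhds
  have hc0 : 0 < c := by linarith
  obtain ⟨d₀, hd₀⟩ := exists_hasDerivAt_max hn hc hφ
  have hd : HasDerivAt (fun s => powInt (-m) (φ s 0)) (φ c 0 ^ (-m) * d₀) c :=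
    HasDerivAt.comp c (hasDerivAt_powInt (-m) (h.pos 0)) hd₀
  have hF := (h.forcing_dec hn hc).mul_one (dec_const (c ^ 2)⁻¹)
  have hψne := (h.coeffs hn hc).ψ_ne
  -- The candidate derivative is the solution of the linearized equation with the derivative of the
  -- amplitude as initial value and slope 0, as evenness demands.
  obtain ⟨v, v₁, hv, hv₁, hv0, hv10⟩ := exists_initial_value_solution
    (h.dec_pot hn hc).contDiff.continuous (h.coeffs hn hc).ψ_hasDerivAt
    (h.coeffs hn hc).dψ_hasDerivAt hψne h.psi_zero hF.contDiff.continuous (φ c 0 ^ (-m) * d₀)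
  rw [← hv0] at hd
  have evp : ∀ x, pot n m c (φ c) (-x) = pot n m c (φ c) x := fun x => by rw [pot, pot, h.even]
  have hderiv : ∀ x, HasDerivAt (fun s => powInt (-m) (φ s x)) (v x) c ∧
      HasDerivAt (fun s => psi m (φ s) x) (v₁ x) c := by
    intro x
    rcases le_total 0 x with hx | hx
    · exact hasDerivAt_speed_of_nonneg hn hc hφ hv hv₁ hd hv10 hx
    · have := hasDerivAt_speed_of_nonneg (v := fun x => v (-x)) (v₁ := fun x => -v₁ (-x)) hn hc hφ
        (fun x => hasDerivAt_comp_neg_arg (hv (-x)))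
        (fun x => (hasDerivAt_comp_neg_arg (hv₁ (-x))).fun_neg.congr_deriv (by
          rw [neg_neg, evp, h.even])) (by simpa using hd) (by simp [hv10])
        (x := -x) (by linarith)
      simp only [neg_neg] at this
      constructor
      · refine this.1.congr_of_eventuallyEq ?_
        filter_upwards [hφ] with s hs
        rw [hs.even]
      · refine (this.2.fun_neg.congr_deriv (neg_neg _)).congr_of_eventuallyEq ?_
        filter_upwards [hφ] with s hs
        rw [hs.psi_neg_arg, neg_neg]
  obtain ⟨C, hC0, hC⟩ := exists_uniform_bounds hn hc hφ
    (fun x _ => (hderiv x).1.continuousAt) hd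
  -- A solution of the initial value problem could grow at infinity; the uniform Lipschitz bound on
  -- its difference quotients excludes this, and boundedness upgrades to decay.
  have hvb : ∀ x, |v x| ≤ C := fun x => by
    refine (hderiv x).1.le_of_lip' hC0 ?_
    filter_upwards [hC] with s hs
    exact (hs x).1
  have e1 : deriv v = v₁ := funext fun x => (hv x).deriv
  have hvd : Dec (expW (gammaOf n c / 2)) v := by
    refine (h.coeffs hn hc).dec_of_bounded (F := fun x => -((1 - φ c x ^ (-n)) * (c ^ 2)⁻¹)) hv
      (fun x => (hv₁ x).congr_deriv ?_) hF.neg ⟨C, hvb⟩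
    change _ = pot n m c (φ c) x * v x - _
    ring
  have hH : ∀ᶠ s in 𝓝 c, ∀ x, φ s x ≤ φ c 0 + 1 := by
    filter_upwards [hφ, lt_mem_nhds hc,
      hd₀.continuousAt.eventually_le_const (show φ c 0 < φ c 0 + 1 by simp)] with s h1 h2 h3 x
    exact (h1.le_max hn (by linarith) x).trans h3
  refine ⟨v, hvd, fun x => ?_, fun x => hasDerivAt_of_powInt hφ hH (hderiv x).1, fun x => ?_,
    C, hC0, ?_⟩
  · rw [e1]; exact (hv₁ x).deriv
  · rw [e1]; exact (hderiv x).2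
  · filter_upwards [hC] with s hs x using (hs x).2

end IsSolitaryWave

/-! ### The invariant and its derivative in the speed -/

theorem powInt_eq {p t : ℝ} (hp : p ≠ -1) (ht : 0 < t) :
    powInt p t = (t ^ (p + 1) - 1) / (p + 1) := by
  rw [powInt, integral_rpow (Or.inr ⟨hp, ?_⟩), Real.one_rpow]
  intro h0
  exact absurd h0.1 (not_le.2 (lt_min one_pos ht))

theorem powInt_neg_one {t : ℝ} (ht : 0 < t) : powInt (-1) t = Real.log t := by
  simp only [powInt, Real.rpow_neg_one]
  rw [integral_inv_of_pos one_pos ht, div_one]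

/-- The three cases of the potential have a common meaning: V' is the primitive of τ^(-n-m)
vanishing at 1. Logarithms appear when one of the two integrations meets τ^(-1). Consequently V'(φ)
= W. -/
theorem hasDerivAt_energyPotential (n m : ℝ) {t : ℝ} (ht : 0 < t) :
    HasDerivAt (energyPotential n m) (powInt (-n - m) t) t := by
  unfold energyPotential
  by_cases h1 : n + m = 1
  · simp only [h1, if_true]
    rw [show -n - m = -1 by linarith, powInt_neg_one ht]
    refine (((hasDerivAt_id t).mul (Real.hasDerivAt_log ht.ne')).sub (hasDerivAt_id t)
      |>.add_const 1).congr_deriv ?_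
    simp [ht.ne']
  by_cases h2 : n + m = 2
  · simp only [h2, if_true, OfNat.ofNat_ne_one, if_false]
    rw [show -n - m = -2 by linarith, powInt_eq (by norm_num) ht]
    refine (((hasDerivAt_id t).sub_const 1).sub (Real.hasDerivAt_log ht.ne')).congr_deriv ?_
    rw [show (-2 : ℝ) + 1 = -1 by norm_num, Real.rpow_neg_one]
    ring
  · simp only [h1, h2, if_false]
    have a1 : n + m - 1 ≠ 0 := sub_ne_zero.2 h1
    have a2 : n + m - 2 ≠ 0 := sub_ne_zero.2 h2
    have a3 : -n - m ≠ -1 := fun h => h1 (by linarith)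
    rw [powInt_eq a3 ht]
    refine ((((Real.hasDerivAt_rpow_const (Or.inl ht.ne')).sub_const 1).add
      (((hasDerivAt_id t).sub_const 1).const_mul (n + m - 2))).div_const
      ((n + m - 1) * (n + m - 2))).congr_deriv ?_
    have a4 : -n - m + 1 ≠ 0 := fun h => a1 (by linarith)
    rw [show 2 - n - m - 1 = -n - m + 1 by ring]
    field_simp
    ring

theorem energyPotential_one (n m : ℝ) : energyPotential n m 1 = 0 := by
  unfold energyPotential
  split_ifs <;> simp

theorem integrable_of_dec {b : ℝ} {f : ℝ → ℝ} (hb : 0 < b) (hf : Dec (expW b) f) :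
    Integrable f := by
  obtain ⟨C, hC⟩ := hf.bound
  exact integrable_of_le_expW hf.contDiff.continuous hb hC

theorem integral_deriv_eq_zero_of_dec {b : ℝ} {f : ℝ → ℝ} (hb : 0 < b) (hf : Dec (expW b) f) :
    ∫ x, deriv f x = 0 :=
  integral_eq_zero_of_hasDerivAt_of_integrable (hasDerivAt_of_smooth hf.contDiff)
    (integrable_of_dec hb hf.deriv) (integrable_of_dec hb hf)

theorem expW_le_one {b : ℝ} (hb : 0 ≤ b) (x : ℝ) : expW b x ≤ 1 := by
  rw [expW, Real.exp_le_one_iff]; have := mul_nonneg hb (abs_nonneg x); linarith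

theorem Dec.wOne_of_expW {b : ℝ} {f : ℝ → ℝ} (hb : 0 ≤ b) (hf : Dec (expW b) f) : Dec wOne f :=
  hf.mono (K := 1) (fun x => (expW_pos b x).le) fun x => by
    rw [_root_.one_mul]; exact expW_le_one hb x

namespace IsSolitaryWave

variable {n m c : ℝ} {f : ℝ → ℝ}

/-- The primitive of `φ ^ (-n-m) φ'` that vanishes at infinity. -/
def primW (n m : ℝ) (f : ℝ → ℝ) (x : ℝ) : ℝ := powInt (-n - m) (f x)

theorem primW_hasDerivAt (h : IsSolitaryWave n m c f) (x : ℝ) :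
    HasDerivAt (primW n m f) (f x ^ (-n) * psi m f x) x := by
  refine (h.comp_hasDerivAt (hasDerivAt_powInt (-n - m) (h.pos x))).congr_deriv ?_
  rw [← mul_assoc, ← Real.rpow_add (h.pos x), show -n - m + m = -n by ring]

theorem primW_le (h : IsSolitaryWave n m c f) (hn : 1 < n) (hc : n < c) :
    ∃ D, 0 < D ∧ ∀ x, |primW n m f x| ≤ D * (f x - 1) := by
  obtain ⟨D, hD, hDb⟩ := exists_powInt_bounds (-n - m) (f 0)
  refine ⟨D, hD, fun x => ?_⟩
  have := (hDb (f x) ⟨(h.one_lt x).le, h.le_max hn (by linarith) x⟩ 1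
    ⟨le_rfl, (h.one_lt 0).le⟩).2
  rwa [powInt_one, sub_zero, abs_of_pos (sub_pos.2 (h.one_lt x))] at this

theorem dec_primW (h : IsSolitaryWave n m c f) (hn : 1 < n) (hc : n < c) :
    Dec (expW (gammaOf n c / 2)) (primW n m f) := by
  have hd : deriv (primW n m f) = fun x => f x ^ (-n) * psi m f x :=
    funext fun x => (h.primW_hasDerivAt x).deriv
  have hdec : Dec (expW (gammaOf n c / 2)) fun x => f x ^ (-n) * psi m f x :=
    ((h.dec_wOne hn hc).1 (-n)).one_mul (h.dec_psi hn hc)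
  obtain ⟨D, hD, hDb⟩ := h.primW_le hn hc
  obtain ⟨C, hC0, hC⟩ := h.exists_decay hn hc
  refine Dec.of_deriv (contDiff_infty_iff_deriv.2
    ⟨fun x => (h.primW_hasDerivAt x).differentiableAt, by rw [hd]; exact hdec.contDiff⟩)
    ⟨D * C, fun x => (hDb x).trans ?_⟩ (by rw [hd]; exact hdec)
  rw [mul_assoc]
  exact mul_le_mul_of_nonneg_left (hC x).1 hD.le

theorem half_gamma_pos (hn : 1 < n) (hc : n < c) : 0 < gammaOf n c / 2 :=
  half_pos (gammaOf_pos (by linarith) hc)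

theorem integral_Iic_eq_primW (h : IsSolitaryWave n m c f) (hn : 1 < n) (hc : n < c) (x : ℝ) :
    ∫ t in Set.Iic x, deriv f t / f t ^ (n + m) = primW n m f x := by
  have e : (fun t => deriv f t / f t ^ (n + m)) = fun t => f t ^ (-n) * psi m f t := by
    ext t
    rw [div_eq_mul_inv, ← Real.rpow_neg (h.pos t).le, psi, neg_add, Real.rpow_add (h.pos t)]
    ring
  have hi : Integrable fun t => f t ^ (-n) * psi m f t :=
    integrable_of_dec (half_gamma_pos hn hc)
      (((h.dec_wOne hn hc).1 (-n)).one_mul (h.dec_psi hn hc))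
  rw [e, integral_Iic_of_hasDerivAt_of_tendsto' (fun t _ => h.primW_hasDerivAt t) hi.integrableOn
    (Coeffs.tendsto_zero_of_dec (half_gamma_pos hn hc) (h.dec_primW hn hc)).2, sub_zero]

theorem baseFun_eq (h : IsSolitaryWave n m c f) (hn : 1 < n) (hc : n < c) :
    baseFun n m f = (h.coeffs hn hc).M (primW n m f) := by
  rw [baseFun, h.adjM_eq hn hc]
  congr 1
  exact funext (h.integral_Iic_eq_primW hn hc)

/-- φ^n W' = ψ and ψ' is the force. In this form M⋆W is visibly even and O(φ - 1). -/
theorem M_primW (h : IsSolitaryWave n m c f) (hn : 1 < n) (hc : n < c) (x : ℝ) :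
    (h.coeffs hn hc).M (primW n m f) x = primW n m f x - f x ^ (-m) * force n c (f x) := by
  have e : (fun y => f y ^ n * deriv (primW n m f) y) = psi m f := by
    ext y
    rw [(h.primW_hasDerivAt y).deriv, ← mul_assoc, ← Real.rpow_add (h.pos y), add_neg_cancel,
      Real.rpow_zero, one_mul]
  change primW n m f x - f x ^ (-m) * deriv (fun y => f y ^ n * deriv (primW n m f) y) x = _
  rw [e, h.deriv_psi (by linarith)]

/-- The derivative of the invariant along the family of waves. -/
theorem dEnergy_eq {φ : ℝ → ℝ → ℝ} (hn : 1 < n) (hc : n < c)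
    (hφ : ∀ᶠ s in 𝓝 c, IsSolitaryWave n m s (φ s)) {v : ℝ → ℝ}
    (hv : Dec (expW (gammaOf n c / 2)) v)
    (h1 : ∀ x, HasDerivAt (fun s => φ s x) (φ c x ^ m * v x) c)
    (h2 : ∀ x, HasDerivAt (fun s => psi m (φ s) x) (deriv v x) c)
    (hC : ∃ C, 0 ≤ C ∧ ∀ᶠ s in 𝓝 c, ∀ x,
        |φ s x - φ c x| ≤ C * |s - c| ∧ |psi m (φ s) x - psi m (φ c) x| ≤ C * |s - c| ∧
        φ s x - 1 ≤ C * expW (gammaOf n c / 2) x ∧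
        |psi m (φ s) x| ≤ C * expW (gammaOf n c / 2) x) :
    dEnergy n m φ c = ∫ x, baseFun n m (φ c) x * (φ c x ^ m * v x) := by
  obtain ⟨C, hC0, hC⟩ := hC
  have h := hφ.self_of_nhds
  have hb := half_gamma_pos hn hc
  set w := expW (gammaOf n c / 2) with hw
  have hw0 : ∀ x, 0 ≤ w x := fun x => (expW_pos _ x).le
  have hw1 : ∀ x, w x ≤ 1 := expW_le_one hb.le
  set F : ℝ → ℝ → ℝ := fun s x => 1 / 2 * psi m (φ s) x ^ 2 + energyPotential n m (φ s x) with hF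
  have hFe : ∀ᶠ s in 𝓝 c, energy n m (φ s) = ∫ x, F s x := by
    filter_upwards [hφ] with s hs
    rw [energy]
    congr 1; ext x
    have : φ s x ^ (-2 * m) = φ s x ^ (-m) * φ s x ^ (-m) := by
      rw [← Real.rpow_add (hs.pos x)]; congr 1; ring
    simp only [hF, psi, this]
    ring
  obtain ⟨D, hD, hDb⟩ := exists_powInt_bounds (-n - m) (1 + C)
  -- V' vanishes at 1, so V has Lipschitz constant O(A) on [1, 1 + A]. With A = C w(x) this yields
  -- an integrable bound on the difference quotients in s.
  have hV : ∀ t u A : ℝ, 1 ≤ t → 1 ≤ u → t - 1 ≤ A → u - 1 ≤ A → A ≤ C →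
      |energyPotential n m t - energyPotential n m u| ≤ D * A * |t - u| := by
    intro t u A ht hu htA huA hAC
    obtain ⟨ξ, hξ, e, -⟩ := exists_eq_slope_of_one_le
      (fun t ht => hasDerivAt_energyPotential n m ht) (H := 1 + A) ⟨ht, by linarith⟩
      ⟨hu, by linarith⟩
    rw [e, abs_mul]
    refine mul_le_mul_of_nonneg_right ?_ (abs_nonneg _)
    have := (hDb ξ ⟨hξ.1, by linarith [hξ.2]⟩ 1 ⟨le_rfl, by linarith⟩).2
    rw [powInt_one, sub_zero] at this
    refine this.trans (mul_le_mul_of_nonneg_left ?_ hD.le)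
    rw [abs_of_nonneg (by linarith [hξ.1])]
    linarith [hξ.2]
  have hcw : ∀ x, C * w x ≤ C := fun x => mul_le_of_le_one_right hC0 (hw1 x)
  have hFc : ∀ s, IsSolitaryWave n m s (φ s) → n < s → Continuous (F s) := by
    intro s hs hns
    refine ((hs.psi_continuous (by linarith)).pow 2 |>.const_mul (1 / 2)).add ?_
    exact continuous_iff_continuousAt.2 fun x =>
      (hs.comp_hasDerivAt (hasDerivAt_energyPotential n m (hs.pos x))).continuousAt
  have hCc := hC.self_of_nhds
  set F' : ℝ → ℝ := fun x => psi m (φ c) x * deriv v x + primW n m (φ c) x * (φ c x ^ m * v x)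
    with hF'
  have hdF : ∀ x, HasDerivAt (fun s => F s x) (F' x) c := fun x => by
    have e1 := ((h2 x).pow 2).const_mul (1 / 2)
    have e2 := HasDerivAt.comp c (hasDerivAt_energyPotential n m (h.pos x)) (h1 x)
    refine (e1.add e2).congr_deriv ?_
    simp only [hF', primW, Nat.cast_ofNat, Nat.add_one_sub_one, pow_one]
    ring
  have dp := h.dec_psi hn hc
  have dW := h.dec_primW hn hc
  have dz : Dec w fun x => φ c x ^ m * v x := ((h.dec_wOne hn hc).1 m).one_mul hv
  have i1 : Integrable fun x => psi m (φ c) x * deriv v x :=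
    integrable_of_dec hb (dp.mul_one (hv.deriv.wOne_of_expW hb.le))
  have i2 : Integrable fun x => primW n m (φ c) x * (φ c x ^ m * v x) :=
    integrable_of_dec hb (dW.mul_one (dz.wOne_of_expW hb.le))
  have hns : ∀ᶠ s in 𝓝 c, n < s := lt_mem_nhds hc
  have main := hasFDerivAt_integral_of_dominated_loc_of_lip' (μ := volume) (F := F) (x₀ := c)
    (F' := fun x => ContinuousLinearMap.toSpanSingleton ℝ (F' x))
    (bound := fun x => (C ^ 2 + D * C ^ 2) * w x) ((hφ.and hns).and hC)
    (fun s hs => (hFc s hs.1.1 hs.1.2).aestronglyMeasurable) ?_ ?_ ?_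
    ((integrable_expW hb).const_mul _)
    (Eventually.of_forall fun x => (hdF x).hasFDerivAt)
  · have hd : HasDerivAt (fun s => ∫ x, F s x) (∫ x, F' x) c := by
      have h4 := main.2.hasDerivAt
      refine h4.congr_deriv ?_
      rw [ContinuousLinearMap.integral_apply main.1]
      simp
    have hd' : dEnergy n m φ c = ∫ x, F' x := by
      rw [dEnergy, EventuallyEq.deriv_eq hFe, hd.deriv]
    have i3 : Integrable fun x => force n c (φ c x) * v x := by
      have := dp.deriv
      rw [h.deriv_psi (by linarith)] at this
      exact integrable_of_dec hb (this.mul_one (hv.wOne_of_expW hb.le))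
    -- Integration by parts, as the integrand is (ψv)'. It trades ψv' for -force·v, the missing part
    -- of (M⋆W) φ^m v.
    have e3 : ∫ x, (force n c (φ c x) * v x + psi m (φ c) x * deriv v x) = 0 := by
      have := integral_deriv_eq_zero_of_dec hb (dp.mul_one (hv.wOne_of_expW hb.le))
      rw [← this]
      congr 1; ext x
      exact (((h.psi_hasDerivAt (by linarith) x).fun_mul
        (hasDerivAt_of_smooth hv.contDiff x)).deriv).symm
    rw [integral_add i3 i1] at e3
    rw [hd', hF', integral_add i1 i2, h.baseFun_eq hn hc]
    simp only [h.M_primW hn hc]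
    have e4 : ∀ x, (primW n m (φ c) x - φ c x ^ (-m) * force n c (φ c x)) * (φ c x ^ m * v x) =
        primW n m (φ c) x * (φ c x ^ m * v x) - force n c (φ c x) * v x := fun x => by
      have := (h.coeffs hn hc).σi_mul x
      change φ c x ^ m * φ c x ^ (-m) = 1 at this
      linear_combination (-force n c (φ c x) * v x) * this
    simp only [e4]
    rw [integral_sub i2 i3]
    linarith
  · refine integrable_of_le_expW (b := gammaOf n c / 2) (C := C ^ 2 + D * C ^ 2) (hFc c h hc) hb
      fun x => ?_
    have a1 : |1 / 2 * psi m (φ c) x ^ 2| ≤ C ^ 2 * w x := by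
      have hp := (hCc x).2.2.2
      rw [abs_mul, abs_pow, abs_of_pos (by norm_num : (0 : ℝ) < 1 / 2)]
      calc 1 / 2 * |psi m (φ c) x| ^ 2 ≤ 1 * |psi m (φ c) x| ^ 2 := by
            have := sq_nonneg (|psi m (φ c) x|); linarith
        _ ≤ 1 * (C * w x * C) := by
            rw [sq]
            exact mul_le_mul_of_nonneg_left (mul_le_mul hp (hp.trans (hcw x)) (abs_nonneg _)
              (mul_nonneg hC0 (hw0 x))) zero_le_one
        _ = _ := by ring
    have a2 : |energyPotential n m (φ c x)| ≤ D * C ^ 2 * w x := by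
      have ht := (hCc x).2.2.1
      have := hV (φ c x) 1 (C * w x) (h.one_lt x).le le_rfl ht
        (by rw [sub_self]; exact mul_nonneg hC0 (hw0 x)) (hcw x)
      rw [energyPotential_one, sub_zero, abs_of_pos (sub_pos.2 (h.one_lt x))] at this
      refine this.trans ?_
      calc D * (C * w x) * (φ c x - 1) ≤ D * (C * w x) * C := by
            refine mul_le_mul_of_nonneg_left (ht.trans (hcw x)) ?_
            exact mul_nonneg hD.le (mul_nonneg hC0 (hw0 x))
        _ = _ := by ring
    rw [add_mul]
    exact (abs_add_le _ _).trans (add_le_add a1 a2)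
  · exact ((ContinuousLinearMap.toSpanSingletonCLE (𝕜 := ℝ) (E := ℝ)).continuous
      |>.comp_aestronglyMeasurable (i1.add i2).aestronglyMeasurable)
  · refine Eventually.of_forall fun x s hs => ?_
    obtain ⟨b1, b2, b3, b4⟩ := hs.2 x
    obtain ⟨c1, c2, c3, c4⟩ := hCc x
    have hsc := abs_nonneg (s - c)
    have hCw : 0 ≤ C * w x := mul_nonneg hC0 (hw0 x)
    have a1 : |1 / 2 * psi m (φ s) x ^ 2 - 1 / 2 * psi m (φ c) x ^ 2| ≤
        C ^ 2 * w x * |s - c| := by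
      have e : 1 / 2 * psi m (φ s) x ^ 2 - 1 / 2 * psi m (φ c) x ^ 2 =
          (psi m (φ s) x - psi m (φ c) x) * (1 / 2 * (psi m (φ s) x + psi m (φ c) x)) := by ring
      have e2 : |1 / 2 * (psi m (φ s) x + psi m (φ c) x)| ≤ C * w x := by
        rw [abs_mul, abs_of_pos (by norm_num : (0 : ℝ) < 1 / 2)]
        have := abs_add_le (psi m (φ s) x) (psi m (φ c) x)
        linarith
      rw [e, abs_mul]
      calc _ ≤ C * |s - c| * (C * w x) := mul_le_mul b2 e2 (abs_nonneg _) (mul_nonneg hC0 hsc)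
        _ = _ := by ring
    have a2 : |energyPotential n m (φ s x) - energyPotential n m (φ c x)| ≤
        D * C ^ 2 * w x * |s - c| := by
      refine (hV _ _ (C * w x) (hs.1.1.one_lt x).le (h.one_lt x).le b3 c3 (hcw x)).trans ?_
      calc _ ≤ D * (C * w x) * (C * |s - c|) :=
            mul_le_mul_of_nonneg_left b1 (mul_nonneg hD.le hCw)
        _ = _ := by ring
    rw [Real.norm_eq_abs, Real.norm_eq_abs]
    calc |F s x - F c x| = |(1 / 2 * psi m (φ s) x ^ 2 - 1 / 2 * psi m (φ c) x ^ 2) +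
          (energyPotential n m (φ s x) - energyPotential n m (φ c x))| := by
          congr 1; simp only [hF]; ring
      _ ≤ _ := (abs_add_le _ _).trans (add_le_add a1 a2)
      _ = _ := by ring

end IsSolitaryWave

/-! ### Preimages of `M⋆W` under `L⋆` -/

theorem two_le_infty : (2 : WithTop ℕ∞) ≤ ∞ := by
  have h : ∀ k : ℕ, (k : WithTop ℕ∞) ≤ ∞ := fun k => by exact_mod_cast le_top
  exact h 2

namespace IsSolitaryWave

variable {n m c : ℝ} {f : ℝ → ℝ}

/-- The momentum dominates the excess near infinity. -/
theorem exists_sub_one_le_psi (h : IsSolitaryWave n m c f) (hn : 1 < n) (hc : n < c) :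
    ∃ C X, 0 ≤ C ∧ ∀ x, X ≤ |x| → f x - 1 ≤ C * |psi m f x| := by
  have hc0 : 0 < c := by linarith
  have hγ := gammaOf_pos (by linarith : 0 < n) hc
  have hγ2 := gammaOf_sq (by linarith : 0 < n) hc
  set κ := gammaOf n c ^ 2 / 2 with hκ
  have hκ0 : 0 < κ := by positivity
  obtain ⟨ε, hε, hmono⟩ := exists_force_monotone (m := m) (n := n) (c := c)
    (κ := κ) (by linarith) (by nlinarith)
  have hm := hmono.self_of_nhds
  obtain ⟨X, hX⟩ := eventually_atTop.1
    (h.tendsto_atTop.eventually_le_const (by linarith : (1 : ℝ) < 1 + ε))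
  obtain ⟨D, hD, hDb⟩ := exists_powInt_bounds (-m) (1 + ε)
  refine ⟨D / Real.sqrt κ, X, by positivity, fun x hx => ?_⟩
  have hfx : f x ∈ Set.Icc 1 (1 + ε) := ⟨(h.one_lt x).le, h.abs_arg x ▸ hX _ hx⟩
  have h1 : (1 : ℝ) ∈ Set.Icc 1 (1 + ε) := ⟨le_rfl, by linarith⟩
  -- The energy ψ²/2 minus κu²/2 is nondecreasing in the amplitude near 1 and vanishes at 1, because
  -- force ≥ κu there. Hence √κ u ≤ |ψ|.
  have hd : ∀ t, 0 < t → HasDerivAt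
      (fun t => potA n m t - c⁻¹ * potB n m t - κ / 2 * powInt (-m) t ^ 2)
      (t ^ (-m) * (force n c t - κ * powInt (-m) t)) t := fun t ht => by
    refine (((hasDerivAt_potA n m ht).sub ((hasDerivAt_potB n m ht).const_mul c⁻¹)).sub
      (((hasDerivAt_powInt (-m) ht).pow 2).const_mul (κ / 2))).congr_deriv ?_
    rw [force_eq ht, show -n - m = -m + -n by ring, Real.rpow_add ht]
    simp only [Nat.cast_ofNat, Nat.add_one_sub_one, pow_one]
    ring
  obtain ⟨ξ, hξ, e, -⟩ := exists_eq_slope_of_one_le hd hfx h1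
  have e1 := hm ξ hξ 1 h1 hξ.1
  simp only [powInt_one, force_one, sub_zero] at e1
  simp only [potA_one, potB_one, powInt_one] at e
  have e2 : 0 ≤ ξ ^ (-m) * (force n c ξ - κ * powInt (-m) ξ) * (f x - 1) :=
    mul_nonneg (mul_nonneg (Real.rpow_pos_of_pos (by linarith [hξ.1]) _).le (by linarith))
      (by linarith [hfx.1])
  have e3 := h.psi_sq hc0.ne' x
  have hP := powInt_pos (-m) (h.one_lt x)
  have e4 : (Real.sqrt κ * powInt (-m) (f x)) ^ 2 ≤ |psi m f x| ^ 2 := by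
    rw [mul_pow, Real.sq_sqrt hκ0.le, sq_abs]; linarith
  have e5 : Real.sqrt κ * powInt (-m) (f x) ≤ |psi m f x| :=
    (sq_le_sq₀ (by positivity) (abs_nonneg _)).1 e4
  have e6 := (hDb (f x) hfx 1 h1).1
  rw [powInt_one, sub_zero, abs_of_pos hP, abs_of_pos (sub_pos.2 (h.one_lt x))] at e6
  refine e6.trans ?_
  rw [div_mul_eq_mul_div, le_div_iff₀ (Real.sqrt_pos.2 hκ0), mul_assoc]
  exact mul_le_mul_of_nonneg_left (by linarith) hD.le

theorem memLp_of_dec {b : ℝ} {f : ℝ → ℝ} (hb : 0 < b) (hf : Dec (expW b) f) : MemLp f 2 := by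
  obtain ⟨C, hC⟩ := hf.bound
  exact memLp_of_le_expW hf.contDiff.continuous hb hC

/-- With τ = φ^n g the equation is -τ'' + qτ = F, where F = c⁻¹φ^m M⋆W is even and O(φ - 1) = O(ψ).
The zero mode ψ is odd, so the Fredholm condition holds by parity. -/
theorem exists_dec_preimage (h : IsSolitaryWave n m c f) (hn : 1 < n) (hc : n < c) :
    ∃ g₀ : ℝ → ℝ, Dec (expW (gammaOf n c / 2)) g₀ ∧
      ∀ x, (h.coeffs hn hc).L g₀ x = baseFun n m f x := by
  have hc0 : 0 < c := by linarith
  set P := h.coeffs hn hc with hP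
  have dW := P.dec_M (h.dec_primW hn hc)
  set F : ℝ → ℝ := fun x => c⁻¹ * (f x ^ m * P.M (primW n m f) x) with hF
  have dF : Dec (expW P.b) F := (P.dec_σi.one_mul dW).const_mul c⁻¹
  obtain ⟨D, hD, hDb⟩ := h.primW_le hn hc
  obtain ⟨A, hA, hAb⟩ := exists_rpow_bounds m (f 0)
  obtain ⟨B, hB, hBb⟩ := exists_rpow_bounds (-m) (f 0)
  obtain ⟨C, X, hC0, hC⟩ := h.exists_sub_one_le_psi hn hc
  have hfx : ∀ x, f x ∈ Set.Icc 1 (f 0) := fun x => ⟨(h.one_lt x).le, h.le_max hn hc0 x⟩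
  have hb1 : ∀ x, |F x| ≤ c⁻¹ * (A * (D + B * (2 * n))) * (f x - 1) := fun x => by
    have hf1 : 0 ≤ f x - 1 := by linarith [h.one_lt x]
    have e1 : |f x ^ (-m) * force n c (f x)| ≤ B * (2 * n * (f x - 1)) := by
      rw [abs_mul, abs_of_pos (Real.rpow_pos_of_pos (h.pos x) _)]
      exact mul_le_mul (hBb _ (hfx x)).2 (abs_force_le hn hc (h.one_lt x).le) (abs_nonneg _) hB.le
    have e2 : |P.M (primW n m f) x| ≤ (D + B * (2 * n)) * (f x - 1) := by
      rw [h.M_primW hn hc]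
      refine ((abs_sub _ _).trans (add_le_add (hDb x) e1)).trans (le_of_eq ?_)
      ring
    simp only [hF]
    rw [abs_mul, abs_mul, abs_of_pos (inv_pos.2 hc0),
      abs_of_pos (Real.rpow_pos_of_pos (h.pos x) _), mul_assoc, mul_assoc]
    refine mul_le_mul_of_nonneg_left ?_ (inv_pos.2 hc0).le
    exact mul_le_mul (hAb _ (hfx x)).2 e2 (abs_nonneg _) hA.le
  have hK : 0 ≤ c⁻¹ * (A * (D + B * (2 * n))) := by positivity
  have hodd : ∫ x, P.ψ x * F x = 0 := by
    have e : ∀ x, P.ψ (-x) * F (-x) = -(P.ψ x * F x) := fun x => by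
      change psi m f (-x) * (c⁻¹ * (f (-x) ^ m * P.M (primW n m f) (-x))) =
        -(psi m f x * (c⁻¹ * (f x ^ m * P.M (primW n m f) x)))
      rw [h.M_primW hn hc, h.M_primW hn hc, h.psi_neg_arg, primW, primW, h.even]
      ring
    have := integral_neg_eq_self (fun x => P.ψ x * F x) volume
    simp only [e, integral_neg] at this
    linarith
  obtain ⟨τ, hτ, hτe⟩ := P.exists_dec_solution dF
    (C := c⁻¹ * (A * (D + B * (2 * n))) * C) (X := X) (fun x hx => (hb1 x).trans (by
      rw [mul_assoc _ C]; exact mul_le_mul_of_nonneg_left (hC x hx) hK)) hodd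
  refine ⟨fun x => P.ri x * τ x, P.dec_ri.one_mul hτ, fun x => ?_⟩
  have e2 : (fun y => P.r y * (P.ri y * τ y)) = τ := by
    ext y
    linear_combination τ y * P.ri_mul y
  rw [h.baseFun_eq hn hc, Coeffs.L, e2]
  have e3 := hτe x
  have e4 : c * c⁻¹ = 1 := mul_inv_cancel₀ hc0.ne'
  have e5 : f x ^ m * P.σ x = 1 := P.σi_mul x
  have e6 : P.c = c := rfl
  simp only [hF] at e3
  rw [e6]
  linear_combination c * P.σ x * e3 + c * P.σ x * P.q x * τ x * P.ri_mul x +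
    (c * c⁻¹ * P.M (primW n m f) x) * e5 + P.M (primW n m f) x * e4

/-- The preimages form a line. -/
theorem isPreimage_iff (h : IsSolitaryWave n m c f) (hn : 1 < n) (hc : n < c) {g₀ : ℝ → ℝ}
    (hg₀ : Dec (expW (gammaOf n c / 2)) g₀)
    (he : ∀ x, (h.coeffs hn hc).L g₀ x = baseFun n m f x) (g : ℝ → ℝ) :
    IsPreimage n m c f g ↔ ∃ k : ℝ, g = fun x => g₀ x + k * (f x ^ (-n) * psi m f x) := by
  have hb := half_gamma_pos hn hc
  set P := h.coeffs hn hc with hP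
  have dw : Dec (expW (gammaOf n c / 2)) fun x => f x ^ (-n) * psi m f x :=
    P.dec_ri.one_mul P.dec_ψ
  have sr := P.dec_r.contDiff
  constructor
  · intro hg
    have sτ : ContDiff ℝ ∞ fun x => P.r x * g₀ x := sr.mul hg₀.contDiff
    have sτ2 : ContDiff ℝ 2 fun x => P.r x * g₀ x := sτ.of_le two_le_infty
    have sy : ContDiff ℝ 2 fun x => P.r x * g x :=
      (sr.of_le two_le_infty).mul hg.contDiff
    have d1 : ∀ {y : ℝ → ℝ}, ContDiff ℝ 2 y → ∀ x, HasDerivAt y (deriv y x) x := fun h x =>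
      (h.differentiable (by norm_num) x).hasDerivAt
    have d2 : ∀ {y : ℝ → ℝ}, ContDiff ℝ 2 y → ∀ x, HasDerivAt (deriv y) (deriv (deriv y) x) x :=
      fun h x => (h.differentiable_deriv_two x).hasDerivAt
    have hsq : Integrable fun x => (P.r x * g x - P.r x * g₀ x) ^ 2 := by
      obtain ⟨A, hA, hAb⟩ := exists_rpow_bounds n (f 0)
      have hL : MemLp (fun x => A * (g x - g₀ x)) 2 :=
        (hg.memLp.sub (memLp_of_dec hb hg₀)).const_mul A
      have hc1 : Continuous fun x => P.r x * g x - P.r x * g₀ x :=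
        sy.continuous.sub sτ.continuous
      refine (hL.mono hc1.aestronglyMeasurable (Eventually.of_forall fun x => ?_)).integrable_sq
      rw [← mul_sub, norm_mul, norm_mul, Real.norm_of_nonneg (P.r_pos x).le,
        Real.norm_of_nonneg hA.le]
      exact mul_le_mul_of_nonneg_right
        (hAb _ ⟨(h.one_lt x).le, h.le_max hn (by linarith) x⟩).2 (norm_nonneg _)
    -- φ^n (g - g₀) is a square integrable solution of the homogeneous Schrödinger equation.
    obtain ⟨k, hk⟩ := P.eq_mul_zero_mode
      (fun x => (d1 sy x).sub (d1 sτ2 x)) (fun x => ((d2 sy x).sub (d2 sτ2 x)).congr_deriv (by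
        have h1 := hg.eq x
        rw [h.adjL_eq hn hc, ← he x, Coeffs.L, Coeffs.L] at h1
        have hne : P.c * P.σ x ≠ 0 := mul_ne_zero P.c_pos.ne' (P.σ_pos x).ne'
        refine mul_left_cancel₀ hne ?_
        simp only [Pi.sub_apply]
        linear_combination (-1 : ℝ) * h1)) hsq
    refine ⟨k, funext fun x => ?_⟩
    have h1 := hk x
    have h2 := P.ri_mul x
    change P.r x * g x - P.r x * g₀ x = k * P.ψ x at h1
    change g x = g₀ x + k * (P.ri x * P.ψ x)
    linear_combination P.ri x * h1 - (g x - g₀ x) * h2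
  · rintro ⟨k, rfl⟩
    have dg := hg₀.add (dw.const_mul k)
    refine ⟨dg.contDiff.of_le two_le_infty, memLp_of_dec hb dg, fun x => ?_⟩
    rw [h.adjL_eq hn hc, ← he x, Coeffs.L, Coeffs.L]
    have e1 : (fun y => P.r y * (g₀ y + k * (f y ^ (-n) * psi m f y))) =
        fun y => P.r y * g₀ y + k * P.ψ y := by
      ext y
      have h2 := P.ri_mul y
      change P.r y * (g₀ y + k * (P.ri y * P.ψ y)) = _
      linear_combination k * P.ψ y * h2
    have sτ : ContDiff ℝ ∞ fun x => P.r x * g₀ x := sr.mul hg₀.contDiff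
    have e2 : deriv (fun y => P.r y * g₀ y + k * P.ψ y) =
        fun y => deriv (fun y => P.r y * g₀ y) y + k * deriv P.ψ y := funext fun y =>
      ((hasDerivAt_of_smooth sτ y).fun_add ((P.ψ_hasDerivAt y).const_mul k)).deriv
    rw [e1, e2, ((hasDerivAt_of_smooth (contDiff_infty_deriv sτ) x).fun_add
      ((P.dψ_hasDerivAt x).const_mul k)).deriv]
    have h2 := P.ri_mul x
    change _ + P.c * P.σ x * P.q x * P.r x * (g₀ x + k * (P.ri x * P.ψ x)) = _
    linear_combination P.c * P.σ x * P.q x * k * P.ψ x * h2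

end IsSolitaryWave

/-! ### Generalized kernels spanned by a Jordan chain of length two -/

theorem mem_kerPow_succ {E : Type*} [AddCommGroup E] [Module ℂ E] {T : E →ₗ.[ℂ] E} {k : ℕ}
    {x : E} : x ∈ kerPow T (k + 1) ↔ ∃ y, (x, y) ∈ T.graph ∧ y ∈ kerPow T k := by
  simp only [kerPow, Submodule.mem_map, Submodule.mem_comap, LinearPMap.mem_graph_iff]
  constructor
  · rintro ⟨y, hy, rfl⟩
    exact ⟨T y, ⟨y, rfl, rfl⟩, hy⟩
  · rintro ⟨y, ⟨z, hz, rfl⟩, hy⟩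
    exact ⟨z, hy, hz⟩

/-- The functional l vanishes on the range of T, hence on e, but not on f. If Tx = αe + βf then
βl(f) = 0, so T(x + αf) = 0 and x stays in the span: the chain cannot be prolonged beyond f. -/
theorem genKer_eq_span {E : Type*} [AddCommGroup E] [Module ℂ E] {T : E →ₗ.[ℂ] E} {e f : E}
    (he : (e, 0) ∈ T.graph) (hf : (f, -e) ∈ T.graph)
    (hker : ∀ x, (x, 0) ∈ T.graph → ∃ α : ℂ, x = α • e) (l : E → ℂ)
    (hladd : ∀ x y, l (x + y) = l x + l y) (hlsmul : ∀ (α : ℂ) x, l (α • x) = α * l x)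
    (hl : ∀ x y, (x, y) ∈ T.graph → l y = 0) (hlf : l f ≠ 0) :
    genKer T = Submodule.span ℂ {e, f} := by
  have hle : l e = 0 := by
    have h1 := hl _ _ hf
    have := hlsmul (-1) e
    rw [neg_one_smul] at this
    rw [this] at h1
    linear_combination -h1
  have step : ∀ x y, (x, y) ∈ T.graph → y ∈ Submodule.span ℂ {e, f} →
      x ∈ Submodule.span ℂ {e, f} := by
    intro x y hxy hy
    obtain ⟨α, β, rfl⟩ := Submodule.mem_span_pair.1 hy
    have h1 := hl _ _ hxy
    rw [hladd, hlsmul, hlsmul, hle, mul_zero, zero_add] at h1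
    have hβ : β = 0 := (mul_eq_zero.1 h1).resolve_right hlf
    rw [hβ, zero_smul, add_zero] at hxy
    have h2 := T.graph.add_mem hxy (T.graph.smul_mem α hf)
    have h3 : ((x, α • e) + α • (f, -e) : E × E) = (x + α • f, 0) := by
      ext <;> simp
    rw [h3] at h2
    obtain ⟨δ, hδ⟩ := hker _ h2
    refine Submodule.mem_span_pair.2 ⟨δ, -α, ?_⟩
    rw [← hδ, neg_smul, add_neg_cancel_right]
  refine le_antisymm (iSup_le fun k => ?_) (Submodule.span_le.2 ?_)
  · induction k with
    | zero => exact bot_le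
    | succ k ih =>
      intro x hx
      obtain ⟨y, hxy, hy⟩ := mem_kerPow_succ.1 hx
      exact step x y hxy (ih hy)
  · have h1 : e ∈ kerPow T 1 := mem_kerPow_succ.2 ⟨0, he, Submodule.zero_mem _⟩
    have h2 : f ∈ kerPow T 2 := mem_kerPow_succ.2 ⟨-e, hf, Submodule.neg_mem _ h1⟩
    rintro x (rfl | rfl)
    · exact Submodule.mem_iSup_of_mem 1 h1
    · exact Submodule.mem_iSup_of_mem 2 h2

theorem range_pair {E : Type*} (x y : E) : Set.range ![x, y] = {x, y} := by
  rw [Matrix.range_cons, Matrix.range_cons, Matrix.range_empty, Set.union_empty,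
    Set.singleton_union]

/-! ### Classes of weighted functions -/

namespace Represents

variable {u v : L2C} {b : ℝ} {f g : ℝ → ℝ}

theorem zero : Represents 0 b fun _ => 0 := by
  filter_upwards [Lp.coeFn_zero ℂ 2 (volume : Measure ℝ)] with x hx
  rw [hx]; simp

theorem neg (hu : Represents u b f) : Represents (-u) b fun x => -f x := by
  filter_upwards [Lp.coeFn_neg u, hu] with x h1 h2
  rw [h1, Pi.neg_apply, h2]
  push_cast; ring

theorem congr (hu : Represents u b f) (h : ∀ x, f x = g x) : Represents u b g := by
  rwa [show g = f from (funext h).symm]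

end Represents

theorem inner_eq_integral {w u : L2C} {a : ℝ} {F G : ℝ → ℝ} (hw : Represents w a F)
    (hu : Represents u (-a) G) : inner ℂ w u = ((∫ x, F x * G x : ℝ) : ℂ) := by
  rw [inner_represents hw, ← Coeffs.integral_smul_represents hu]
  simp only [neg_mul, neg_neg]

namespace Coeffs

variable (P : Coeffs)

theorem M_add_const_mul {χ θ : ℝ → ℝ} (hχ : ContDiff ℝ ∞ χ) (hθ : ContDiff ℝ ∞ θ) (k x : ℝ) :
    P.M (fun y => χ y + k * θ y) x = P.M χ x + k * P.M θ x := by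
  have e1 : ∀ {χ θ : ℝ → ℝ}, ContDiff ℝ ∞ χ → ContDiff ℝ ∞ θ →
      deriv (fun y => χ y + k * θ y) = fun y => deriv χ y + k * deriv θ y := fun h1 h2 =>
    funext fun y => ((hasDerivAt_of_smooth h1 y).fun_add
      ((hasDerivAt_of_smooth h2 y).const_mul k)).deriv
  rw [P.M_eq (hχ.add (contDiff_const.mul hθ)), P.M_eq hχ, P.M_eq hθ, e1 hχ hθ,
    e1 (contDiff_infty_deriv hχ) (contDiff_infty_deriv hθ)]
  ring

theorem M_const_mul {χ : ℝ → ℝ} (hχ : ContDiff ℝ ∞ χ) (k x : ℝ) :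
    P.M (fun y => k * χ y) x = k * P.M χ x := by
  have h0 : P.M (fun _ => 0) x = 0 := by simp [M]
  have := P.M_add_const_mul contDiff_const hχ k x (χ := fun _ => 0)
  rw [h0] at this
  simpa using this

theorem L_const_mul {θ : ℝ → ℝ} (hθ : ContDiff ℝ ∞ θ) (k x : ℝ) :
    P.L (fun y => k * θ y) x = k * P.L θ x := by
  have e1 : ∀ {χ : ℝ → ℝ}, ContDiff ℝ ∞ χ → deriv (fun y => k * χ y) = fun y => k * deriv χ y :=
    fun h1 => funext fun y => ((hasDerivAt_of_smooth h1 y).const_mul k).deriv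
  rw [P.L_eq (contDiff_const.mul hθ), P.L_eq hθ, e1 hθ, e1 (contDiff_infty_deriv hθ)]
  ring

end Coeffs

/-! ### The operator at a solitary wave: graph, adjoint and Jordan chains -/

theorem leftW_le_one (b x : ℝ) : leftW b x ≤ 1 := min_le_left _ _

namespace IsSolitaryWave

variable {n m c a : ℝ} {f : ℝ → ℝ}

theorem mem_linGraph_iff (h : IsSolitaryWave n m c f) (hn : 1 < n) (hc : n < c) {w u : L2C} :
    (w, u) ∈ linGraph n m c a f ↔ (h.coeffs hn hc).Rel a w u := by
  have e : ∀ χ, adjL n m c f χ = (h.coeffs hn hc).L χ := h.adjL_eq hn hc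
  constructor
  · intro hw χ h1 h2
    have := (hw χ h1 h2).2.2
    rw [e] at this
    exact this
  · intro hw χ h1 h2
    have d := dec_of_hasCompactSupport (continuous_expW (|a| + 1)) (expW_pos _) h1 h2
    refine ⟨Coeffs.integrable_of_test a ((h.coeffs hn hc).dec_M d) u, ?_, ?_⟩
    · rw [e]
      exact Coeffs.integrable_of_test a ((h.coeffs hn hc).dec_L d.deriv) w
    · rw [e]
      exact hw χ h1 h2

theorem lt_b (hn : 1 < n) (hc : n < c) (ha : a ≤ aStar n m c f) : a < gammaOf n c / 2 := by
  have h1 : a ≤ 1 / 3 * gammaOf n c := ha.trans (min_le_left _ _)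
  have := gammaOf_pos (by linarith : 0 < n) hc
  linarith

/-- Single-valuedness is `Rel.eq_zero`; it ensures that passing from the linear relation to an
operator loses nothing. -/
theorem linOp_graph (h : IsSolitaryWave n m c f) (hn : 1 < n) (hc : n < c) (ha : 0 < a)
    (hab : a < gammaOf n c / 2) : (linOp n m c a f).graph = linGraph n m c a f := by
  refine Submodule.toLinearPMap_graph_eq _ ?_
  rintro ⟨w, u⟩ hx rfl
  exact Coeffs.Rel.eq_zero ha hab ((h.mem_linGraph_iff hn hc).1 hx)

theorem mem_graph_iff (h : IsSolitaryWave n m c f) (hn : 1 < n) (hc : n < c) (ha : 0 < a)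
    (hab : a < gammaOf n c / 2) {w u : L2C} :
    (w, u) ∈ (linOp n m c a f).graph ↔ (h.coeffs hn hc).Rel a w u := by
  rw [h.linOp_graph hn hc ha hab, h.mem_linGraph_iff hn hc]

theorem dense_domain (h : IsSolitaryWave n m c f) (hn : 1 < n) (hc : n < c) (ha : 0 < a)
    (hab : a < gammaOf n c / 2) : Dense ((linOp n m c a f).domain : Set L2C) := by
  rw [Submodule.dense_iff_topologicalClosure_eq_top, Submodule.topologicalClosure_eq_top_iff,
    Submodule.eq_bot_iff]
  intro y hy
  refine Coeffs.eq_zero_of_orthogonal_domain (P := h.coeffs hn hc) ha hab fun w u hwu => ?_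
  refine Submodule.inner_right_of_mem_orthogonal ?_ hy
  exact LinearPMap.mem_domain_of_mem_graph ((h.mem_graph_iff hn hc ha hab).2 hwu)

/-- The domain is dense, so the adjoint operator has the adjoint relation as its graph and
membership becomes a family of pairings. -/
theorem mem_adjoint_graph_iff (h : IsSolitaryWave n m c f) (hn : 1 < n) (hc : n < c) (ha : 0 < a)
    (hab : a < gammaOf n c / 2) {y z : L2C} : (y, z) ∈ (linOp n m c a f).adjoint.graph ↔
      ∀ w u, (h.coeffs hn hc).Rel a w u → inner ℂ u y = inner ℂ w z := by
  rw [LinearPMap.adjoint_graph_eq_graph_adjoint (h.dense_domain hn hc ha hab),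
    Submodule.mem_adjoint_iff]
  simp only [h.mem_graph_iff hn hc ha hab, sub_eq_zero]

/-- The derivative of the wave is a zero mode. -/
theorem rel_deriv (h : IsSolitaryWave n m c f) (hn : 1 < n) (hc : n < c) {w : L2C}
    (hw : Represents w a (deriv f)) : (h.coeffs hn hc).Rel a w 0 := by
  refine (h.coeffs hn hc).rel_of_classical (k := fun _ => 0) (h.coeffs hn hc).dec_ψ.contDiff
    contDiff_const (fun x => ?_) (hw.congr h.deriv_eq) (Represents.zero.congr fun x => by simp)
  have e : (fun y => (h.coeffs hn hc).c * (h.coeffs hn hc).r y *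
      (-deriv (deriv (h.coeffs hn hc).ψ) y + (h.coeffs hn hc).q y * (h.coeffs hn hc).ψ y)) =
      fun _ => 0 := by
    ext y
    rw [(h.coeffs hn hc).ψ_ode]; ring
  rw [e]
  simp

/-- The derivative with respect to the speed is a generalized zero mode. -/
theorem rel_variation (h : IsSolitaryWave n m c f) (hn : 1 < n) (hc : n < c) {v : ℝ → ℝ}
    (hv : ContDiff ℝ ∞ v)
    (hve : ∀ x, deriv (deriv v) x = pot n m c f x * v x + (1 - f x ^ (-n)) * (c ^ 2)⁻¹)
    {w w' : L2C} (hw : Represents w a fun x => f x ^ m * v x) (hw' : Represents w' a (deriv f)) :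
    (h.coeffs hn hc).Rel a w (-w') := by
  have hc0 : c ≠ 0 := by linarith
  have sψ := (h.coeffs hn hc).dec_ψ.contDiff
  change ContDiff ℝ ∞ (psi m f) at sψ
  refine (h.coeffs hn hc).rel_of_classical (k := fun x => -psi m f x) hv sψ.neg (fun x => ?_) hw
    (hw'.neg.congr fun x => ?_)
  · change f x ^ m * -psi m f x - deriv (fun y => f y ^ n * deriv (fun x => -psi m f x) y) x =
      deriv (fun y => c * f y ^ n * (-deriv (deriv v) y + pot n m c f y * v y)) x
    have en : ∀ y, f y ^ (-n) * f y ^ n = 1 := (h.coeffs hn hc).ri_mul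
    -- Both fluxes are explicit functions of φ: φ^n ψ' = φ - 1 - (φ^n - 1)/c by the profile
    -- equation, and c φ^n (-v'' + qv) = -(φ^n - 1)/c.
    have e1 : (fun y => f y ^ n * deriv (fun x => -psi m f x) y) =
        fun y => -(f y - 1 - c⁻¹ * (f y ^ n - 1)) := by
      ext y
      rw [(h.psi_hasDerivAt hc0 y).fun_neg.deriv, force_eq (h.pos y)]
      linear_combination (-(f y - 1 - c⁻¹ * (f y ^ n - 1))) * en y
    have e2 : (fun y => c * f y ^ n * (-deriv (deriv v) y + pot n m c f y * v y)) =
        fun y => -(c⁻¹ * (f y ^ n - 1)) := by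
      ext y
      have e3 : c * (c ^ 2)⁻¹ = c⁻¹ := by field_simp
      rw [hve]
      linear_combination (-(f y ^ n) * (1 - f y ^ (-n))) * e3 + c⁻¹ * en y
    have d1 := h.hasDerivAt x
    have d2 := h.rpow_hasDerivAt n x
    rw [e1, e2, ((d2.sub_const 1).const_mul c⁻¹).fun_neg.deriv,
      ((d1.sub_const 1).fun_sub ((d2.sub_const 1).const_mul c⁻¹)).fun_neg.deriv]
    ring
  · rw [h.deriv_eq]
    change -(f x ^ m * psi m f x) = f x ^ m * -psi m f x
    ring

theorem exists_eq_smul_of_rel_zero (h : IsSolitaryWave n m c f) (hn : 1 < n) (hc : n < c)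
    (ha : 0 < a) (hab : a < gammaOf n c / 2) {x w : L2C} (hw : Represents w a (deriv f))
    (hx : (h.coeffs hn hc).Rel a x 0) : ∃ α : ℂ, x = α • w := by
  obtain ⟨α, hα⟩ := hx.exists_eq_zero_mode ha hab
  refine ⟨α, Lp.ext ?_⟩
  filter_upwards [hα, hw, Lp.coeFn_smul α w] with t h1 h2 h3
  rw [h1, h3, Pi.smul_apply, h2, smul_eq_mul, h.deriv_eq]
  rfl

theorem exists_eq_smul_of_orthogonal (h : IsSolitaryWave n m c f) (hn : 1 < n) (hc : n < c)
    (ha : 0 < a) (hab : a < gammaOf n c / 2) {x w : L2C} {k : ℝ} (hk : k ≠ 0)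
    (hw : Represents w (-a) fun x => k * baseFun n m f x)
    (hx : ∀ w u, (h.coeffs hn hc).Rel a w u → inner ℂ u x = 0) : ∃ α : ℂ, x = α • w := by
  have hb := half_gamma_pos hn hc
  obtain ⟨β, hβ⟩ := Coeffs.exists_eq_of_orthogonal_range ha hab
    (dec_leftW_of_expW hb.le (h.dec_primW hn hc)) (fun x => (h.primW_hasDerivAt x).deriv) hx
  refine ⟨β * (k : ℂ)⁻¹, Lp.ext ?_⟩
  filter_upwards [hβ, hw, Lp.coeFn_smul (β * (k : ℂ)⁻¹) w] with t h1 h2 h3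
  have hk' : (k : ℂ) ≠ 0 := Complex.ofReal_ne_zero.2 hk
  rw [h1, h3, Pi.smul_apply, h2, smul_eq_mul, h.baseFun_eq hn hc]
  push_cast
  field_simp

/-- Left primitives of the preimages. -/
theorem integral_Iic_preimage (h : IsSolitaryWave n m c f) (hn : 1 < n) (hc : n < c) {g₀ : ℝ → ℝ}
    (hg₀ : Dec (expW (gammaOf n c / 2)) g₀) (k x : ℝ) :
    ∫ t in Set.Iic x, (g₀ t + k * (f t ^ (-n) * psi m f t)) =
      (∫ t in Set.Iic x, g₀ t) + k * primW n m f x := by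
  have hb := half_gamma_pos hn hc
  have dw : Dec (expW (gammaOf n c / 2)) fun x => f x ^ (-n) * psi m f x :=
    ((h.dec_wOne hn hc).1 (-n)).one_mul (h.dec_psi hn hc)
  rw [integral_add (integrable_of_dec hb hg₀).integrableOn
    ((integrable_of_dec hb dw).const_mul k).integrableOn, integral_const_mul,
    integral_Iic_of_hasDerivAt_of_tendsto' (fun t _ => h.primW_hasDerivAt t)
      (integrable_of_dec hb dw).integrableOn
      (Coeffs.tendsto_zero_of_dec hb (h.dec_primW hn hc)).2, sub_zero]

/-- The Jordan chain of the adjoint operator. -/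
theorem exists_adjoint_chain (h : IsSolitaryWave n m c f) (hn : 1 < n) (hc : n < c) (ha : 0 < a)
    (hab : a < gammaOf n c / 2) {g : ℝ → ℝ} (hg : Dec (expW (gammaOf n c / 2)) g)
    (he : ∀ x, (h.coeffs hn hc).L g x = baseFun n m f x) (k : ℝ) :
    ∃ η₀ η₁ : L2C,
      Represents η₀ (-a) (fun x => k * adjM n m f (fun y => ∫ t in Set.Iic y, g t) x) ∧
      Represents η₁ (-a) (fun x => k * baseFun n m f x) ∧
      (η₁, 0) ∈ (linOp n m c a f).adjoint.graph ∧
      (η₀, -η₁) ∈ (linOp n m c a f).adjoint.graph := by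
  have hb := half_gamma_pos hn hc
  set P := h.coeffs hn hc with hP
  have dW : Dec (leftW P.b) (primW n m f) := dec_leftW_of_expW hb.le (h.dec_primW hn hc)
  obtain ⟨dG, hG⟩ := dec_primitive hb hg
  have dG' : Dec (leftW P.b) fun x => ∫ t in Set.Iic x, g t := dG
  obtain ⟨η₀, r₀⟩ := Coeffs.exists_represents_left (P := P) ha hab ((P.dec_M dG').const_mul k)
  obtain ⟨η₁, r₁⟩ := Coeffs.exists_represents_left (P := P) ha hab ((P.dec_M dW).const_mul k)
  have r₁' : Represents η₁ (-a) (fun x => k * baseFun n m f x) := by rwa [h.baseFun_eq hn hc]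
  have eD : ∀ {χ : ℝ → ℝ}, ContDiff ℝ ∞ χ → ∀ x, -P.L (deriv fun y => k * χ y) x =
      -(k * P.L (deriv χ) x) := fun {χ} hχ x => by
    have : (deriv fun y => k * χ y) = fun y => k * deriv χ y := funext fun y =>
      ((hasDerivAt_of_smooth hχ y).const_mul k).deriv
    rw [this, P.L_const_mul (contDiff_infty_deriv hχ)]
  refine ⟨η₀, η₁, r₀, r₁', ?_, ?_⟩
  -- Here χ = W: φ^n W' = ψ is the zero mode, so L⋆W' = 0.
  · rw [h.mem_adjoint_graph_iff hn hc ha hab]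
    intro w u hwu
    refine hwu.inner_eq ha hab (dW.const_mul k)
      (r₁.congr fun x => (P.M_const_mul dW.contDiff k x).symm) (Represents.zero.congr fun x => ?_)
    have e1 : (fun y => P.r y * deriv (primW n m f) y) = P.ψ := by
      ext y
      have h2 := P.ri_mul y
      rw [(h.primW_hasDerivAt y).deriv]
      change P.r y * (P.ri y * P.ψ y) = _
      linear_combination P.ψ y * h2
    have h2 := P.ri_mul x
    rw [eD dW.contDiff, Coeffs.L, e1, P.ψ_ode, (h.primW_hasDerivAt x).deriv]
    change 0 = -(k * (_ + P.c * P.σ x * P.q x * P.r x * (P.ri x * P.ψ x)))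
    linear_combination (k * P.c * P.σ x * P.q x * P.ψ x) * h2
  -- Here χ is the left primitive of g: L⋆χ' = L⋆g = M⋆W, which produces -η₁.
  · rw [h.mem_adjoint_graph_iff hn hc ha hab]
    intro w u hwu
    refine hwu.inner_eq ha hab (dG'.const_mul k)
      (r₀.congr fun x => (P.M_const_mul dG'.contDiff k x).symm) (r₁'.neg.congr fun x => ?_)
    rw [eD dG'.contDiff, show (deriv fun x => ∫ t in Set.Iic x, g t) = g from
      funext fun x => (hG x).deriv, he]

end IsSolitaryWave

/-! ### Generalized kernels and biorthogonal normalization -/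

open IsSolitaryWave

theorem mainTheorem11 (n m c a : ℝ) (hn : 1 < n) (hc : n < c) (φ : ℝ → ℝ → ℝ)
    (hφ : ∀ᶠ s in 𝓝 c, IsSolitaryWave n m s (φ s))
    (ha : 0 < a) (haStar : a ≤ aStar n m c (φ c)) (hN : dEnergy n m φ c ≠ 0) :
    (∀ x, DifferentiableAt ℝ (fun s => φ s x) c) ∧
    (linOp n m c a (φ c)).graph = linGraph n m c a (φ c) ∧
    Dense ((linOp n m c a (φ c)).domain : Set L2C) ∧
    ∃ ξ : Fin 2 → L2C,
      Represents (ξ 0) a (deriv (φ c)) ∧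
      Represents (ξ 1) a (fun x => deriv (fun s => φ s x) c) ∧
      (ξ 0, 0) ∈ (linOp n m c a (φ c)).graph ∧
      (ξ 1, -ξ 0) ∈ (linOp n m c a (φ c)).graph ∧
      IsBasisOf ξ (genKer (linOp n m c a (φ c))) ∧
      (∀ g : ℝ → ℝ, IsPreimage n m c (φ c) g →
        ∃ η : Fin 2 → L2C,
          Represents (η 0) (-a) (etaTilde₁ n m φ c g) ∧
          Represents (η 1) (-a) (etaTilde₂ n m φ c) ∧
          (η 1, 0) ∈ (linOp n m c a (φ c)).adjoint.graph ∧
          (η 0, -η 1) ∈ (linOp n m c a (φ c)).adjoint.graph ∧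
          IsBasisOf η (genKer (linOp n m c a (φ c)).adjoint)) ∧
      (∃! g : ℝ → ℝ, IsPreimage n m c (φ c) g ∧
        ∃ η : Fin 2 → L2C,
          Represents (η 0) (-a) (etaTilde₁ n m φ c g) ∧
          Represents (η 1) (-a) (etaTilde₂ n m φ c) ∧
          ∀ i j, inner ℂ (ξ i) (η j) = if i = j then 1 else 0) := by
  have h := hφ.self_of_nhds
  have hb := half_gamma_pos hn hc
  have hab := lt_b hn hc haStar
  have hab' : |a| < gammaOf n c / 2 := by rwa [abs_of_pos ha]
  obtain ⟨v, hv, hve, hd1, hd2, hC⟩ := exists_variation hn hc hφ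
  have hdE := dEnergy_eq hn hc hφ hv hd1 hd2 hC
  set Θ := (dEnergy n m φ c)⁻¹ with hΘ
  have hΘ0 : Θ ≠ 0 := inv_ne_zero hN
  set P := h.coeffs hn hc with hP
  have dz : Dec (expW (gammaOf n c / 2)) fun x => φ c x ^ m * v x := P.dec_σi.one_mul hv
  have hz : (fun x => deriv (fun s => φ s x) c) = fun x => φ c x ^ m * v x :=
    funext fun x => (hd1 x).deriv
  have dφ : Dec (expW (gammaOf n c / 2)) (deriv (φ c)) := by
    rw [show deriv (φ c) = _ from funext h.deriv_eq]
    exact P.dec_σi.one_mul P.dec_ψ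
  obtain ⟨ξ₀, rξ₀⟩ := exists_represents (memLp_exp_mul hab' dφ)
  obtain ⟨ξ₁, rξ₁⟩ := exists_represents (memLp_exp_mul hab' dz)
  have rel₀ := h.rel_deriv hn hc rξ₀
  have rel₁ := h.rel_variation hn hc hv.contDiff hve rξ₁ rξ₀
  have g₀ := (h.mem_graph_iff hn hc ha hab).2 rel₀
  have g₁ := (h.mem_graph_iff hn hc ha hab).2 rel₁
  obtain ⟨γ₀, hγ₀, hγ₀e⟩ := h.exists_dec_preimage hn hc
  have dwm : Dec (expW (gammaOf n c / 2)) fun x => φ c x ^ (-n) * psi m (φ c) x :=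
    P.dec_ri.one_mul P.dec_ψ
  have hpre := h.isPreimage_iff hn hc hγ₀ hγ₀e
  have hpreDec : ∀ g, IsPreimage n m c (φ c) g → Dec (expW (gammaOf n c / 2)) g := fun g hg => by
    obtain ⟨k, rfl⟩ := (hpre g).1 hg
    exact hγ₀.add (dwm.const_mul k)
  have chain : ∀ g, IsPreimage n m c (φ c) g → ∃ η₀ η₁ : L2C,
      Represents η₀ (-a) (etaTilde₁ n m φ c g) ∧ Represents η₁ (-a) (etaTilde₂ n m φ c) ∧
      (η₁, 0) ∈ (linOp n m c a (φ c)).adjoint.graph ∧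
      (η₀, -η₁) ∈ (linOp n m c a (φ c)).adjoint.graph := fun g hg =>
    h.exists_adjoint_chain hn hc ha hab (hpreDec g hg)
      (fun x => by rw [← h.adjL_eq hn hc]; exact hg.eq x) Θ
  -- The weights e^(ax) and e^(-ax) cancel, and what remains is Θ ∫ (M⋆W) ∂_cφ = Θ ∂_c𝒩.
  have pair₁₁ : ∀ {η₁ : L2C}, Represents η₁ (-a) (etaTilde₂ n m φ c) → inner ℂ ξ₁ η₁ = 1 := by
    intro η₁ r₁
    rw [inner_eq_integral rξ₁ r₁]
    have e : ∫ x, φ c x ^ m * v x * etaTilde₂ n m φ c x = 1 := by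
      have : ∀ x, φ c x ^ m * v x * etaTilde₂ n m φ c x =
          Θ * (baseFun n m (φ c) x * (φ c x ^ m * v x)) := fun x => by
        rw [etaTilde₂]; ring
      simp only [this]
      rw [integral_const_mul, ← hdE, hΘ, inv_mul_cancel₀ hN]
    rw [e, Complex.ofReal_one]
  -- Pairing A ξ₁ = -ξ₀ with η₁ and η₀ and moving A across: ⟨ξ₀, η₁⟩ = 0 and ⟨ξ₀, η₀⟩ = ⟨ξ₁, η₁⟩,
  -- whatever preimage is used.
  have pairs : ∀ {η₀ η₁ : L2C}, Represents η₁ (-a) (etaTilde₂ n m φ c) →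
      (η₁, 0) ∈ (linOp n m c a (φ c)).adjoint.graph →
      (η₀, -η₁) ∈ (linOp n m c a (φ c)).adjoint.graph →
      inner ℂ ξ₀ η₁ = 0 ∧ inner ℂ ξ₀ η₀ = 1 := by
    intro η₀ η₁ r₁ G₁ G₀
    have e1 := (h.mem_adjoint_graph_iff hn hc ha hab).1 G₁ _ _ rel₁
    have e0 := (h.mem_adjoint_graph_iff hn hc ha hab).1 G₀ _ _ rel₁
    rw [inner_neg_left, inner_zero_right, neg_eq_zero] at e1
    rw [inner_neg_left, inner_neg_right, neg_inj, pair₁₁ r₁] at e0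
    exact ⟨e1, e0⟩
  have basisT : ∀ {η₀ η₁ : L2C}, Represents η₁ (-a) (etaTilde₂ n m φ c) →
      (η₁, 0) ∈ (linOp n m c a (φ c)).adjoint.graph →
      (η₀, -η₁) ∈ (linOp n m c a (φ c)).adjoint.graph →
      IsBasisOf ![ξ₀, ξ₁] (genKer (linOp n m c a (φ c))) ∧
      IsBasisOf ![η₀, η₁] (genKer (linOp n m c a (φ c)).adjoint) := by
    intro η₀ η₁ r₁ G₁ G₀
    obtain ⟨p01, p00⟩ := pairs r₁ G₁ G₀
    have p11 := pair₁₁ r₁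
    refine ⟨⟨LinearIndependent.pair_iff.2 fun s t hst => ?_, ?_⟩,
      ⟨LinearIndependent.pair_iff.2 fun s t hst => ?_, ?_⟩⟩
    · have e1 := congrArg (fun x => inner ℂ η₁ x) hst
      have e2 := congrArg (fun x => inner ℂ η₀ x) hst
      have q01 : inner ℂ η₁ ξ₀ = 0 := inner_eq_zero_symm.1 p01
      have q11 : inner ℂ η₁ ξ₁ = 1 := by rw [← inner_conj_symm, p11, map_one]
      have q00 : inner ℂ η₀ ξ₀ = 1 := by rw [← inner_conj_symm, p00, map_one]
      simp only [inner_add_right, inner_smul_right, inner_zero_right, q01, q11, q00] at e1 e2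
      have ht : t = 0 := by linear_combination e1
      rw [ht] at e2
      exact ⟨by linear_combination e2, ht⟩
    · rw [range_pair]
      refine (genKer_eq_span g₀ g₁ (fun x hx => h.exists_eq_smul_of_rel_zero hn hc ha hab rξ₀
        ((h.mem_graph_iff hn hc ha hab).1 hx)) (fun x => inner ℂ η₁ x)
        (fun x y => inner_add_right _ _ _) (fun α x => inner_smul_right _ _ _)
        (fun x y hxy => ?_) ?_).symm
      · have := (h.mem_adjoint_graph_iff hn hc ha hab).1 G₁ _ _
          ((h.mem_graph_iff hn hc ha hab).1 hxy)
        rw [inner_zero_right] at this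
        exact inner_eq_zero_symm.1 this
      · rw [← inner_conj_symm, p11, map_one]; exact one_ne_zero
    · have e1 := congrArg (fun x => inner ℂ ξ₀ x) hst
      have e2 := congrArg (fun x => inner ℂ ξ₁ x) hst
      simp only [inner_add_right, inner_smul_right, inner_zero_right, p01, p11, p00] at e1 e2
      have hs : s = 0 := by linear_combination e1
      rw [hs] at e2
      exact ⟨hs, by linear_combination e2⟩
    -- In the adjoint chain the eigenvector is the second entry. Pairing with ξ₀ annihilates the
    -- range of the adjoint because A ξ₀ = 0.
    · rw [range_pair, Set.pair_comm]
      refine (genKer_eq_span G₁ G₀ (fun x hx => ?_) (fun x => inner ℂ ξ₀ x)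
        (fun x y => inner_add_right _ _ _) (fun α x => inner_smul_right _ _ _)
        (fun x y hxy => ?_) ?_).symm
      · refine h.exists_eq_smul_of_orthogonal hn hc ha hab hΘ0 r₁ fun w u hwu => ?_
        rw [(h.mem_adjoint_graph_iff hn hc ha hab).1 hx _ _ hwu, inner_zero_right]
      · have := (h.mem_adjoint_graph_iff hn hc ha hab).1 hxy _ _ rel₀
        rw [inner_zero_left] at this
        exact this.symm
      · rw [p00]; exact one_ne_zero
  -- The only pairing the chain relations leave free, ⟨ξ₁, η₀⟩, evaluated for the reference preimage
  -- γ₀.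
  set I₀ := Θ * ∫ x, φ c x ^ m * v x * P.M (fun y => ∫ t in Set.Iic y, γ₀ t) x with hI₀
  have dG : Dec (leftW P.b) fun x => ∫ t in Set.Iic x, γ₀ t := (dec_primitive hb hγ₀).1
  have pair₁₀ : ∀ (k : ℝ) {η₀ : L2C}, Represents η₀ (-a) (etaTilde₁ n m φ c fun x =>
      γ₀ x + k * (φ c x ^ (-n) * psi m (φ c) x)) → inner ℂ ξ₁ η₀ = ((I₀ + k : ℝ) : ℂ) := by
    intro k η₀ r₀
    rw [inner_eq_integral rξ₁ r₀]
    congr 1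
    have dW := h.dec_primW hn hc
    have e1 : ∀ x, φ c x ^ m * v x * etaTilde₁ n m φ c (fun x =>
        γ₀ x + k * (φ c x ^ (-n) * psi m (φ c) x)) x =
        Θ * (φ c x ^ m * v x * P.M (fun y => ∫ t in Set.Iic y, γ₀ t) x) +
          k * (Θ * (baseFun n m (φ c) x * (φ c x ^ m * v x))) := fun x => by
      rw [etaTilde₁, h.adjM_eq hn hc, h.baseFun_eq hn hc]
      simp only [h.integral_Iic_preimage hn hc hγ₀]
      rw [P.M_add_const_mul dG.contDiff dW.contDiff]
      ring
    have dM1 : Dec wOne (P.M fun y => ∫ t in Set.Iic y, γ₀ t) :=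
      (P.dec_M dG).mono (K := 1) (leftW_nonneg _) fun x => by
        rw [one_mul]; exact leftW_le_one _ x
    have i1 : Integrable fun x => φ c x ^ m * v x * P.M (fun y => ∫ t in Set.Iic y, γ₀ t) x :=
      integrable_of_dec hb (dz.mul_one dM1)
    have i2 : Integrable fun x => baseFun n m (φ c) x * (φ c x ^ m * v x) := by
      rw [h.baseFun_eq hn hc]
      exact integrable_of_dec hb ((P.dec_M (dW.wOne_of_expW hb.le)).one_mul dz)
    simp only [e1]
    rw [integral_add (i1.const_mul _) ((i2.const_mul _).const_mul _), integral_const_mul,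
      integral_const_mul, integral_const_mul, ← hdE, hΘ, inv_mul_cancel₀ hN, mul_one]
  refine ⟨fun x => (hd1 x).differentiableAt, h.linOp_graph hn hc ha hab,
    h.dense_domain hn hc ha hab, ![ξ₀, ξ₁], rξ₀, ?_, g₀, g₁, ?_, fun g hg => ?_, ?_⟩
  · rw [hz]; exact rξ₁
  · obtain ⟨η₀, η₁, -, r₁, G₁, G₀⟩ := chain γ₀ ((hpre γ₀).2 ⟨0, by simp⟩)
    exact (basisT r₁ G₁ G₀).1
  · obtain ⟨η₀, η₁, r₀, r₁, G₁, G₀⟩ := chain g hg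
    exact ⟨![η₀, η₁], r₀, r₁, G₁, G₀, (basisT r₁ G₁ G₀).2⟩
  -- Adding kW' to the preimage adds kη₁ to η₀, and ⟨ξ₁, η₁⟩ = 1, so the free pairing becomes I₀ +
  -- k; it vanishes exactly for k = -I₀.
  · refine ⟨fun x => γ₀ x + -I₀ * (φ c x ^ (-n) * psi m (φ c) x), ⟨(hpre _).2 ⟨-I₀, rfl⟩, ?_⟩, ?_⟩
    · obtain ⟨η₀, η₁, r₀, r₁, G₁, G₀⟩ := chain _ ((hpre _).2 ⟨-I₀, rfl⟩)
      obtain ⟨p01, p00⟩ := pairs r₁ G₁ G₀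
      have p11 := pair₁₁ r₁
      have p10 := pair₁₀ (-I₀) r₀
      rw [add_neg_cancel, Complex.ofReal_zero] at p10
      refine ⟨![η₀, η₁], r₀, r₁, fun i j => ?_⟩
      fin_cases i <;> fin_cases j <;> simp [p00, p01, p10, p11]
    · rintro g ⟨hg, η, r₀, r₁, hη⟩
      obtain ⟨k, rfl⟩ := (hpre g).1 hg
      have e1 := hη 1 0
      have e2 : inner ℂ ξ₁ (η 0) = ((I₀ + k : ℝ) : ℂ) := pair₁₀ k r₀
      have e3 : inner ℂ ξ₁ (η 0) = 0 := by simpa using e1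
      rw [e3, eq_comm, Complex.ofReal_eq_zero] at e2
      rw [show k = -I₀ by linarith]

end
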